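/- Let $k$ be a field and let $H=\bigoplus_{n\in\mathbb Z}H^n$ be a $\mathbb Z$-graded $k$-algebra with $H^0=k$, generated as a $k$-algebra by finitely many homogeneous elements of positive degree, and graded commutative: $ab=(-1)^{|a||b|}ba$ for homogeneous $a,b$. Let $\mathfrak m=\bigoplus_{n>0}H^n$. Let $M$ be a finitely generated graded $H$-module of Krull dimension $r$. Let $R=k[\zeta_1,\dots,\zeta_r]$ be a polynomial ring with $|\zeta_i|=n_i>0$, and let $R\to H$ be a homomorphism of graded $k$-algebras such that $M$ is finitely generated as an $R$-module and $\zeta_1,\dots,\zeta_r$ is filter-regular for $M$. The latter means that $M/(\zeta_1,\dots,\zeta_r)M$ has finite length and there are integers $e_0,\dots,e_r$ with $e_{i-1}-1\le e_i\le e_{i-1}$ for $1\le i\le r$ such that for $0\le i\le r-1$ multiplication by $\zeta_{i+1}$ is injective on $(M/(\zeta_1,\dots,\zeta_i)M)^j$ for all $j>n_1+\dots+n_i+e_i$, and $(M/(\zeta_1,\dots,\zeta_r)M)^j=0$ for all $j>n_1+\dots+n_r+e_r$. For $i\ge 0$ let $H^{i,n}_{\mathfrak m}M$ be the degree $n$ part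 of the $i$-th local cohomology of $M$, i.e. of the $i$-th cohomology of the stable Koszul (Čech) complex of $M$ with respect to any finite family of homogeneous central elements of positive degree in $H$ generating $\mathfrak m$ up to radical (such families exist), and put $$a^i_{\mathfrak m}(M)=\max\{n\in\mathbb Z\mid H^{i,n}_{\mathfrak m}M\ne 0\},\qquad \operatorname{Reg}M=\max_{i\ge 0}\{a^i_{\mathfrak m}(M)+i\},$$ with $a^i_{\mathfrak m}(M)=-\infty$ if $H^i_{\mathfrak m}M=0$. Then $M$ has a minimal graded free resolution $\cdots\to F_1\to F_0\to M\to 0$ over $R$ with all $F_j$ of finite rank. For any such resolution let $\beta^R_j(M)$ be the largest degree of a generator of $F_j$, or $-\infty$ if $F_j=0$. The following hold. 1. For all integers $d_0,\dots,d_r$ satisfying (a) $d_i\ge d_{i-1}-1$ and (b) $d_{i-1}\ge d_i$ for $1\le i\le r$, $$\max_{0\le i\le r}\{a^i_{\mathfrak m}(M)-d_i\}=\max_{0\le i\le r}\{\beta^R_{r-i}(M)-d_i\}-\sum_{j=1}^r n_j .$$ 2. $\displaystyle\max_{i\ge 0}\{a^i_{\mathfrak m}(M)\}=\max_{i\ge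 0}\{\beta^R_i(M)\}-\sum_{j=1}^r n_j .$ 3. $\displaystyle\operatorname{Reg}M=\max_{i\ge 0}\{\beta^R_i(M)-i\}-\sum_{j=1}^r(n_j-1).$ -/

import Mathlib

noncomputable section

/-! ### Graded-commutative rings -/

/-- The `ℤ`-graded `k`-algebra `H = ⨁ 𝒜 n` has `H⁰ = k`, is generated as a `k`-algebra by finitely
many homogeneous elements of positive degree, and is graded commutative:
`a b = (-1)^{|a||b|} b a`. -/
structure IsGradedCommutativeFG {k H : Type*} [Field k] [Ring H] [Algebra k H]
    (𝒜 : ℤ → Submodule k H) : Prop where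
  injective_algebraMap : Function.Injective (algebraMap k H)
  zero_part : ∀ h : H, h ∈ 𝒜 0 ↔ ∃ c : k, algebraMap k H c = h
  generated : ∃ t : Finset H, (∀ h ∈ t, ∃ n : ℤ, 0 < n ∧ h ∈ 𝒜 n) ∧
    Algebra.adjoin k (t : Set H) = ⊤
  graded_comm : ∀ (i j : ℤ) (a b : H), a ∈ 𝒜 i → b ∈ 𝒜 j → a * b = (i * j).negOnePow • (b * a)

/-- Krull dimension of a finitely generated module: the supremum of the lengths of chains of prime
ideals containing its annihilator.  (`Ideal.IsPrime` asks that `a b ∈ 𝔭` implies `a ∈ 𝔭` or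
`b ∈ 𝔭`; in a graded-commutative ring such a left ideal contains every odd element when
`2 ≠ 0`, so these are the primes of a commutative quotient of the ring.) -/
def moduleKrullDim (H M : Type*) [Ring H] [AddCommGroup M] [Module H M] : WithBot ℕ∞ :=
  Order.krullDim {p : Ideal H // p.IsPrime ∧ Module.annihilator H M ≤ p}

/-! ### Top degrees -/

/-- The maximum of a set of integers, in `ℤ ∪ {±∞}`: it is `⊥` for the empty set and `⊤` for a set
that is not bounded above. -/
def topDegree (S : Set ℤ) : EReal := ⨆ n ∈ S, ((n : ℝ) : EReal)

/-! ### Local cohomology -/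

section Cech

variable {C : Type*} [CommRing C] (M : Type*) [AddCommGroup M] [Module C M]
  {s : ℕ} (x : Fin s → C)

/-- `M[1/x_j : j ∈ S]`. -/
abbrev CechTerm (S : Finset (Fin s)) : Type _ :=
  LocalizedModule (Submonoid.closure (x '' (S : Set (Fin s)))) M

/-- The canonical map `M[1/x_j : j ∈ S] → M[1/x_j : j ∈ T]` for `S ⊆ T`. -/
def cechRestrict {S T : Finset (Fin s)} (h : S ⊆ T) : CechTerm M x S →ₗ[C] CechTerm M x T :=
  LocalizedModule.liftOfLE (Submonoid.closure (x '' (S : Set (Fin s))))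
    (Submonoid.closure (x '' (T : Set (Fin s))))
    (Submonoid.closure_mono (Set.image_mono (Finset.coe_subset.mpr h)))

/-- The degree `i` term `⨁_{|S| = i} M[1/x_j : j ∈ S]` of the stable Koszul (Čech) complex. -/
abbrev CechCochain (i : ℕ) : Type _ :=
  (S : {S : Finset (Fin s) // S.card = i}) → CechTerm M x S.1

/-- The differential: its component at `T` is
`∑_{j ∈ T} (-1)^{#{l ∈ T : l < j}} (c_{T ∖ {j}} restricted to T)`. -/
def cechDifferential (i : ℕ) : CechCochain M x i →ₗ[C] CechCochain M x (i + 1) :=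
  LinearMap.pi fun T => ∑ j : {j // j ∈ T.1},
    ((-1 : ℤ) ^ (T.1.filter (· < j.1)).card) •
      (cechRestrict M x (T.1.erase_subset j.1) ∘ₗ
        LinearMap.proj (⟨T.1.erase j.1, by
          rw [Finset.card_erase_of_mem j.2, T.2, Nat.add_sub_cancel]⟩ :
            {S : Finset (Fin s) // S.card = i}))

/-- Coboundaries of the stable Koszul complex. -/
def cechBoundaries : (i : ℕ) → Submodule C (CechCochain M x i)
  | 0 => ⊥
  | i + 1 => LinearMap.range (cechDifferential M x i)

end Cech

/-- Homogeneous central elements `x_1, …, x_s` of positive degree in `H` which generate the ideal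
`𝔪` of positive degree elements up to radical. -/
structure ParameterSystem {k H : Type*} [Field k] [Ring H] [Algebra k H]
    (𝒜 : ℤ → Submodule k H) where
  /-- number of elements -/
  s : ℕ
  /-- the elements -/
  x : Fin s → Subalgebra.center k H
  /-- their degrees -/
  e : Fin s → ℤ
  e_pos : ∀ j, 0 < e j
  x_mem : ∀ j, (x j : H) ∈ 𝒜 (e j)
  radical : ∀ n : ℤ, 0 < n → ∀ h ∈ 𝒜 n,
    ∃ N : ℕ, h ^ N ∈ Ideal.span (Set.range fun j => (x j : H))

section LocalCohomology

variable {k H M : Type*} [Field k] [Ring H] [Algebra k H] {𝒜 : ℤ → Submodule k H}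
  [AddCommGroup M] [Module k M] [Module H M]

/-- An element of `M[1/x_j : j ∈ S]` is homogeneous of degree `n` if it is a fraction `m / u` with
`u` a product of `x_j`'s of some degree `e` and `m ∈ M` homogeneous of degree `n + e`. -/
def CechTerm.IsHomogeneous (X : ParameterSystem 𝒜) (ℳ : ℤ → Submodule k M)
    {S : Finset (Fin X.s)} (n : ℤ) (z : CechTerm M X.x S) : Prop :=
  ∃ (e : ℤ) (m : M) (u : Submonoid.closure (X.x '' (S : Set (Fin X.s)))),
    ((u : Subalgebra.center k H) : H) ∈ 𝒜 e ∧ m ∈ ℳ (n + e) ∧ z = LocalizedModule.mk m u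

/-- The set of `n` with `H^{i,n}_𝔪(M) ≠ 0`, where `H^{i,n}_𝔪(M)` is the degree `n` part of the
`i`-th cohomology of the stable Koszul complex of `M`: some homogeneous cocycle of degree `n` is not
a coboundary. -/
def localCohomologyDegrees (X : ParameterSystem 𝒜) (ℳ : ℤ → Submodule k M) (i : ℕ) : Set ℤ :=
  {n | ∃ c : CechCochain M X.x i, (∀ S, CechTerm.IsHomogeneous X ℳ n (c S)) ∧
    cechDifferential M X.x i c = 0 ∧ c ∉ cechBoundaries M X.x i}

/-- `a^i_𝔪(M) = max {n | H^{i,n}_𝔪(M) ≠ 0}`, with value `-∞` if `H^i_𝔪(M) = 0`. -/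
def aInvariant (X : ParameterSystem 𝒜) (ℳ : ℤ → Submodule k M) (i : ℕ) : EReal :=
  topDegree (localCohomologyDegrees X ℳ i)

/-- Castelnuovo–Mumford regularity `Reg M = max_{j ≥ 0} (a^j_𝔪(M) + j)`. -/
def regularity (X : ParameterSystem 𝒜) (ℳ : ℤ → Submodule k M) : EReal :=
  ⨆ j : ℕ, (aInvariant X ℳ j + ((j : ℝ) : EReal))

end LocalCohomology

/-! ### Filter-regular systems of parameters -/

section Polynomial

variable {k M : Type*} [Field k] [AddCommGroup M] [Module k M] {r : ℕ}
  [Module (MvPolynomial (Fin r) k) M]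

/-- The submodule `(ζ_1, …, ζ_i) M`, where `ζ_1, …, ζ_r` are the variables. -/
def variablesSMul (k M : Type*) [Field k] [AddCommGroup M] (r : ℕ)
    [Module (MvPolynomial (Fin r) k) M] (i : ℕ) : Submodule (MvPolynomial (Fin r) k) M :=
  Ideal.span {p : MvPolynomial (Fin r) k | ∃ j : Fin r, (j : ℕ) < i ∧ p = MvPolynomial.X j} •
    (⊤ : Submodule (MvPolynomial (Fin r) k) M)

/-- Conditions `d_i ≥ d_{i-1} - 1` and `d_{i-1} ≥ d_i` for `1 ≤ i ≤ r` on integers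
`d_0, …, d_r`. -/
def IsTypeSequence (d : Fin (r + 1) → ℤ) : Prop :=
  (∀ i : Fin r, d i.castSucc - 1 ≤ d i.succ) ∧ (∀ i : Fin r, d i.succ ≤ d i.castSucc)

/-- The variables `ζ_1, …, ζ_r` of degrees `n_1, …, n_r` are a filter-regular system of parameters
of type `(d_0, …, d_r)` for the graded module `M`. -/
def IsFilterRegularOfType (n : Fin r → ℤ) (ℳ : ℤ → Submodule k M) (d : Fin (r + 1) → ℤ) : Prop :=
  IsFiniteLength (MvPolynomial (Fin r) k) (M ⧸ variablesSMul k M r r) ∧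
  (∀ (i : Fin r) (j : ℤ), (∑ t ∈ Finset.Iio i, n t) + d i.castSucc < j → ∀ m ∈ ℳ j,
    (MvPolynomial.X i : MvPolynomial (Fin r) k) • m ∈ variablesSMul k M r i →
      m ∈ variablesSMul k M r i) ∧
  (∀ j : ℤ, (∑ t, n t) + d (Fin.last r) < j → ∀ m ∈ ℳ j, m ∈ variablesSMul k M r r)

/-- The variables are a filter-regular system of parameters for `M`. -/
def IsFilterRegular (n : Fin r → ℤ) (ℳ : ℤ → Submodule k M) : Prop :=
  ∃ d : Fin (r + 1) → ℤ, IsTypeSequence d ∧ IsFilterRegularOfType n ℳ d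

/-! ### Minimal graded free resolutions -/

/-- A minimal graded free resolution `⋯ → F_1 → F_0 → M → 0` over `R = k[ζ_1, …, ζ_r]`,
`|ζ_i| = n_i`.  The module `F_j` is free on a basis of `rank j` elements in degrees `deg j`, the maps
preserve degrees, and minimality is the condition that `F_{j+1}` maps into `(ζ_1, …, ζ_r) F_j`. -/
structure MinimalFreeResolution (n : Fin r → ℤ) (ℳ : ℤ → Submodule k M) where
  /-- ranks of the free modules -/
  rank : ℕ → ℕ
  /-- degrees of the basis elements -/
  deg : ∀ j, Fin (rank j) → ℤ
  /-- the differential `F_{j+1} → F_j` -/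
  diff : ∀ j, (Fin (rank (j + 1)) → MvPolynomial (Fin r) k) →ₗ[MvPolynomial (Fin r) k]
    (Fin (rank j) → MvPolynomial (Fin r) k)
  /-- the augmentation `F_0 → M` -/
  aug : (Fin (rank 0) → MvPolynomial (Fin r) k) →ₗ[MvPolynomial (Fin r) k] M
  diff_homogeneous : ∀ j u v,
    MvPolynomial.IsWeightedHomogeneous n (diff j (Pi.single u 1) v) (deg (j + 1) u - deg j v)
  aug_homogeneous : ∀ u, aug (Pi.single u 1) ∈ ℳ (deg 0 u)
  aug_surjective : Function.Surjective aug
  exact_zero : Function.Exact (diff 0) aug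
  exact_succ : ∀ j, Function.Exact (diff (j + 1)) (diff j)
  minimal : ∀ j w v, MvPolynomial.constantCoeff (diff j w v) = 0

/-- `β_j^R(M)`: the largest degree of a generator of `F_j`, or `-∞` if `F_j = 0`. -/
def MinimalFreeResolution.beta {n : Fin r → ℤ} {ℳ : ℤ → Submodule k M}
    (F : MinimalFreeResolution n ℳ) (j : ℕ) : EReal :=
  topDegree (Set.range (F.deg j))

end Polynomial

end

/-!
The theorem is a form of graded local duality, proved here by hand on Čech complexes.

*Reduction to the polynomial ring.*  The central parameters `x_j` and the variables `ζ_i` act on `M`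
through one commutative ring, `Z(H) ⊗ R`, over which `M` is finite.  Each family lies, up to powers
and modulo operators acting as zero (Cayley–Hamilton, `exists_pow_smul_eq_of_smul_mem`), in the ideal
generated by the other.  Adjoining to a family an element of the radical of its ideal does not change
Čech cohomology (`cechExact_insert_iff`, `cechExact_of_mem_span`), so both families compute the same
graded local cohomology (`cechExact_iff_of_radical`, `cechExact_parameterSystem_iff`).

*Free modules.*  The localizations of `R^m` at products of variables embed in Laurent polynomials
`k[ζ^{±1}]^m`.  A cocycle in which every Laurent monomial has a nonnegative exponent is a coboundary
(`exists_coboundary_of_nonneg`): so the cohomology of a graded free module lives in degree `r`, and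
is spanned there by the monomials with all exponents negative.

*Dimension shifting.*  Let `F` be the minimal resolution of `M`, and `s = ∑ n_l`.  Along `F`,
`H^{i,c}(M)` vanishes if all generators of `F_{r-i}` have degree less than `c + s`
(`MinimalFreeResolution.cechExact_of_deg_lt`).  Conversely, let `v` be a generator of `F_j` whose
degree is not exceeded by the degrees of the generators of `F_{j+1}`.  The socle element
`ζ_1⁻¹ ⋯ ζ_r⁻¹ v` of `H^r(F_j)` maps to zero in `H^r(F_{j-1})` by minimality, is not in the image of
`H^r(F_{j+1})` by degree reasons, and so gives a nonzero class of degree `|v| - s` in `H^{r-j}(M)`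
(`MinimalFreeResolution.not_cechExact`).

*The equalities.*  The first vanishing gives `≤` in each of them.  For `≥`, start from a generator
of `F_{r-i}`; as long as the next module `F_{r-i+1}` has a generator of larger degree, pass to it.
Since `d_{i-1} ≤ d_i + 1`, this does not decrease the degree minus `d_i`, and it stops because
`F_j = 0` for `j > r` (`MinimalFreeResolution.rank_eq_zero`).  The other two equalities are the cases
`d_i = 0` and `d_i = -i` (`topDegree_eq`).

Existence of parameter systems and of minimal resolutions is `nonempty_parameterSystem` and
`nonempty_minimalFreeResolution`.
-/

noncomputable section

/-! ### Čech cochains with values in a coefficient system -/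

section Cochains

variable {ι : Type*} [LinearOrder ι]

/-- The sign with which removing `j` from `T` contributes to the Čech differential. -/
def cechSign (j : ι) (T : Finset ι) : ℤ := (-1) ^ (T.filter (· < j)).card

lemma cechSign_mul_self (j : ι) (T : Finset ι) : cechSign j T * cechSign j T = 1 := by
  rw [cechSign, ← pow_add, ← two_mul, pow_mul]; simp

lemma cechSign_erase_of_lt {j l : ι} {T : Finset ι} (hj : j ∈ T) (h : j < l) :
    cechSign l T = -cechSign l (T.erase j) := by
  have : T.filter (· < l) = insert j ((T.erase j).filter (· < l)) := by
    ext a; simp only [Finset.mem_filter, Finset.mem_insert, Finset.mem_erase]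
    by_cases e : a = j
    · subst e; simp [hj, h]
    · simp [e]
  rw [cechSign, cechSign, this, Finset.card_insert_of_notMem (by simp), pow_succ]; simp

lemma cechSign_erase_of_gt {j l : ι} {T : Finset ι} (h : l < j) :
    cechSign l (T.erase j) = cechSign l T := by
  rw [cechSign, cechSign]
  congr 2
  ext a; simp only [Finset.mem_filter, Finset.mem_erase]
  constructor
  · tauto
  · rintro ⟨h1, h2⟩; exact ⟨⟨(h2.trans h).ne, h1⟩, h2⟩

/-- Removing two elements in the two possible orders gives opposite signs. -/
lemma cechSign_swap {j l : ι} {T : Finset ι} (hj : j ∈ T) (hl : l ∈ T) (h : j ≠ l) :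
    cechSign j T * cechSign l (T.erase j) = -(cechSign l T * cechSign j (T.erase l)) := by
  rcases lt_or_gt_of_ne h with h | h
  · rw [cechSign_erase_of_lt hj h, cechSign_erase_of_gt h]; ring
  · rw [cechSign_erase_of_lt hl h, cechSign_erase_of_gt h]; ring

lemma cechSign_swap' {j l : ι} {T : Finset ι} (hj : j ∈ T) (hl : l ∈ T) (h : j ≠ l) :
    cechSign l (T.erase j) * cechSign j (T.erase l) = -(cechSign j T * cechSign l T) := by
  rcases lt_or_gt_of_ne h with h | h
  · rw [cechSign_erase_of_lt hj h, cechSign_erase_of_gt h]; ring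
  · rw [cechSign_erase_of_lt hl h, cechSign_erase_of_gt h]; ring

variable {A : Finset ι → Type*} [∀ S, AddCommGroup (A S)]

/-- A family of abelian groups indexed by finite sets, with restriction maps `ρ` along inclusions,
is a coefficient system if the restriction maps are functorial. -/
structure IsCoeffSystem (ρ : ∀ ⦃S T : Finset ι⦄, S ⊆ T → A S →+ A T) : Prop where
  refl : ∀ S (x : A S), ρ (subset_refl S) x = x
  trans : ∀ {S T U} (h : S ⊆ T) (h' : T ⊆ U) (x : A S), ρ h' (ρ h x) = ρ (h.trans h') x

/-- The Čech differential on families `(c_S)` of elements of a coefficient system, relative to `V`: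
only elements outside `V` are removed.  It is used on the sets `T` with `V ⊆ T ⊆ U`, which gives
a subquotient of the Čech complex. -/
def coboundary (ρ : ∀ ⦃S T : Finset ι⦄, S ⊆ T → A S →+ A T) (V : Finset ι) (c : ∀ S, A S)
    (T : Finset ι) : A T :=
  ∑ j ∈ T \ V, cechSign j T • ρ (T.erase_subset j) (c (T.erase j))

/-- The restriction of `c_S` to `T`, or `0` if `S` is not contained in `T`. -/
def resTo (ρ : ∀ ⦃S T : Finset ι⦄, S ⊆ T → A S →+ A T) (c : ∀ S, A S) (T S : Finset ι) : A T :=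
  if h : S ⊆ T then ρ h (c S) else 0

variable {ρ : ∀ ⦃S T : Finset ι⦄, S ⊆ T → A S →+ A T}

lemma resTo_of_subset (c : ∀ S, A S) {S T : Finset ι} (h : S ⊆ T) : resTo ρ c T S = ρ h (c S) :=
  dif_pos h

lemma resTo_self (hρ : IsCoeffSystem ρ) (c : ∀ S, A S) (T : Finset ι) : resTo ρ c T T = c T := by
  rw [resTo_of_subset c (subset_refl T), hρ.refl]

lemma res_resTo (hρ : IsCoeffSystem ρ) (c : ∀ S, A S) {S T U : Finset ι} (h : S ⊆ T) (h' : T ⊆ U) :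
    ρ h' (resTo ρ c T S) = resTo ρ c U S := by
  rw [resTo_of_subset c h, resTo_of_subset c (h.trans h'), hρ.trans]

lemma coboundary_eq (V : Finset ι) (c : ∀ S, A S) (T : Finset ι) :
    coboundary ρ V c T = ∑ j ∈ T \ V, cechSign j T • resTo ρ c T (T.erase j) :=
  Finset.sum_congr rfl fun j _ => by rw [resTo_of_subset c (T.erase_subset j)]

lemma coboundary_add (V : Finset ι) (c c' : ∀ S, A S) (T : Finset ι) :
    coboundary ρ V (fun S => c S + c' S) T = coboundary ρ V c T + coboundary ρ V c' T := by
  simp [coboundary, Finset.sum_add_distrib]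

lemma coboundary_sub (V : Finset ι) (c c' : ∀ S, A S) (T : Finset ι) :
    coboundary ρ V (fun S => c S - c' S) T = coboundary ρ V c T - coboundary ρ V c' T := by
  simp [coboundary, Finset.sum_sub_distrib, smul_sub]

lemma coboundary_sum {κ : Type*} (K : Finset κ) (V : Finset ι) (c : κ → ∀ S, A S) (T : Finset ι) :
    coboundary ρ V (fun S => ∑ a ∈ K, c a S) T = ∑ a ∈ K, coboundary ρ V (c a) T := by
  simp only [coboundary, map_sum, Finset.smul_sum]
  rw [Finset.sum_comm]

lemma coboundary_congr {V : Finset ι} {c c' : ∀ S, A S} {T : Finset ι}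
    (h : ∀ j ∈ T, j ∉ V → c (T.erase j) = c' (T.erase j)) :
    coboundary ρ V c T = coboundary ρ V c' T :=
  Finset.sum_congr rfl fun j hj => by
    rw [Finset.mem_sdiff] at hj
    rw [h j hj.1 hj.2]

lemma coboundary_mem {P : ∀ S, AddSubgroup (A S)}
    (hP : ∀ ⦃S T : Finset ι⦄ (h : S ⊆ T), ∀ x ∈ P S, ρ h x ∈ P T) (V : Finset ι) {c : ∀ S, A S}
    (hc : ∀ S, c S ∈ P S) (T : Finset ι) : coboundary ρ V c T ∈ P T :=
  sum_mem fun _ _ => zsmul_mem (hP _ _ (hc _)) _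

/-- A map of coefficient systems commutes with the differentials. -/
lemma map_coboundary {B : Finset ι → Type*} [∀ S, AddCommGroup (B S)]
    {σ : ∀ ⦃S T : Finset ι⦄, S ⊆ T → B S →+ B T} (f : ∀ S, A S →+ B S)
    (hf : ∀ ⦃S T : Finset ι⦄ (h : S ⊆ T) (x : A S), f T (ρ h x) = σ h (f S x))
    (V : Finset ι) (c : ∀ S, A S) (T : Finset ι) :
    f T (coboundary ρ V c T) = coboundary σ V (fun S => f S (c S)) T := by
  simp [coboundary, hf]

lemma coboundary_coboundary (hρ : IsCoeffSystem ρ) (V : Finset ι) (c : ∀ S, A S) (T : Finset ι) :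
    coboundary ρ V (coboundary ρ V c) T = 0 := by
  have h1 : coboundary ρ V (coboundary ρ V c) T =
      ∑ p ∈ ((T \ V) ×ˢ (T \ V)).filter (fun p => p.1 ≠ p.2),
        (cechSign p.1 T * cechSign p.2 (T.erase p.1)) • resTo ρ c T ((T.erase p.1).erase p.2) := by
    rw [Finset.sum_filter, Finset.sum_product, coboundary]
    refine Finset.sum_congr rfl fun j hj => ?_
    rw [coboundary_eq, map_sum, Finset.smul_sum, ← Finset.sum_filter]
    refine Finset.sum_congr ?_ fun l hl => ?_
    · ext l; simp only [Finset.mem_sdiff, Finset.mem_erase, Finset.mem_filter]; tauto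
    · rw [map_zsmul, res_resTo hρ _ (Finset.erase_subset _ _), smul_smul]
  rw [h1]
  refine Finset.sum_involution (fun p _ => (p.2, p.1)) ?_ ?_ ?_ ?_
  · rintro ⟨j, l⟩ h
    simp only [Finset.mem_filter, Finset.mem_product, Finset.mem_sdiff] at h
    rw [Finset.erase_right_comm (a := l), ← add_smul, cechSign_swap h.1.1.1 h.1.2.1 h.2]; simp
  · rintro ⟨j, l⟩ h _ e
    simp only [Finset.mem_filter] at h
    exact h.2 (congrArg Prod.snd e)
  · rintro ⟨j, l⟩ h
    simp only [Finset.mem_filter, Finset.mem_product] at h ⊢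
    exact ⟨⟨h.1.2, h.1.1⟩, h.2.symm⟩
  · rintro ⟨j, l⟩ h; rfl

/-- Exactness in degree `i` of the complex of cochains on the sets `T` with `V ⊆ T ⊆ U` and with
values in the subgroups `P`. -/
def CechExact (ρ : ∀ ⦃S T : Finset ι⦄, S ⊆ T → A S →+ A T) (P : ∀ S, AddSubgroup (A S))
    (V U : Finset ι) (i : ℕ) : Prop :=
  ∀ c : ∀ S, A S, (∀ S, c S ∈ P S) →
    (∀ T, V ⊆ T → T ⊆ U → T.card = i + 1 → coboundary ρ V c T = 0) →
    ∃ b : ∀ S, A S, (∀ S, b S ∈ P S) ∧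
      ∀ T, V ⊆ T → T ⊆ U → T.card = i → coboundary ρ V b T = c T

/-- If `A_S → A_{S ∪ j}` is a localization at `a` for all `S`, then `a` acts nilpotently on every
cohomology class: up to a power of `a`, the cochain `S ↦ c_{S ∪ j}` is a contraction. -/
lemma exists_pow_smul_eq_coboundary (hρ : IsCoeffSystem ρ) {P : ∀ S, AddSubgroup (A S)}
    (hP : ∀ ⦃S T : Finset ι⦄ (h : S ⊆ T), ∀ x ∈ P S, ρ h x ∈ P T)
    {C : Type*} [CommRing C] [∀ S, Module C (A S)]
    (hlin : ∀ ⦃S T : Finset ι⦄ (h : S ⊆ T) (a : C) (x : A S), ρ h (a • x) = a • ρ h x)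
    {a : C} (ha : ∀ S, ∀ x ∈ P S, a • x ∈ P S) {V U : Finset ι} {j : ι} (hjU : j ∈ U) (hjV : j ∉ V)
    (lift : ∀ S, j ∉ S → ∀ w ∈ P (insert j S), ∃ K : ℕ, ∃ v ∈ P S,
      ρ (Finset.subset_insert j S) v = a ^ K • w)
    (inj : ∀ S, j ∉ S → ∀ v ∈ P S, ρ (Finset.subset_insert j S) v = 0 → ∃ K : ℕ, a ^ K • v = 0)
    {i : ℕ} {c : ∀ S, A S} (hc : ∀ S, c S ∈ P S)
    (hcoc : ∀ T, V ⊆ T → T ⊆ U → T.card = i + 1 → coboundary ρ V c T = 0) :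
    ∃ K : ℕ, ∃ b : ∀ S, A S, (∀ S, b S ∈ P S) ∧
      ∀ T, V ⊆ T → T ⊆ U → T.card = i → coboundary ρ V b T = a ^ K • c T := by
  have hapow : ∀ (K : ℕ) S, ∀ x ∈ P S, a ^ K • x ∈ P S := by
    intro K; induction K with
    | zero => intro S x hx; simpa using hx
    | succ K ih => intro S x hx; rw [pow_succ', mul_smul]; exact ha _ _ (ih _ _ hx)
  choose! κ v hv hvρ using fun S (h : j ∉ S) => lift S h (c (insert j S)) (hc _)
  let K := ∑ S ∈ U.powerset, κ S
  have hK : ∀ S, S ⊆ U → κ S ≤ K := fun S h =>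
    Finset.single_le_sum (f := κ) (fun _ _ => Nat.zero_le _) (Finset.mem_powerset.mpr h)
  let b0 : ∀ S, A S := fun S => if j ∈ S then 0 else cechSign j (insert j S) • a ^ (K - κ S) • v S
  have hb0 : ∀ S, b0 S ∈ P S := by
    intro S
    by_cases h : j ∈ S
    · simp only [b0, if_pos h]; exact zero_mem _
    · simp only [b0, if_neg h]; exact zsmul_mem (hapow _ _ _ (hv S h)) _
  -- the restriction of `b0` to any set containing `j`
  have hres : ∀ S T, j ∉ S → S ⊆ U → insert j S ⊆ T →
      resTo ρ b0 T S = cechSign j (insert j S) • a ^ K • resTo ρ c T (insert j S) := by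
    intro S T hS hSU hT
    have hST : S ⊆ T := (Finset.subset_insert j S).trans hT
    rw [resTo_of_subset _ hST, resTo_of_subset _ hT]
    simp only [b0, if_neg hS]
    rw [map_zsmul, ← hρ.trans (Finset.subset_insert j S) hT, hlin, hvρ S hS, hlin, hlin, smul_smul,
      ← pow_add, Nat.sub_add_cancel (hK S hSU)]
  have hres0 : ∀ S T, j ∈ S → resTo ρ b0 T S = 0 := by
    intro S T h
    unfold resTo
    split_ifs with hh
    · simp only [b0, if_pos h, map_zero]
    · rfl
  have case1 : ∀ T, V ⊆ T → T ⊆ U → j ∈ T → coboundary ρ V b0 T = a ^ K • c T := by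
    intro T hVT hTU hjT
    rw [coboundary_eq, Finset.sum_eq_single j]
    · rw [hres _ _ (Finset.notMem_erase j T) ((T.erase_subset j).trans hTU)
        (by rw [Finset.insert_erase hjT]), Finset.insert_erase hjT, smul_smul, cechSign_mul_self,
        one_smul, resTo_self hρ]
    · intro l _ hl
      rw [hres0 _ _ (Finset.mem_erase.mpr ⟨fun h => hl h.symm, hjT⟩), smul_zero]
    · intro h; exact absurd (Finset.mem_sdiff.mpr ⟨hjT, hjV⟩) h
  have case2 : ∀ T, V ⊆ T → T ⊆ U → T.card = i → j ∉ T →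
      ρ (Finset.subset_insert j T) (coboundary ρ V b0 T - a ^ K • c T) = 0 := by
    intro T hVT hTU hTi hjT
    have hT'U : insert j T ⊆ U := Finset.insert_subset hjU hTU
    have h0 := hcoc (insert j T) (hVT.trans (Finset.subset_insert j T)) hT'U
      (by rw [Finset.card_insert_of_notMem hjT, hTi])
    have hsd : insert j T \ V = insert j (T \ V) := by
      rw [Finset.insert_sdiff_of_notMem _ hjV]
    rw [coboundary_eq, hsd, Finset.sum_insert (by simp [hjT]), Finset.erase_insert hjT] at h0
    have h1 : ρ (Finset.subset_insert j T) (coboundary ρ V b0 T) =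
        -cechSign j (insert j T) • a ^ K • ∑ l ∈ T \ V, cechSign l (insert j T) •
          resTo ρ c (insert j T) ((insert j T).erase l) := by
      rw [coboundary_eq, map_sum, Finset.smul_sum, Finset.smul_sum]
      refine Finset.sum_congr rfl fun l hl => ?_
      rw [Finset.mem_sdiff] at hl
      have hlj : l ≠ j := fun h => hjT (h ▸ hl.1)
      have e : insert j (T.erase l) = (insert j T).erase l := by
        rw [Finset.erase_insert_of_ne hlj.symm]
      rw [map_zsmul, res_resTo hρ _ (T.erase_subset l), hres _ _ (by simp [hjT])
        ((T.erase_subset l).trans hTU) (Finset.insert_subset_insert _ (T.erase_subset l)), smul_smul, e,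
        smul_comm (a ^ K) (cechSign l (insert j T)), smul_smul]
      congr 1
      have := cechSign_swap' (T := insert j T) (Finset.mem_insert_self j T)
        (Finset.mem_insert_of_mem hl.1) hlj.symm
      rw [Finset.erase_insert hjT] at this
      rw [this]; ring
    have h2 : ∑ l ∈ T \ V, cechSign l (insert j T) • resTo ρ c (insert j T) ((insert j T).erase l) =
        -(cechSign j (insert j T) • resTo ρ c (insert j T) T) := (neg_eq_of_add_eq_zero_right h0).symm
    rw [map_sub, h1, h2, smul_neg, smul_neg, smul_comm (a ^ K), smul_smul, neg_mul,
      cechSign_mul_self, hlin, resTo_of_subset _ (Finset.subset_insert j T)]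
    simp
  have hD : ∀ T, coboundary ρ V b0 T - a ^ K • c T ∈ P T := fun T =>
    sub_mem (coboundary_mem hP V hb0 T) (hapow _ _ _ (hc T))
  have h3 : ∀ T, ∃ K' : ℕ, V ⊆ T → T ⊆ U → T.card = i →
      a ^ K' • (coboundary ρ V b0 T - a ^ K • c T) = 0 := by
    intro T
    by_cases h : V ⊆ T ∧ T ⊆ U ∧ T.card = i
    · by_cases hjT : j ∈ T
      · exact ⟨0, fun _ _ _ => by rw [case1 T h.1 h.2.1 hjT, sub_self, smul_zero]⟩
      · obtain ⟨K', hK'⟩ := inj T hjT _ (hD T) (case2 T h.1 h.2.1 h.2.2 hjT)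
        exact ⟨K', fun _ _ _ => hK'⟩
    · exact ⟨0, fun h1 h2 h3 => absurd ⟨h1, h2, h3⟩ h⟩
  choose κ' hκ' using h3
  let K' := ∑ S ∈ U.powerset, κ' S
  refine ⟨K' + K, fun S => a ^ K' • b0 S, fun S => hapow _ _ _ (hb0 S), fun T h1 h2 h4 => ?_⟩
  have h5 := hκ' T h1 h2 h4
  have h6 : κ' T ≤ K' :=
    Finset.single_le_sum (f := κ') (fun _ _ => Nat.zero_le _) (Finset.mem_powerset.mpr h2)
  have h7 : coboundary ρ V (fun S => a ^ K' • b0 S) T = a ^ K' • coboundary ρ V b0 T := by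
    simp only [coboundary, hlin, Finset.smul_sum]
    exact Finset.sum_congr rfl fun l _ => smul_comm _ _ _
  rw [h7, pow_add, mul_smul, ← sub_eq_zero, ← smul_sub, ← Nat.sub_add_cancel h6, pow_add, mul_smul,
    h5, smul_zero]

end Cochains

/-! ### Comparison and long exact sequence arguments for cochains -/

section Cochains

variable {ι : Type*} [LinearOrder ι] {A : Finset ι → Type*} [∀ S, AddCommGroup (A S)]
  {ρ : ∀ ⦃S T : Finset ι⦄, S ⊆ T → A S →+ A T}

/-- The complex of cochains on the sets between `V` and `U` is exact if some element acting
invertibly on the terms acts as an element of the ideal generated by the `z_j`, `j ∈ U ∖ V`: every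
cohomology class is killed by a power of each `z_j`. -/
lemma cechExact_of_mem_span (hρ : IsCoeffSystem ρ) {C : Type*} [CommRing C] [∀ S, Module C (A S)]
    (hlin : ∀ ⦃S T : Finset ι⦄ (h : S ⊆ T) (a : C) (x : A S), ρ h (a • x) = a • ρ h x)
    {z : ι → C} {V U : Finset ι} {J : Set ι} (hJ : ∀ j ∈ J, j ∈ U ∧ j ∉ V)
    (lift : ∀ j ∈ J, ∀ S, j ∉ S → ∀ w : A (insert j S), ∃ K : ℕ, ∃ v : A S,
      ρ (Finset.subset_insert j S) v = z j ^ K • w)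
    (inj : ∀ j ∈ J, ∀ S, j ∉ S → ∀ v : A S, ρ (Finset.subset_insert j S) v = 0 →
      ∃ K : ℕ, z j ^ K • v = 0)
    {u a : C} (hu : ∀ S, V ⊆ S → Function.Bijective fun x : A S => u • x)
    (ha : a ∈ Ideal.span (z '' J)) (hua : ∀ S, V ⊆ S → ∀ x : A S, u • x = a • x) (i : ℕ) :
    CechExact ρ (fun _ => ⊤) V U i := by
  intro c hc hcoc
  let I : Ideal C :=
    { carrier := {a | ∃ b : ∀ S, A S, ∀ T, V ⊆ T → T ⊆ U → T.card = i →
        coboundary ρ V b T = a • c T}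
      add_mem' := by
        rintro a a' ⟨b, hb⟩ ⟨b', hb'⟩
        exact ⟨fun S => b S + b' S, fun T h1 h2 h3 => by
          rw [coboundary_add, hb T h1 h2 h3, hb' T h1 h2 h3, add_smul]⟩
      zero_mem' := ⟨fun _ => 0, fun T _ _ _ => by simp [coboundary]⟩
      smul_mem' := by
        rintro a a' ⟨b, hb⟩
        refine ⟨fun S => a • b S, fun T h1 h2 h3 => ?_⟩
        rw [smul_eq_mul, mul_smul, ← hb T h1 h2 h3, coboundary, coboundary, Finset.smul_sum]
        exact Finset.sum_congr rfl fun l _ => by rw [hlin, smul_comm] }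
  have hI : a ∈ I.radical := by
    refine Ideal.span_le.mpr ?_ ha
    rintro _ ⟨j, hj, rfl⟩
    obtain ⟨K, b, -, hb⟩ := exists_pow_smul_eq_coboundary hρ (P := fun _ => ⊤)
      (fun _ _ _ _ _ => AddSubgroup.mem_top _) hlin (a := z j) (fun _ _ _ => AddSubgroup.mem_top _)
      (hJ j hj).1 (hJ j hj).2
      (fun S hS w _ => by
        obtain ⟨K, v, h⟩ := lift j hj S hS w
        exact ⟨K, v, AddSubgroup.mem_top _, h⟩)
      (fun S hS v _ => inj j hj S hS v) hc hcoc
    exact ⟨K, b, hb⟩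
  obtain ⟨m, b, hb⟩ := hI
  have hum : ∀ m : ℕ, ∀ S, V ⊆ S → Function.Bijective fun x : A S => u ^ m • x := by
    intro m S hS
    induction m with
    | zero => simp only [pow_zero, one_smul]; exact Function.bijective_id
    | succ m ih =>
      have : (fun x : A S => u ^ (m + 1) • x) = (fun x => u ^ m • x) ∘ fun x => u • x := by
        funext x; simp [pow_succ, mul_smul]
      rw [this]; exact ih.comp (hu S hS)
  have huam : ∀ m : ℕ, ∀ S, V ⊆ S → ∀ x : A S, u ^ m • x = a ^ m • x := by
    intro m S hS
    induction m with
    | zero => simp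
    | succ m ih => intro x; rw [pow_succ, mul_smul, hua S hS, ih, ← mul_smul, ← pow_succ]
  choose! b' hb' using fun S (hS : V ⊆ S) => (hum m S hS).2 (b S)
  refine ⟨b', fun _ => AddSubgroup.mem_top _, fun T h1 h2 h3 => ?_⟩
  apply (hum m T h1).1
  simp only
  rw [huam m T h1 (c T), ← hb T h1 h2 h3, coboundary, coboundary, Finset.smul_sum]
  refine Finset.sum_congr rfl fun j hj => ?_
  have hVj : V ⊆ T.erase j := fun l hl =>
    Finset.mem_erase.mpr ⟨fun e => (Finset.mem_sdiff.mp hj).2 (e ▸ hl), h1 hl⟩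
  have e : u ^ m • b' (T.erase j) = b (T.erase j) := hb' _ hVj
  rw [smul_comm, ← hlin, e]

/-- Exactness passes to direct summands of the coefficient system. -/
lemma CechExact.of_proj {P : ∀ S, AddSubgroup (A S)} (π : ∀ S, A S →+ A S)
    (hπ : ∀ ⦃S T : Finset ι⦄ (h : S ⊆ T) (x : A S), π T (ρ h x) = ρ h (π S x))
    (hmem : ∀ S x, π S x ∈ P S) (hid : ∀ S, ∀ x ∈ P S, π S x = x) {V U : Finset ι} {i : ℕ}
    (h : CechExact ρ (fun _ => ⊤) V U i) : CechExact ρ P V U i := by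
  intro c hc hcoc
  obtain ⟨b, -, hb⟩ := h c (fun _ => AddSubgroup.mem_top _) hcoc
  refine ⟨fun S => π S (b S), fun S => hmem _ _, fun T h1 h2 h3 => ?_⟩
  rw [← map_coboundary π hπ, hb T h1 h2 h3, hid _ _ (hc T)]

variable {P : ∀ S, AddSubgroup (A S)}
  (hP : ∀ ⦃S T : Finset ι⦄ (h : S ⊆ T), ∀ x ∈ P S, ρ h x ∈ P T)

/-- The part of a cochain on the sets containing `y`. -/
def supportedAt (y : ι) (c : ∀ S, A S) (S : Finset ι) : A S := if y ∈ S then c S else 0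

/-- The part of a cochain on the sets not containing `y`. -/
def supportedAway (y : ι) (c : ∀ S, A S) (S : Finset ι) : A S := if y ∈ S then 0 else c S

lemma supportedAt_mem {y : ι} {c : ∀ S, A S} (hc : ∀ S, c S ∈ P S) (S : Finset ι) :
    supportedAt y c S ∈ P S := by
  unfold supportedAt; split_ifs
  exacts [hc S, zero_mem _]

lemma supportedAway_mem {y : ι} {c : ∀ S, A S} (hc : ∀ S, c S ∈ P S) (S : Finset ι) :
    supportedAway y c S ∈ P S := by
  unfold supportedAway; split_ifs
  exacts [zero_mem _, hc S]

lemma coboundary_supportedAt_of_notMem {y : ι} {V T : Finset ι} (c : ∀ S, A S) (hy : y ∉ T) :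
    coboundary ρ V (supportedAt y c) T = 0 := by
  refine Finset.sum_eq_zero fun j _ => ?_
  rw [supportedAt, if_neg (fun h => hy (Finset.mem_of_mem_erase h)), map_zero, smul_zero]

lemma coboundary_supportedAt_of_mem {y : ι} {V T : Finset ι} (c : ∀ S, A S) (hy : y ∈ T) :
    coboundary ρ V (supportedAt y c) T = coboundary ρ (insert y V) c T := by
  rw [coboundary, coboundary]
  symm
  apply Finset.sum_subset_zero_on_sdiff
  · exact Finset.sdiff_subset_sdiff subset_rfl (Finset.subset_insert y V)
  · intro j hj
    simp only [Finset.mem_sdiff, Finset.mem_insert, not_and, not_not] at hj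
    have : j = y := by tauto
    subst this
    rw [supportedAt, if_neg (Finset.notMem_erase j T), map_zero, smul_zero]
  · intro j hj
    simp only [Finset.mem_sdiff, Finset.mem_insert, not_or] at hj
    rw [supportedAt, if_pos (Finset.mem_erase.mpr ⟨fun h => hj.2.1 h.symm, hy⟩)]

lemma coboundary_supportedAway_of_notMem {y : ι} {V T : Finset ι} (c : ∀ S, A S) (hy : y ∉ T) :
    coboundary ρ V (supportedAway y c) T = coboundary ρ V c T := by
  refine coboundary_congr fun j _ _ => ?_
  rw [supportedAway, if_neg (fun h => hy (Finset.mem_of_mem_erase h))]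

lemma insert_subset_cases {y : ι} {U T : Finset ι} (hTU : T ⊆ insert y U) (hy : y ∉ T) :
    T ⊆ U := (Finset.subset_insert_iff_of_notMem hy).mp hTU

include hP in
/-- If the complex of the sets containing `y` is exact, then omitting `y` from `U` does not change
the cohomology. -/
lemma cechExact_insert_iff (hρ : IsCoeffSystem ρ) {V U : Finset ι} {y : ι} (hyU : y ∉ U)
    (hyV : y ∉ V) (hex : ∀ i, CechExact ρ P (insert y V) (insert y U) i) (i : ℕ) :
    CechExact ρ P V (insert y U) i ↔ CechExact ρ P V U i := by
  have hVerase : ∀ {T : Finset ι} {j}, V ⊆ T → j ∉ V → V ⊆ T.erase j := fun hT hj l hl =>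
    Finset.mem_erase.mpr ⟨fun e => hj (e ▸ hl), hT hl⟩
  have hy_not : ∀ {T : Finset ι}, T ⊆ U → y ∉ T := fun hT h => hyU (hT h)
  constructor
  · intro h c hc hcoc
    let c1 := supportedAway y c
    have hc1 : ∀ S, c1 S ∈ P S := supportedAway_mem hc
    let e := coboundary ρ V c1
    have he0 : ∀ T, V ⊆ T → T ⊆ U → T.card = i + 1 → e T = 0 := fun T h1 h2 h3 => by
      simp only [e, c1]
      rw [coboundary_supportedAway_of_notMem _ (hy_not h2), hcoc T h1 h2 h3]
    obtain ⟨b', hb'P, hb'⟩ := hex (i + 1) (supportedAt y e)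
      (supportedAt_mem (coboundary_mem hP V hc1)) (by
        intro T h1 h2 h3
        have hyT : y ∈ T := h1 (Finset.mem_insert_self y V)
        have hVT : V ⊆ T := (Finset.subset_insert y V).trans h1
        have h4 : coboundary ρ (insert y V) (supportedAt y e) T = coboundary ρ V e T := by
          rw [← coboundary_supportedAt_of_mem _ hyT]
          refine coboundary_congr fun j hj hjV => ?_
          by_cases hj' : j = y
          · subst hj'
            rw [supportedAt, if_neg (Finset.notMem_erase j T), he0 _ (hVerase hVT hjV)
              (insert_subset_cases ((T.erase_subset j).trans h2) (Finset.notMem_erase j T))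
              (by rw [Finset.card_erase_of_mem hj, h3]; rfl)]
          · rw [supportedAt, supportedAt, if_pos, if_pos] <;>
              exact Finset.mem_erase.mpr ⟨fun h => hj' h.symm, hyT⟩
        rw [h4, coboundary_coboundary hρ])
    obtain ⟨b, hbP, hb⟩ := h (fun S => c1 S - supportedAt y b' S)
      (fun S => sub_mem (hc1 S) (supportedAt_mem hb'P S)) (by
        intro T h1 h2 h3
        rw [coboundary_sub]
        by_cases hyT : y ∈ T
        · rw [coboundary_supportedAt_of_mem _ hyT, hb' T (Finset.insert_subset hyT h1) h2 h3,
            supportedAt, if_pos hyT, sub_self]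
        · rw [coboundary_supportedAt_of_notMem _ hyT, sub_zero]
          exact he0 T h1 (insert_subset_cases h2 hyT) h3)
    refine ⟨b, hbP, fun T h1 h2 h3 => ?_⟩
    rw [hb T h1 (h2.trans (Finset.subset_insert y U)) h3]
    simp only [c1]
    rw [supportedAway, supportedAt, if_neg (hy_not h2), if_neg (hy_not h2), sub_zero]
  · intro h c hc hcoc
    obtain ⟨b, hbP, hb⟩ := h c hc fun T h1 h2 h3 =>
      hcoc T h1 (h2.trans (Finset.subset_insert y U)) h3
    let b1 := supportedAway y b
    have hb1 : ∀ S, b1 S ∈ P S := supportedAway_mem hbP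
    let c1 : ∀ S, A S := fun S => c S - coboundary ρ V b1 S
    have hc10 : ∀ T, V ⊆ T → T ⊆ U → T.card = i → c1 T = 0 := fun T h1 h2 h3 => by
      simp only [c1, b1]
      rw [coboundary_supportedAway_of_notMem _ (hy_not h2), hb T h1 h2 h3, sub_self]
    obtain ⟨b2, hb2P, hb2⟩ := hex i (supportedAt y c1)
      (supportedAt_mem fun S => sub_mem (hc S) (coboundary_mem hP V hb1 S)) (by
        intro T h1 h2 h3
        have hyT : y ∈ T := h1 (Finset.mem_insert_self y V)
        have hVT : V ⊆ T := (Finset.subset_insert y V).trans h1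
        have h4 : coboundary ρ (insert y V) (supportedAt y c1) T = coboundary ρ V c1 T := by
          rw [← coboundary_supportedAt_of_mem _ hyT]
          refine coboundary_congr fun j hj hjV => ?_
          by_cases hj' : j = y
          · subst hj'
            rw [supportedAt, if_neg (Finset.notMem_erase j T), hc10 _ (hVerase hVT hjV)
              (insert_subset_cases ((T.erase_subset j).trans h2) (Finset.notMem_erase j T))
              (by rw [Finset.card_erase_of_mem hj, h3]; rfl)]
          · rw [supportedAt, supportedAt, if_pos, if_pos] <;>
              exact Finset.mem_erase.mpr ⟨fun h => hj' h.symm, hyT⟩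
        rw [h4]
        simp only [c1]
        rw [coboundary_sub, coboundary_coboundary hρ, hcoc T hVT h2 h3, sub_zero])
    refine ⟨fun S => b1 S + supportedAt y b2 S,
      fun S => add_mem (hb1 S) (supportedAt_mem hb2P S), fun T h1 h2 h3 => ?_⟩
    rw [coboundary_add]
    by_cases hyT : y ∈ T
    · rw [coboundary_supportedAt_of_mem _ hyT, hb2 T (Finset.insert_subset hyT h1) h2 h3,
        supportedAt, if_pos hyT]
      simp [c1]
    · rw [coboundary_supportedAt_of_notMem _ hyT, add_zero]
      exact sub_eq_zero.mp (hc10 T h1 (insert_subset_cases h2 hyT) h3) |>.symm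

end Cochains

section Resolution

variable {ι : Type*} [LinearOrder ι]
  {A₀ : Finset ι → Type*} [∀ S, AddCommGroup (A₀ S)]
  {A₁ : Finset ι → Type*} [∀ S, AddCommGroup (A₁ S)]
  {A₂ : Finset ι → Type*} [∀ S, AddCommGroup (A₂ S)]
  {ρ₀ : ∀ ⦃S T : Finset ι⦄, S ⊆ T → A₀ S →+ A₀ T}
  {ρ₁ : ∀ ⦃S T : Finset ι⦄, S ⊆ T → A₁ S →+ A₁ T}
  {P₀ : ∀ S, AddSubgroup (A₀ S)} {P₁ : ∀ S, AddSubgroup (A₁ S)} {P₂ : ∀ S, AddSubgroup (A₂ S)}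
  {V U : Finset ι}

/-- Exactness in degree `i` of the complex of cochains with values in the cokernel of
`f : A₁ → A₀`, expressed by cochains with values in `A₀` modulo the image of `f`. -/
def CechExactMod (ρ₀ : ∀ ⦃S T : Finset ι⦄, S ⊆ T → A₀ S →+ A₀ T) (P₀ : ∀ S, AddSubgroup (A₀ S))
    (P₁ : ∀ S, AddSubgroup (A₁ S)) (f : ∀ S, A₁ S →+ A₀ S) (V U : Finset ι) (i : ℕ) : Prop :=
  ∀ (c : ∀ S, A₀ S) (a : ∀ S, A₁ S), (∀ S, c S ∈ P₀ S) → (∀ S, a S ∈ P₁ S) →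
    (∀ T, V ⊆ T → T ⊆ U → T.card = i + 1 → coboundary ρ₀ V c T = f T (a T)) →
    ∃ (b : ∀ S, A₀ S) (a' : ∀ S, A₁ S), (∀ S, b S ∈ P₀ S) ∧ (∀ S, a' S ∈ P₁ S) ∧
      ∀ T, V ⊆ T → T ⊆ U → T.card = i → c T - coboundary ρ₀ V b T = f T (a' T)

lemma subset_erase_of_notMem {V T : Finset ι} {j : ι} (hT : V ⊆ T) (hj : j ∉ V) :
    V ⊆ T.erase j := fun _ hl => Finset.mem_erase.mpr ⟨fun e => hj (e ▸ hl), hT hl⟩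

/-- Cochains agreeing in degree `i` have the same differential in degree `i + 1`. -/
lemma coboundary_congr_card {i : ℕ} {c c' : ∀ S, A₀ S} {T : Finset ι} (hV : V ⊆ T) (hU : T ⊆ U)
    (hT : T.card = i + 1) (h : ∀ T, V ⊆ T → T ⊆ U → T.card = i → c T = c' T) :
    coboundary ρ₀ V c T = coboundary ρ₀ V c' T :=
  coboundary_congr fun j hj hjV => h _ (subset_erase_of_notMem hV hjV)
    ((T.erase_subset j).trans hU) (by rw [Finset.card_erase_of_mem hj, hT]; rfl)

lemma exists_family_of_card {Q : ∀ T, A₀ T → Prop} {i : ℕ}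
    (h : ∀ T, V ⊆ T → T ⊆ U → T.card = i → ∃ x ∈ P₀ T, Q T x) :
    ∃ x : ∀ T, A₀ T, (∀ T, x T ∈ P₀ T) ∧ ∀ T, V ⊆ T → T ⊆ U → T.card = i → Q T (x T) := by
  have : ∀ T, ∃ x ∈ P₀ T, V ⊆ T → T ⊆ U → T.card = i → Q T x := by
    intro T
    by_cases hT : V ⊆ T ∧ T ⊆ U ∧ T.card = i
    · obtain ⟨x, hx, hQ⟩ := h T hT.1 hT.2.1 hT.2.2
      exact ⟨x, hx, fun _ _ _ => hQ⟩
    · exact ⟨0, zero_mem _, fun h1 h2 h3 => absurd ⟨h1, h2, h3⟩ hT⟩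
  choose x hx hQ using this
  exact ⟨x, hx, hQ⟩

variable {f₁ : ∀ S, A₁ S →+ A₀ S} {f₂ : ∀ S, A₂ S →+ A₁ S}
  (hρ₀ : IsCoeffSystem ρ₀) (hρ₁ : IsCoeffSystem ρ₁)
  (hP₁ : ∀ ⦃S T : Finset ι⦄ (h : S ⊆ T), ∀ x ∈ P₁ S, ρ₁ h x ∈ P₁ T)
  (hf₁ : ∀ ⦃S T : Finset ι⦄ (h : S ⊆ T) (x : A₁ S), f₁ T (ρ₁ h x) = ρ₀ h (f₁ S x))
  (hfP : ∀ S, ∀ x ∈ P₁ S, f₁ S x ∈ P₀ S)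
  (hff : ∀ S x, f₁ S (f₂ S x) = 0)
  (hexact : ∀ S, ∀ x ∈ P₁ S, f₁ S x = 0 → ∃ y ∈ P₂ S, f₂ S y = x)

include hρ₀ hP₁ hf₁ hfP hexact in
/-- Dimension shifting: `Hⁱ(A₀) = 0` and `Hⁱ⁺¹(coker f₂) = 0` imply `Hⁱ(coker f₁) = 0`. -/
lemma CechExact.exactMod_of_succ {i : ℕ} (h0 : CechExact ρ₀ P₀ V U i)
    (h1 : CechExactMod ρ₁ P₁ P₂ f₂ V U (i + 1)) (hff : ∀ S x, f₁ S (f₂ S x) = 0) :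
    CechExactMod ρ₀ P₀ P₁ f₁ V U i := by
  intro c a hc ha hca
  obtain ⟨a', ha'P, ha'⟩ := exists_family_of_card (P₀ := P₂) (V := V) (U := U) (i := i + 1 + 1)
    (Q := fun T x => f₂ T x = coboundary ρ₁ V a T) (by
      intro T hV hU hT
      refine hexact T _ (coboundary_mem hP₁ V ha T) ?_
      rw [map_coboundary f₁ hf₁, ← coboundary_coboundary hρ₀ V c T]
      exact coboundary_congr_card hV hU hT fun T h1 h2 h3 => (hca T h1 h2 h3).symm)
  obtain ⟨b', a'', hb'P, -, hb'⟩ := h1 a a' ha ha'P fun T h1 h2 h3 => (ha' T h1 h2 h3).symm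
  obtain ⟨b, hbP, hb⟩ := h0 (fun S => c S - f₁ S (b' S))
    (fun S => sub_mem (hc S) (hfP S _ (hb'P S))) (by
      intro T h1 h2 h3
      rw [coboundary_sub, hca T h1 h2 h3, ← map_coboundary f₁ hf₁, ← map_sub, hb' T h1 h2 h3, hff])
  exact ⟨b, b', hbP, hb'P, fun T h1 h2 h3 => by rw [hb T h1 h2 h3]; abel⟩

include hf₁ hexact in
/-- If `Hⁱ(coker f₁) = 0`, then `Hⁱ⁺¹(coker f₂) → Hⁱ⁺¹(A₀)` is injective. -/
lemma CechExactMod.exists_of_map_eq_coboundary {i : ℕ} (h : CechExactMod ρ₀ P₀ P₁ f₁ V U i)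
    (hP₁ : ∀ ⦃S T : Finset ι⦄ (h : S ⊆ T), ∀ x ∈ P₁ S, ρ₁ h x ∈ P₁ T)
    {a : ∀ S, A₁ S} {c : ∀ S, A₀ S} (ha : ∀ S, a S ∈ P₁ S) (hc : ∀ S, c S ∈ P₀ S)
    (hac : ∀ T, V ⊆ T → T ⊆ U → T.card = i + 1 → f₁ T (a T) = coboundary ρ₀ V c T)
    (hρ₀ : IsCoeffSystem ρ₀) :
    ∃ (b : ∀ S, A₁ S) (a' : ∀ S, A₂ S), (∀ S, b S ∈ P₁ S) ∧ (∀ S, a' S ∈ P₂ S) ∧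
      ∀ T, V ⊆ T → T ⊆ U → T.card = i + 1 → a T - coboundary ρ₁ V b T = f₂ T (a' T) := by
  obtain ⟨b, b', -, hb'P, hb⟩ := h c a hc ha fun T h1 h2 h3 => (hac T h1 h2 h3).symm
  obtain ⟨a', ha'P, ha'⟩ := exists_family_of_card (P₀ := P₂) (V := V) (U := U) (i := i + 1)
    (Q := fun T x => f₂ T x = a T - coboundary ρ₁ V b' T) (by
      intro T hV hU hT
      refine hexact T _ (sub_mem (ha T) (coboundary_mem hP₁ V hb'P T)) ?_
      rw [map_sub, map_coboundary f₁ hf₁, hac T hV hU hT,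
        ← coboundary_congr_card (ρ₀ := ρ₀) hV hU hT hb, coboundary_sub, coboundary_coboundary hρ₀]
      simp)
  exact ⟨b', a', hb'P, ha'P, fun T h1 h2 h3 => (ha' T h1 h2 h3).symm⟩

include hf₁ hfP hff hexact in
/-- Dimension shifting: `Hⁱ(coker f₁) = 0` and `Hⁱ⁺¹(A₀) = 0` imply `Hⁱ⁺¹(coker f₂) = 0`. -/
lemma CechExactMod.succ {i : ℕ} (h : CechExactMod ρ₀ P₀ P₁ f₁ V U i)
    (hP₁ : ∀ ⦃S T : Finset ι⦄ (h : S ⊆ T), ∀ x ∈ P₁ S, ρ₁ h x ∈ P₁ T)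
    (h0 : CechExact ρ₀ P₀ V U (i + 1)) (hρ₀ : IsCoeffSystem ρ₀) :
    CechExactMod ρ₁ P₁ P₂ f₂ V U (i + 1) := by
  intro a a' ha ha' haa'
  obtain ⟨c, hc, hca⟩ := h0 (fun S => f₁ S (a S)) (fun S => hfP S _ (ha S)) (by
    intro T h1 h2 h3
    rw [← map_coboundary f₁ hf₁, haa' T h1 h2 h3, hff])
  exact h.exists_of_map_eq_coboundary hf₁ hexact hP₁ ha hc
    (fun T h1 h2 h3 => (hca T h1 h2 h3).symm) hρ₀

include hf₁ hfP hff hexact in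
/-- For a cokernel `f₁ : A₁ → A₀` of `f₂`, exactness with values in `A₀` is exactness with values in
`A₁` modulo the image of `f₂`. -/
lemma cechExact_iff_exactMod (hsurj : ∀ S, ∀ x ∈ P₀ S, ∃ y ∈ P₁ S, f₁ S y = x)
    (hP₁ : ∀ ⦃S T : Finset ι⦄ (h : S ⊆ T), ∀ x ∈ P₁ S, ρ₁ h x ∈ P₁ T) (i : ℕ) :
    CechExact ρ₀ P₀ V U i ↔ CechExactMod ρ₁ P₁ P₂ f₂ V U i := by
  constructor
  · intro h c a hc ha hca
    obtain ⟨e, he, hec⟩ := h (fun S => f₁ S (c S)) (fun S => hfP S _ (hc S)) (by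
      intro T h1 h2 h3
      rw [← map_coboundary f₁ hf₁, hca T h1 h2 h3, hff])
    choose b hbP hb using fun S => hsurj S (e S) (he S)
    obtain ⟨a', ha'P, ha'⟩ := exists_family_of_card (P₀ := P₂) (V := V) (U := U) (i := i)
      (Q := fun T x => f₂ T x = c T - coboundary ρ₁ V b T) (by
        intro T hV hU hT
        refine hexact T _ (sub_mem (hc T) (coboundary_mem hP₁ V hbP T)) ?_
        rw [map_sub, map_coboundary f₁ hf₁, ← hec T hV hU hT]
        simp only [hb, sub_self])
    exact ⟨b, a', hbP, ha'P, fun T h1 h2 h3 => (ha' T h1 h2 h3).symm⟩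
  · intro h c hc hcoc
    choose c' hc'P hc' using fun S => hsurj S (c S) (hc S)
    obtain ⟨a, haP, ha⟩ := exists_family_of_card (P₀ := P₂) (V := V) (U := U) (i := i + 1)
      (Q := fun T x => f₂ T x = coboundary ρ₁ V c' T) (by
        intro T hV hU hT
        refine hexact T _ (coboundary_mem hP₁ V hc'P T) ?_
        rw [map_coboundary f₁ hf₁]
        simp only [hc']
        exact hcoc T hV hU hT)
    obtain ⟨b, a', hbP, -, hb⟩ := h c' a hc'P haP fun T h1 h2 h3 => (ha T h1 h2 h3).symm
    refine ⟨fun S => f₁ S (b S), fun S => hfP S _ (hbP S), fun T h1 h2 h3 => ?_⟩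
    have := congrArg (f₁ T) (hb T h1 h2 h3)
    rw [map_sub, hff, hc', sub_eq_zero, map_coboundary f₁ hf₁] at this
    exact this.symm

end Resolution

/-! ### Graded pieces of localizations -/

section Localization

variable {ι : Type*} {C : Type*} [CommRing C] (z : ι → C)
  (N : Type*) [AddCommGroup N] [Module C N]

/-- `N[1/z_j : j ∈ S]`. -/
abbrev Loc (S : Finset ι) : Type _ :=
  LocalizedModule (Submonoid.closure (z '' (S : Set ι))) N

/-- The canonical map `N[1/z_j : j ∈ S] → N[1/z_j : j ∈ T]` for `S ⊆ T`. -/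
def locRes ⦃S T : Finset ι⦄ (h : S ⊆ T) : Loc z N S →ₗ[C] Loc z N T :=
  LocalizedModule.liftOfLE (Submonoid.closure (z '' (S : Set ι)))
    (Submonoid.closure (z '' (T : Set ι)))
    (Submonoid.closure_mono (Set.image_mono (Finset.coe_subset.mpr h)))

/-- The restriction maps between the localizations of `N`, as a coefficient system. -/
def locSystem ⦃S T : Finset ι⦄ (h : S ⊆ T) : Loc z N S →+ Loc z N T :=
  (locRes z N h).toAddMonoidHom

variable {N}

lemma locSystem_mk {S T : Finset ι} (h : S ⊆ T) (m : N) (u : Submonoid.closure (z '' (S : Set ι))) :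
    locSystem z N h (LocalizedModule.mk m u) = LocalizedModule.mk m
      ⟨u.1, Submonoid.closure_mono (Set.image_mono (Finset.coe_subset.mpr h)) u.2⟩ := by
  change locRes z N h _ = _
  rw [locRes, IsLocalizedModule.mk_eq_mk', IsLocalizedModule.liftOfLE_mk',
    ← IsLocalizedModule.mk_eq_mk']

lemma locSystem_smul {S T : Finset ι} (h : S ⊆ T) (a : C) (x : Loc z N S) :
    locSystem z N h (a • x) = a • locSystem z N h x := map_smul (locRes z N h) a x

lemma isCoeffSystem_locSystem [LinearOrder ι] : IsCoeffSystem (locSystem z N) where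
  refl S x := by
    induction x using LocalizedModule.induction_on with
    | h m u => rw [locSystem_mk]
  trans h h' x := by
    induction x using LocalizedModule.induction_on with
    | h m u => rw [locSystem_mk, locSystem_mk, locSystem_mk]

/-- The monomial `∏_{j ∈ S} z_j ^ a_j` as an element of the multiplicative set defining the
localization. -/
def locMon (S : Finset ι) (a : ι → ℕ) : Submonoid.closure (z '' (S : Set ι)) :=
  ⟨∏ j ∈ S, z j ^ a j, prod_mem fun _ hj => pow_mem
    (Submonoid.subset_closure (Set.mem_image_of_mem _ (Finset.mem_coe.mpr hj))) _⟩

lemma locMon_add (S : Finset ι) (a b : ι → ℕ) :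
    locMon z S (a + b) = locMon z S a * locMon z S b :=
  Subtype.ext (by simp [locMon, pow_add, Finset.prod_mul_distrib])

lemma exists_locMon (S : Finset ι) (u : Submonoid.closure (z '' (S : Set ι))) :
    ∃ a, locMon z S a = u := by
  classical
  obtain ⟨u, hu⟩ := u
  induction hu using Submonoid.closure_induction with
  | mem x hx =>
    obtain ⟨j, hj, rfl⟩ := hx
    refine ⟨Pi.single j 1, Subtype.ext ?_⟩
    simp only [locMon]
    rw [Finset.prod_eq_single_of_mem j hj]
    · simp
    · intro l _ hl; simp [hl]
  | one => exact ⟨0, Subtype.ext (by simp [locMon])⟩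
  | mul x y hx hy ihx ihy =>
    obtain ⟨a, ha⟩ := ihx
    obtain ⟨b, hb⟩ := ihy
    exact ⟨a + b, by rw [locMon_add, ha, hb]; rfl⟩

lemma exists_eq_mk_locMon {S : Finset ι} (x : Loc z N S) :
    ∃ (a : ι → ℕ) (m : N), x = LocalizedModule.mk m (locMon z S a) := by
  induction x using LocalizedModule.induction_on with
  | h m u =>
    obtain ⟨a, rfl⟩ := exists_locMon z S u
    exact ⟨a, m, rfl⟩

lemma coe_locMon (S : Finset ι) (a : ι → ℕ) : (locMon z S a : C) = ∏ j ∈ S, z j ^ a j := rfl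

lemma coe_locMon_of_subset {S T : Finset ι} (h : S ⊆ T) (a : ι → ℕ) [DecidableEq ι] :
    (locMon z T (fun j => if j ∈ S then a j else 0) : C) = locMon z S a := by
  rw [coe_locMon, coe_locMon, ← Finset.prod_subset h]
  · exact Finset.prod_congr rfl fun j hj => by rw [if_pos hj]
  · intro j _ hj; rw [if_neg hj, pow_zero]

lemma locSystem_mk_locMon [DecidableEq ι] {S T : Finset ι} (h : S ⊆ T) (m : N) (a : ι → ℕ) :
    locSystem z N h (LocalizedModule.mk m (locMon z S a)) =
      LocalizedModule.mk m (locMon z T (fun j => if j ∈ S then a j else 0)) := by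
  rw [locSystem_mk]
  congr 1
  exact Subtype.ext (coe_locMon_of_subset z h a).symm

lemma bijective_smul_of_mem {S : Finset ι} {u : C} (hu : u ∈ Submonoid.closure (z '' (S : Set ι))) :
    Function.Bijective fun x : Loc z N S => u • x := by
  have := IsLocalizedModule.map_units (S := Submonoid.closure (z '' (S : Set ι)))
    (LocalizedModule.mkLinearMap (Submonoid.closure (z '' (S : Set ι))) N) ⟨u, hu⟩
  exact (Module.End.isUnit_iff _).mp this

lemma mem_closure_of_mem {S : Finset ι} {j : ι} (hj : j ∈ S) :
    z j ∈ Submonoid.closure (z '' (S : Set ι)) :=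
  Submonoid.subset_closure (Set.mem_image_of_mem _ (Finset.mem_coe.mpr hj))

lemma exists_lift_locSystem [DecidableEq ι] {S : Finset ι} {j : ι} (hj : j ∉ S)
    (w : Loc z N (insert j S)) : ∃ K : ℕ, ∃ v : Loc z N S,
      locSystem z N (Finset.subset_insert j S) v = z j ^ K • w := by
  obtain ⟨a, m, rfl⟩ := exists_eq_mk_locMon z w
  refine ⟨a j, LocalizedModule.mk m (locMon z S a), ?_⟩
  rw [locSystem_mk, LocalizedModule.smul'_mk, LocalizedModule.mk_eq]
  refine ⟨1, ?_⟩
  simp only [one_smul, Submonoid.smul_def, coe_locMon, Finset.prod_insert hj, smul_smul]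
  rw [mul_comm]

lemma exists_pow_smul_eq_zero [DecidableEq ι] {S : Finset ι} {j : ι} (hj : j ∉ S) (v : Loc z N S)
    (h : locSystem z N (Finset.subset_insert j S) v = 0) : ∃ K : ℕ, z j ^ K • v = 0 := by
  obtain ⟨a, m, rfl⟩ := exists_eq_mk_locMon z v
  rw [locSystem_mk, ← LocalizedModule.zero_mk 1, LocalizedModule.mk_eq] at h
  obtain ⟨u, hu⟩ := h
  obtain ⟨b, rfl⟩ := exists_locMon z _ u
  refine ⟨b j, ?_⟩
  rw [LocalizedModule.smul'_mk, ← LocalizedModule.zero_mk 1, LocalizedModule.mk_eq]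
  refine ⟨locMon z S b, ?_⟩
  simp only [one_smul, smul_zero, Submonoid.smul_def, coe_locMon, Finset.prod_insert hj,
    smul_smul] at hu ⊢
  rw [mul_comm, hu]

/-- The maps on localizations induced by a linear map. -/
def locMap {N' : Type*} [AddCommGroup N'] [Module C N'] (g : N →ₗ[C] N') (S : Finset ι) :
    Loc z N S →+ Loc z N' S :=
  (IsLocalizedModule.map (Submonoid.closure (z '' (S : Set ι)))
    (LocalizedModule.mkLinearMap _ N) (LocalizedModule.mkLinearMap _ N') g).toAddMonoidHom

section locMap

variable {N' : Type*} [AddCommGroup N'] [Module C N'] (g : N →ₗ[C] N')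

lemma locMap_mk {S : Finset ι} (m : N) (u : Submonoid.closure (z '' (S : Set ι))) :
    locMap z g S (LocalizedModule.mk m u) = LocalizedModule.mk (g m) u :=
  IsLocalizedModule.map_LocalizedModules _ g m u

lemma locMap_locSystem {S T : Finset ι} (h : S ⊆ T) (x : Loc z N S) :
    locMap z g T (locSystem z N h x) = locSystem z N' h (locMap z g S x) := by
  induction x using LocalizedModule.induction_on with
  | h m u => rw [locSystem_mk, locMap_mk, locMap_mk, locSystem_mk]

lemma locMap_surjective (hg : Function.Surjective g) (S : Finset ι) :
    Function.Surjective (locMap z g S) := by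
  intro x
  induction x using LocalizedModule.induction_on with
  | h m u =>
    obtain ⟨m, rfl⟩ := hg m
    exact ⟨LocalizedModule.mk m u, locMap_mk z g m u⟩

lemma locMap_exact {N'' : Type*} [AddCommGroup N''] [Module C N''] {g : N →ₗ[C] N'}
    {g' : N' →ₗ[C] N''} (h : Function.Exact g g') (S : Finset ι) :
    Function.Exact (locMap z g S) (locMap z g' S) :=
  LocalizedModule.map_exact (Submonoid.closure (z '' (S : Set ι))) g g' h

end locMap

/-- A family of projections of `N`, indexed by degrees, such that multiplication by `z_j` raises
degrees by `e_j`.  Only the idempotence of each projection is recorded. -/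
structure DegreeProj (e : ι → ℤ) (N : Type*) [AddCommGroup N] [Module C N] where
  /-- the projection to degree `d` -/
  proj : ℤ → N →+ N
  proj_proj : ∀ d x, proj d (proj d x) = proj d x
  proj_smul : ∀ j d x, proj (d + e j) (z j • x) = z j • proj d x

/-- The degree of the monomial `∏_{j ∈ S} z_j ^ a_j`. -/
def locDeg (e : ι → ℤ) (S : Finset ι) (a : ι → ℕ) : ℤ := ∑ j ∈ S, a j * e j

lemma locDeg_add (e : ι → ℤ) (S : Finset ι) (a b : ι → ℕ) :
    locDeg e S (a + b) = locDeg e S a + locDeg e S b := by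
  simp [locDeg, add_mul, Finset.sum_add_distrib]

lemma locDeg_of_subset [DecidableEq ι] (e : ι → ℤ) {S T : Finset ι} (h : S ⊆ T) (a : ι → ℕ) :
    locDeg e T (fun j => if j ∈ S then a j else 0) = locDeg e S a := by
  rw [locDeg, locDeg, ← Finset.sum_subset h]
  · exact Finset.sum_congr rfl fun j hj => by rw [if_pos hj]
  · intro j _ hj; simp [hj]

variable {z} {e : ι → ℤ} (D : DegreeProj z e N)

namespace DegreeProj

lemma proj_pow_smul (j : ι) (K : ℕ) (d : ℤ) (x : N) :
    D.proj (d + K * e j) (z j ^ K • x) = z j ^ K • D.proj d x := by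
  induction K with
  | zero => simp
  | succ K ih =>
    rw [pow_succ', mul_smul, mul_smul, ← ih, ← D.proj_smul]; congr 2; push_cast; ring

lemma proj_locMon_smul (S : Finset ι) (a : ι → ℕ) (d : ℤ) (x : N) :
    D.proj (d + locDeg e S a) ((locMon z S a : C) • x) = (locMon z S a : C) • D.proj d x := by
  classical
  simp only [coe_locMon, locDeg]
  induction S using Finset.induction_on generalizing d x with
  | empty => simp
  | insert j S hj ih =>
    rw [Finset.prod_insert hj, Finset.sum_insert hj, mul_smul, mul_smul, ← ih, ← D.proj_pow_smul]
    congr 2; ring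

/-- Fractions representing the same element have the same components. -/
lemma mk_proj_eq {S : Finset ι} {a a' : ι → ℕ} {m m' : N} (n : ℤ)
    (h : (LocalizedModule.mk m (locMon z S a) : Loc z N S) = LocalizedModule.mk m' (locMon z S a')) :
    (LocalizedModule.mk (D.proj (n + locDeg e S a) m) (locMon z S a) : Loc z N S) =
      LocalizedModule.mk (D.proj (n + locDeg e S a') m') (locMon z S a') := by
  rw [LocalizedModule.mk_eq] at h ⊢
  obtain ⟨u, hu⟩ := h
  obtain ⟨c, rfl⟩ := exists_locMon z _ u
  refine ⟨locMon z S c, ?_⟩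
  have := congrArg (D.proj (n + locDeg e S a + locDeg e S a' + locDeg e S c)) hu
  simp only [Submonoid.smul_def] at this ⊢
  rwa [D.proj_locMon_smul, D.proj_locMon_smul, D.proj_locMon_smul, add_right_comm n,
    D.proj_locMon_smul] at this

/-- The degree `n` component of an element of a localization. -/
def locProj (S : Finset ι) (n : ℤ) : Loc z N S →+ Loc z N S :=
  AddMonoidHom.mk' (fun x => LocalizedModule.liftOn x
    (fun p => LocalizedModule.mk
      (D.proj (n + locDeg e S (exists_locMon z S p.2).choose) p.1) p.2) (by
    rintro ⟨m, u⟩ ⟨m', u'⟩ h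
    have h1 := (exists_locMon z S u).choose_spec
    have h2 := (exists_locMon z S u').choose_spec
    have h3 := D.mk_proj_eq (S := S) (a := (exists_locMon z S u).choose)
      (a' := (exists_locMon z S u').choose) (m := m) (m' := m') n (by
        rw [h1, h2]; exact LocalizedModule.mk_eq.mpr h)
    rw [h1, h2] at h3
    exact h3)) (by
    intro x y
    induction x using LocalizedModule.induction_on with
    | h m u =>
    induction y using LocalizedModule.induction_on with
    | h m' u' =>
    rw [LocalizedModule.mk_add_mk, LocalizedModule.liftOn_mk, LocalizedModule.liftOn_mk,
      LocalizedModule.liftOn_mk]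
    simp only
    generalize ha : (exists_locMon z S u).choose = a
    generalize hb : (exists_locMon z S u').choose = b
    generalize hc : (exists_locMon z S (u * u')).choose = c
    have h1 := (exists_locMon z S u).choose_spec
    have h2 := (exists_locMon z S u').choose_spec
    have h3 := (exists_locMon z S (u * u')).choose_spec
    rw [ha] at h1; rw [hb] at h2; rw [hc] at h3
    subst h1; subst h2
    have h4 := D.mk_proj_eq (S := S) (a := c) (a' := a + b)
      (m := locMon z S b • m + locMon z S a • m')
      (m' := locMon z S b • m + locMon z S a • m') n (by rw [h3, locMon_add])
    rw [h3] at h4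
    rw [h4, LocalizedModule.mk_add_mk, locMon_add, locDeg_add, map_add, ← add_assoc]
    simp only [Submonoid.smul_def]
    rw [D.proj_locMon_smul, add_right_comm, D.proj_locMon_smul])

lemma locProj_mk (S : Finset ι) (n : ℤ) (m : N) (a : ι → ℕ) :
    D.locProj S n (LocalizedModule.mk m (locMon z S a)) =
      LocalizedModule.mk (D.proj (n + locDeg e S a) m) (locMon z S a) := by
  rw [locProj, AddMonoidHom.mk'_apply, LocalizedModule.liftOn_mk]
  simp only
  have h1 := (exists_locMon z S (locMon z S a)).choose_spec
  have h2 := D.mk_proj_eq (S := S) (m := m) (m' := m) n (congrArg (LocalizedModule.mk m) h1)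
  rw [h1] at h2
  exact h2

lemma locProj_locProj (S : Finset ι) (n : ℤ) (x : Loc z N S) :
    D.locProj S n (D.locProj S n x) = D.locProj S n x := by
  obtain ⟨a, m, rfl⟩ := exists_eq_mk_locMon z x
  rw [locProj_mk, locProj_mk, D.proj_proj]

lemma locProj_locSystem [LinearOrder ι] {S T : Finset ι} (h : S ⊆ T) (n : ℤ) (x : Loc z N S) :
    D.locProj T n (locSystem z N h x) = locSystem z N h (D.locProj S n x) := by
  obtain ⟨a, m, rfl⟩ := exists_eq_mk_locMon z x
  rw [locProj_mk, locSystem_mk_locMon, locSystem_mk_locMon, locProj_mk, locDeg_of_subset e h]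

/-- The elements of degree `n` of a localization. -/
def locStrand (n : ℤ) (S : Finset ι) : AddSubgroup (Loc z N S) :=
  (D.locProj S n - AddMonoidHom.id _).ker

lemma mem_locStrand {n : ℤ} {S : Finset ι} {x : Loc z N S} :
    x ∈ D.locStrand n S ↔ D.locProj S n x = x := by
  rw [locStrand, AddMonoidHom.mem_ker, AddMonoidHom.sub_apply, sub_eq_zero]; rfl

lemma locProj_mem_locStrand (n : ℤ) (S : Finset ι) (x : Loc z N S) :
    D.locProj S n x ∈ D.locStrand n S := D.mem_locStrand.mpr (D.locProj_locProj S n x)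

lemma mem_locStrand_iff {n : ℤ} {S : Finset ι} {x : Loc z N S} :
    x ∈ D.locStrand n S ↔ ∃ (a : ι → ℕ) (m : N), D.proj (n + locDeg e S a) m = m ∧
      x = LocalizedModule.mk m (locMon z S a) := by
  rw [mem_locStrand]
  constructor
  · intro h
    obtain ⟨a, m, rfl⟩ := exists_eq_mk_locMon z x
    rw [locProj_mk] at h
    exact ⟨a, _, D.proj_proj _ _, h.symm⟩
  · rintro ⟨a, m, hm, rfl⟩
    rw [locProj_mk, hm]

lemma locSystem_mem_locStrand [LinearOrder ι] (n : ℤ) ⦃S T : Finset ι⦄ (h : S ⊆ T) :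
    ∀ x ∈ D.locStrand n S, locSystem z N h x ∈ D.locStrand n T := by
  intro x hx
  rw [mem_locStrand] at hx ⊢
  rw [locProj_locSystem, hx]

lemma cechExact_locStrand [LinearOrder ι] (n : ℤ) {V U : Finset ι} {i : ℕ}
    (h : CechExact (locSystem z N) (fun _ => ⊤) V U i) :
    CechExact (locSystem z N) (D.locStrand n) V U i :=
  h.of_proj (fun S => D.locProj S n) (fun _ _ h x => D.locProj_locSystem h n x)
    (fun S x => D.locProj_mem_locStrand n S x) fun _ _ hx => D.mem_locStrand.mp hx

section Maps

variable {N' : Type*} [AddCommGroup N'] [Module C N'] {D' : DegreeProj z e N'} {g : N →ₗ[C] N'}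
  (hg : ∀ d x, g (D.proj d x) = D'.proj d (g x))

variable {D}
include hg

lemma locMap_locProj (S : Finset ι) (n : ℤ) (x : Loc z N S) :
    locMap z g S (D.locProj S n x) = D'.locProj S n (locMap z g S x) := by
  obtain ⟨a, m, rfl⟩ := exists_eq_mk_locMon z x
  rw [locProj_mk, locMap_mk, locMap_mk, locProj_mk, hg]

lemma locMap_mem_locStrand (n : ℤ) (S : Finset ι) :
    ∀ x ∈ D.locStrand n S, locMap z g S x ∈ D'.locStrand n S := by
  intro x hx
  rw [mem_locStrand] at hx ⊢
  rw [← locMap_locProj hg, hx]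

/-- An element of degree `n` with a preimage has a preimage of degree `n`. -/
lemma exists_mem_locStrand_of_exists {n : ℤ} {S : Finset ι} {x : Loc z N' S}
    (hx : x ∈ D'.locStrand n S) (h : ∃ y, locMap z g S y = x) :
    ∃ y ∈ D.locStrand n S, locMap z g S y = x := by
  obtain ⟨y, rfl⟩ := h
  exact ⟨D.locProj S n y, D.locProj_mem_locStrand n S y, by
    rw [locMap_locProj hg, D'.mem_locStrand.mp hx]⟩

end Maps

end DegreeProj

end Localization

/-! ### Change of rings and of generators up to radical -/

section Reindex

variable {ι₀ ι : Type*} [LinearOrder ι₀] [LinearOrder ι] (emb : ι₀ ↪o ι)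

lemma cechSign_map (j : ι₀) (T : Finset ι₀) :
    cechSign (emb j) (T.map emb.toEmbedding) = cechSign j T := by
  rw [cechSign, cechSign, Finset.filter_map, Finset.card_map]
  congr 2
  ext; simp

variable {A₀ : Finset ι₀ → Type*} [∀ S, AddCommGroup (A₀ S)]
  {A : Finset ι → Type*} [∀ S, AddCommGroup (A S)]
  {ρ₀ : ∀ ⦃S T : Finset ι₀⦄, S ⊆ T → A₀ S →+ A₀ T}
  {ρ : ∀ ⦃S T : Finset ι⦄, S ⊆ T → A S →+ A T}
  (θ : ∀ S : Finset ι₀, A₀ S ≃+ A (S.map emb.toEmbedding))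

variable {emb} in
lemma coboundary_map (hθ : ∀ ⦃S T : Finset ι₀⦄ (h : S ⊆ T) (x : A₀ S),
      θ T (ρ₀ h x) = ρ (Finset.map_subset_map.mpr h) (θ S x))
    (c₀ : ∀ S, A₀ S) (c : ∀ S, A S) (hc : ∀ S, c (S.map emb.toEmbedding) = θ S (c₀ S))
    (T : Finset ι₀) :
    coboundary ρ ∅ c (T.map emb.toEmbedding) = θ T (coboundary ρ₀ ∅ c₀ T) := by
  rw [coboundary_eq, coboundary, map_sum, Finset.sdiff_empty, Finset.sdiff_empty, Finset.sum_map]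
  refine Finset.sum_congr rfl fun j _ => ?_
  have e : (T.map emb.toEmbedding).erase (emb.toEmbedding j) =
      (T.erase j).map emb.toEmbedding := by
    rw [Finset.map_erase]
  rw [e, resTo_of_subset _ (Finset.map_subset_map.mpr (T.erase_subset j)), hc, map_zsmul, hθ]
  congr 1
  exact cechSign_map emb j T

/-- A family of elements on the images of the finite subsets of `ι₀` extends to all finite subsets
of `ι`. -/
lemma exists_extension (hρ : IsCoeffSystem ρ) {P : ∀ S, AddSubgroup (A S)}
    (hP : ∀ ⦃S T : Finset ι⦄ (h : S ⊆ T), ∀ x ∈ P S, ρ h x ∈ P T)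
    (c₀ : ∀ S : Finset ι₀, A (S.map emb.toEmbedding)) (hc₀ : ∀ S, c₀ S ∈ P _) :
    ∃ c : ∀ S, A S, (∀ S, c S ∈ P S) ∧ ∀ S, c (S.map emb.toEmbedding) = c₀ S := by
  classical
  have hpre : ∀ T : Finset ι, ∃ S : Finset ι₀, S.map emb.toEmbedding ⊆ T ∧
      ∀ S', S'.map emb.toEmbedding = T → S = S' := by
    intro T
    by_cases h : ∃ S' : Finset ι₀, S'.map emb.toEmbedding = T
    · obtain ⟨S', h⟩ := h
      exact ⟨S', h.subset, fun S'' h'' => Finset.map_injective _ (h.trans h''.symm)⟩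
    · exact ⟨∅, by simp, fun S' h' => absurd ⟨S', h'⟩ h⟩
  choose pre hpre1 hpre2 using hpre
  refine ⟨fun T => ρ (hpre1 T) (c₀ (pre T)), fun T => hP _ _ (hc₀ _), fun S => ?_⟩
  let g : Finset ι₀ → A (S.map emb.toEmbedding) := fun S' =>
    if h : S'.map emb.toEmbedding ⊆ S.map emb.toEmbedding then ρ h (c₀ S') else 0
  have h1 : ρ (hpre1 (S.map emb.toEmbedding)) (c₀ (pre (S.map emb.toEmbedding))) =
      g (pre (S.map emb.toEmbedding)) := by
    simp only [g]
    rw [dif_pos (hpre1 (S.map emb.toEmbedding))]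
  have h2 : g S = c₀ S := by
    simp only [g]
    rw [dif_pos (subset_refl _), hρ.refl]
  refine h1.trans ?_
  rw [hpre2 _ S rfl, h2]

/-- Exactness only depends on the coefficient system on the sets involved. -/
lemma cechExact_map_iff (hρ : IsCoeffSystem ρ)
    (hθ : ∀ ⦃S T : Finset ι₀⦄ (h : S ⊆ T) (x : A₀ S),
      θ T (ρ₀ h x) = ρ (Finset.map_subset_map.mpr h) (θ S x))
    {P₀ : ∀ S, AddSubgroup (A₀ S)} {P : ∀ S, AddSubgroup (A S)}
    (hP : ∀ ⦃S T : Finset ι⦄ (h : S ⊆ T), ∀ x ∈ P S, ρ h x ∈ P T)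
    (hPP : ∀ S x, θ S x ∈ P _ ↔ x ∈ P₀ S) (U : Finset ι₀) (i : ℕ) :
    CechExact ρ₀ P₀ ∅ U i ↔ CechExact ρ P ∅ (U.map emb.toEmbedding) i := by
  constructor
  · intro h c hc hcoc
    let c₀ : ∀ S, A₀ S := fun S => (θ S).symm (c (S.map emb.toEmbedding))
    have hc₀ : ∀ S, c (S.map emb.toEmbedding) = θ S (c₀ S) := fun S => by simp [c₀]
    obtain ⟨b₀, hb₀P, hb₀⟩ := h c₀ (fun S => by rw [← hPP, ← hc₀]; exact hc _) (by
      intro T _ h2 h3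
      apply (θ T).injective
      rw [map_zero, ← coboundary_map θ hθ c₀ c hc₀]
      exact hcoc _ (Finset.empty_subset _) (Finset.map_subset_map.mpr h2)
        (by rw [Finset.card_map, h3]))
    obtain ⟨b, hbP, hb⟩ := exists_extension emb hρ hP (fun S => θ S (b₀ S))
      (fun S => (hPP S _).mpr (hb₀P S))
    refine ⟨b, hbP, fun T _ h2 h3 => ?_⟩
    obtain ⟨T, hT, rfl⟩ := Finset.subset_map_iff.mp h2
    rw [coboundary_map θ hθ b₀ b hb, hb₀ T (Finset.empty_subset _) hT
      (by rwa [Finset.card_map] at h3), hc₀]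
  · intro h c₀ hc₀ hcoc
    obtain ⟨c, hcP, hc⟩ := exists_extension emb hρ hP (fun S => θ S (c₀ S))
      (fun S => (hPP S _).mpr (hc₀ S))
    obtain ⟨b, hbP, hb⟩ := h c hcP (by
      intro T _ h2 h3
      obtain ⟨T, hT, rfl⟩ := Finset.subset_map_iff.mp h2
      rw [coboundary_map θ hθ c₀ c hc, hcoc T (Finset.empty_subset _) hT
        (by rwa [Finset.card_map] at h3), map_zero])
    have hb₀ : ∀ S, b (S.map emb.toEmbedding) = θ S ((θ S).symm (b (S.map emb.toEmbedding))) :=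
      fun S => by simp
    refine ⟨fun S => (θ S).symm (b (S.map emb.toEmbedding)),
      fun S => by rw [← hPP, ← hb₀]; exact hbP _, fun T _ h2 h3 => ?_⟩
    apply (θ T).injective
    rw [← coboundary_map θ hθ _ b hb₀, hb _ (Finset.empty_subset _) (Finset.map_subset_map.mpr h2)
      (by rw [Finset.card_map, h3]), hc]

end Reindex

section ChangeOfRings

variable {ι₀ ι : Type*} [LinearOrder ι₀] [LinearOrder ι] (emb : ι₀ ↪o ι)
  {C₀ C : Type*} [CommRing C₀] [CommRing C] (σ : C₀ →+* C)
  {N : Type*} [AddCommGroup N] [Module C₀ N] [Module C N]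
  (hσ : ∀ (a : C₀) (m : N), σ a • m = a • m)
  {z₀ : ι₀ → C₀} {z : ι → C} (hz : ∀ j, z (emb j) = σ (z₀ j))

include hz in
lemma map_locMon (S : Finset ι₀) (a : ι₀ → ℕ) :
    (locMon z (S.map emb.toEmbedding) (Function.extend emb a 0) : C) = σ (locMon z₀ S a) := by
  rw [coe_locMon, coe_locMon, Finset.prod_map, map_prod]
  refine Finset.prod_congr rfl fun j _ => ?_
  rw [map_pow, ← hz]
  congr 1
  exact emb.injective.extend_apply a 0 j

lemma locDeg_map {e₀ : ι₀ → ℤ} {e : ι → ℤ} (he : ∀ j, e (emb j) = e₀ j) (S : Finset ι₀)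
    (a : ι₀ → ℕ) :
    locDeg e (S.map emb.toEmbedding) (Function.extend emb a 0) = locDeg e₀ S a := by
  rw [locDeg, locDeg, Finset.sum_map]
  refine Finset.sum_congr rfl fun j _ => ?_
  have h1 : Function.extend emb a 0 (emb.toEmbedding j) = a j := emb.injective.extend_apply a 0 j
  have h2 : e (emb.toEmbedding j) = e₀ j := he j
  rw [h1, h2]

include hz in
lemma map_mem_closure_image {S : Finset ι₀} {u : C₀}
    (hu : u ∈ Submonoid.closure (z₀ '' (S : Set ι₀))) :
    σ u ∈ Submonoid.closure (z '' (S.map emb.toEmbedding : Finset ι)) := by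
  obtain ⟨a, ha⟩ := exists_locMon z₀ S ⟨u, hu⟩
  have := map_locMon emb σ hz S a
  rw [ha] at this
  rw [← this]
  exact (locMon z (S.map emb.toEmbedding) (Function.extend emb a 0)).2

/-- Localizing at the images of the `z_j` in a larger ring gives the same abelian group. -/
def locChange (S : Finset ι₀) : Loc z₀ N S →+ Loc z N (S.map emb.toEmbedding) :=
  AddMonoidHom.mk' (fun x => LocalizedModule.liftOn x
    (fun p => LocalizedModule.mk p.1 ⟨σ p.2, map_mem_closure_image emb σ hz p.2.2⟩) (by
    rintro ⟨m, u⟩ ⟨m', u'⟩ ⟨t, ht⟩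
    rw [LocalizedModule.mk_eq]
    refine ⟨⟨σ t, map_mem_closure_image emb σ hz t.2⟩, ?_⟩
    simp only [Submonoid.smul_def] at ht ⊢
    rw [hσ, hσ, hσ, hσ, ht])) (by
    intro x y
    induction x using LocalizedModule.induction_on with
    | h m u =>
    induction y using LocalizedModule.induction_on with
    | h m' u' =>
    rw [LocalizedModule.mk_add_mk, LocalizedModule.liftOn_mk, LocalizedModule.liftOn_mk,
      LocalizedModule.liftOn_mk, LocalizedModule.mk_add_mk]
    simp only [Submonoid.smul_def, hσ]
    congr 1
    exact Subtype.ext (map_mul σ _ _))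

lemma locChange_mk (S : Finset ι₀) (m : N) (u : Submonoid.closure (z₀ '' (S : Set ι₀))) :
    locChange emb σ hσ hz S (LocalizedModule.mk m u) =
      LocalizedModule.mk m ⟨σ u, map_mem_closure_image emb σ hz u.2⟩ := by
  rw [locChange, AddMonoidHom.mk'_apply, LocalizedModule.liftOn_mk]

lemma locChange_mk_locMon (S : Finset ι₀) (m : N) (a : ι₀ → ℕ) :
    locChange emb σ hσ hz S (LocalizedModule.mk m (locMon z₀ S a)) =
      LocalizedModule.mk m (locMon z (S.map emb.toEmbedding) (Function.extend emb a 0)) := by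
  rw [locChange_mk]
  congr 1
  exact Subtype.ext (map_locMon emb σ hz S a).symm

lemma exists_map_locMon (S : Finset ι₀)
    (u : Submonoid.closure (z '' (S.map emb.toEmbedding : Finset ι))) :
    ∃ a : ι₀ → ℕ, u = locMon z (S.map emb.toEmbedding) (Function.extend emb a 0) := by
  obtain ⟨b, rfl⟩ := exists_locMon z _ u
  refine ⟨b ∘ emb, Subtype.ext ?_⟩
  rw [coe_locMon, coe_locMon, Finset.prod_map, Finset.prod_map]
  refine Finset.prod_congr rfl fun j _ => ?_
  congr 1
  exact (emb.injective.extend_apply (b ∘ emb) 0 j).symm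

lemma locChange_bijective (S : Finset ι₀) :
    Function.Bijective (locChange emb σ hσ hz (N := N) S) := by
  constructor
  · rw [injective_iff_map_eq_zero]
    intro x hx
    induction x using LocalizedModule.induction_on with
    | h m u =>
    rw [locChange_mk, ← LocalizedModule.zero_mk 1, LocalizedModule.mk_eq] at hx
    obtain ⟨t, ht⟩ := hx
    obtain ⟨a, rfl⟩ := exists_map_locMon emb S t
    rw [← LocalizedModule.zero_mk 1, LocalizedModule.mk_eq]
    refine ⟨locMon z₀ S a, ?_⟩
    simpa only [one_smul, smul_zero, Submonoid.smul_def, map_locMon emb σ hz, hσ] using ht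
  · intro x
    induction x using LocalizedModule.induction_on with
    | h m u =>
    obtain ⟨a, rfl⟩ := exists_map_locMon emb S u
    exact ⟨LocalizedModule.mk m (locMon z₀ S a), locChange_mk_locMon emb σ hσ hz S m a⟩

include hσ hz in
/-- The graded Čech cohomology does not depend on the ring over which the localizations are
formed. -/
lemma cechExact_locStrand_iff_of_ringHom {e₀ : ι₀ → ℤ} {e : ι → ℤ} (he : ∀ j, e (emb j) = e₀ j)
    (D₀ : DegreeProj z₀ e₀ N) (D : DegreeProj z e N) (hD : D.proj = D₀.proj) (n : ℤ)
    (U : Finset ι₀) (i : ℕ) :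
    CechExact (locSystem z₀ N) (D₀.locStrand n) ∅ U i ↔
      CechExact (locSystem z N) (D.locStrand n) ∅ (U.map emb.toEmbedding) i := by
  refine cechExact_map_iff emb
    (fun S => AddEquiv.ofBijective (locChange emb σ hσ hz S) (locChange_bijective emb σ hσ hz S))
    (isCoeffSystem_locSystem z) ?_ (D.locSystem_mem_locStrand n) ?_ U i
  · intro S T h x
    induction x using LocalizedModule.induction_on with
    | h m u =>
    simp only [AddEquiv.ofBijective_apply]
    rw [locSystem_mk, locChange_mk, locChange_mk, locSystem_mk]
  · intro S x
    simp only [AddEquiv.ofBijective_apply]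
    rw [D.mem_locStrand, D₀.mem_locStrand]
    obtain ⟨a, m, rfl⟩ := exists_eq_mk_locMon z₀ x
    rw [D₀.locProj_mk, locChange_mk_locMon, D.locProj_mk, locDeg_map emb he, hD,
      ← locChange_mk_locMon emb σ hσ hz, ← locChange_mk_locMon emb σ hσ hz]
    exact (locChange_bijective emb σ hσ hz S).1.eq_iff

end ChangeOfRings

section Radical

variable {ι : Type*} [LinearOrder ι] {C : Type*} [CommRing C] {z : ι → C} {e : ι → ℤ}
  {N : Type*} [AddCommGroup N] [Module C N]

/-- Adding to a family elements which are nilpotent modulo the ideal generated by it does not change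
the Čech cohomology. -/
lemma cechExact_union_iff (D : DegreeProj z e N) (n : ℤ) (U₁ U₂ : Finset ι)
    (h : ∀ y ∈ U₂, ∃ K : ℕ, ∃ a ∈ Ideal.span (z '' (U₁ : Set ι)), ∀ m : N, z y ^ K • m = a • m)
    (i : ℕ) :
    CechExact (locSystem z N) (D.locStrand n) ∅ (U₁ ∪ U₂) i ↔
      CechExact (locSystem z N) (D.locStrand n) ∅ U₁ i := by
  induction U₂ using Finset.induction_on with
  | empty => rw [Finset.union_empty]
  | insert y U hy ih =>
    rw [← ih fun y hy => h y (Finset.mem_insert_of_mem hy), Finset.union_insert]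
    by_cases hyU : y ∈ U₁ ∪ U
    · rw [Finset.insert_eq_of_mem hyU]
    · refine cechExact_insert_iff (D.locSystem_mem_locStrand n) (isCoeffSystem_locSystem z) hyU
        (Finset.notMem_empty y) (fun i => D.cechExact_locStrand n ?_) i
      obtain ⟨K, a, ha, hKa⟩ := h y (Finset.mem_insert_self y U)
      refine cechExact_of_mem_span (A := Loc z N) (ρ := locSystem z N) (isCoeffSystem_locSystem z)
        (fun _ _ h a x => locSystem_smul z h a x) (z := z) (J := (U₁ : Set ι)) ?_
        (fun j _ S hS w => exists_lift_locSystem z hS w)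
        (fun j _ S hS v hv => exists_pow_smul_eq_zero z hS v hv) (u := z y ^ K) (a := a) ?_ ha ?_ i
      · intro j hj
        refine ⟨Finset.mem_insert_of_mem (Finset.mem_union_left _ hj), fun hjy => hyU ?_⟩
        rw [Finset.mem_insert, or_iff_left (Finset.notMem_empty j)] at hjy
        exact hjy ▸ Finset.mem_union_left _ hj
      · intro S hS
        exact bijective_smul_of_mem z (pow_mem (mem_closure_of_mem z
          (hS (Finset.mem_insert_self y ∅))) K)
      · intro S _ x
        induction x using LocalizedModule.induction_on with
        | h m u => rw [LocalizedModule.smul'_mk, LocalizedModule.smul'_mk, hKa]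

/-- By Cayley–Hamilton, an element mapping a finite module `N` into `I N` acts nilpotently
modulo `I`. -/
lemma exists_pow_smul_eq_of_smul_mem [Module.Finite C N] {f : C} {I : Ideal C}
    (h : ∀ m : N, f • m ∈ I • (⊤ : Submodule C N)) :
    ∃ K : ℕ, ∃ a ∈ I, ∀ m : N, f ^ K • m = a • m := by
  obtain ⟨p, hp, -, hpI, hp0⟩ :=
    LinearMap.exists_monic_and_natDegree_eq_and_coeff_mem_pow_and_aeval_eq_zero C
      (algebraMap C (Module.End C N) f) I (by
        rintro _ ⟨m, rfl⟩
        exact h m)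
  refine ⟨p.natDegree, -∑ k ∈ Finset.range p.natDegree, p.coeff k * f ^ k, ?_, fun m => ?_⟩
  · refine neg_mem (sum_mem fun k hk => Ideal.mul_mem_right _ _ ?_)
    have := hpI k
    exact Ideal.pow_le_self (Nat.sub_ne_zero_of_lt (Finset.mem_range.mp hk)) this
  · rw [Polynomial.aeval_algebraMap_apply] at hp0
    have h1 := LinearMap.congr_fun hp0 m
    rw [Module.algebraMap_end_apply, LinearMap.zero_apply, Polynomial.aeval_eq_sum_range,
      Finset.sum_range_succ, hp.coeff_natDegree, one_smul, add_smul] at h1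
    rw [neg_smul, eq_neg_of_add_eq_zero_right h1]
    simp only [smul_eq_mul]

end Radical

/-! ### The graded local cohomology in terms of exactness -/

section OfDecomposition

variable {k M : Type*} [Field k] [AddCommGroup M] [Module k M] (ℳ : ℤ → Submodule k M)
  [DirectSum.Decomposition ℳ]

/-- The projection of a graded module to its degree `d` part. -/
def degreeComponent (d : ℤ) : M →+ M :=
  (ℳ d).subtype.toAddMonoidHom.comp
    ((DFinsupp.evalAddMonoidHom d).comp (DirectSum.decomposeAddEquiv ℳ).toAddMonoidHom)

lemma degreeComponent_apply (d : ℤ) (m : M) :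
    degreeComponent ℳ d m = (DirectSum.decompose ℳ m d : M) := rfl

lemma degreeComponent_eq_self_iff {d : ℤ} {m : M} : degreeComponent ℳ d m = m ↔ m ∈ ℳ d := by
  rw [degreeComponent_apply]
  exact ⟨fun h => h ▸ (DirectSum.decompose ℳ m d).2, fun h => DirectSum.decompose_of_mem_same ℳ h⟩

lemma degreeComponent_mem (d : ℤ) (m : M) : degreeComponent ℳ d m ∈ ℳ d :=
  (DirectSum.decompose ℳ m d).2

/-- A map of degree `f` commutes with taking components. -/
lemma degreeComponent_map {M' : Type*} [AddCommGroup M'] [Module k M'] (ℳ' : ℤ → Submodule k M')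
    [DirectSum.Decomposition ℳ'] (g : M →+ M') (f : ℤ) (hg : ∀ d, ∀ m ∈ ℳ d, g m ∈ ℳ' (d + f))
    (d : ℤ) (m : M) : degreeComponent ℳ' (d + f) (g m) = g (degreeComponent ℳ d m) := by
  induction m using DirectSum.Decomposition.inductionOn ℳ with
  | zero => simp
  | @homogeneous i m =>
    by_cases h : i = d
    · subst h
      rw [(degreeComponent_eq_self_iff ℳ).mpr m.2,
        (degreeComponent_eq_self_iff ℳ').mpr (hg _ _ m.2)]
    · rw [degreeComponent_apply, degreeComponent_apply, DirectSum.decompose_of_mem_ne ℳ m.2 h,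
        DirectSum.decompose_of_mem_ne ℳ' (hg _ _ m.2) (fun h' => h (by simpa using h')), map_zero]
  | add m m' h h' => rw [map_add, map_add, map_add, map_add, h, h']

/-- The projections of a graded module on which `z_j` acts with degree `e_j`. -/
def DegreeProj.ofDecomposition {ι C : Type*} [CommRing C] [Module C M] {z : ι → C} {e : ι → ℤ}
    (h : ∀ j d, ∀ m ∈ ℳ d, z j • m ∈ ℳ (d + e j)) : DegreeProj z e M where
  proj := degreeComponent ℳ
  proj_proj d m := (degreeComponent_eq_self_iff ℳ).mpr (degreeComponent_mem ℳ d m)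
  proj_smul j d m := degreeComponent_map ℳ ℳ (DistribSMul.toAddMonoidHom M (z j)) (e j) (h j) d m

end OfDecomposition

lemma exists_extension_of_card {ι : Type*} {A : Finset ι → Type*} [∀ S, Zero (A S)] {i : ℕ}
    (c : ∀ S : {S : Finset ι // S.card = i}, A S.1) :
    ∃ c' : ∀ S, A S, (c = fun S : {S : Finset ι // S.card = i} => c' S.1) ∧
      ∀ S, S.card ≠ i → c' S = 0 := by
  refine ⟨fun S => if h : S.card = i then c ⟨S, h⟩ else 0, ?_, fun S hS => dif_neg hS⟩
  funext S
  simp only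
  rw [dif_pos S.2]

section LocalCohomology

variable {k H M : Type*} [Field k] [Ring H] [Algebra k H] {𝒜 : ℤ → Submodule k H} [GradedAlgebra 𝒜]
  [AddCommGroup M] [Module k M] [Module H M] (X : ParameterSystem 𝒜)
  (ℳ : ℤ → Submodule k M) [DirectSum.Decomposition ℳ] [SetLike.GradedSMul 𝒜 ℳ]

/-- The projections to the graded pieces of `M`, with respect to a system of parameters. -/
def ParameterSystem.degreeProj : DegreeProj X.x X.e M :=
  DegreeProj.ofDecomposition ℳ fun j d m hm => by
    have : (X.x j : H) • m ∈ ℳ (X.e j +ᵥ d) := SetLike.GradedSMul.smul_mem (X.x_mem j) hm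
    rw [vadd_eq_add, add_comm] at this
    exact this

lemma ParameterSystem.coe_locMon_mem (S : Finset (Fin X.s)) (a : Fin X.s → ℕ) :
    (((locMon X.x S a : Subalgebra.center k H)) : H) ∈ 𝒜 (locDeg X.e S a) := by
  rw [coe_locMon, locDeg]
  induction S using Finset.induction_on with
  | empty => simpa using SetLike.one_mem_graded 𝒜
  | insert j S hj ih =>
    rw [Finset.prod_insert hj, Finset.sum_insert hj, Subalgebra.coe_mul, Subalgebra.coe_pow]
    refine SetLike.mul_mem_graded ?_ ih
    rw [← nsmul_eq_mul]
    exact SetLike.pow_mem_graded _ (X.x_mem j)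

lemma CechTerm.isHomogeneous_iff {S : Finset (Fin X.s)} {n : ℤ} {w : CechTerm M X.x S} :
    CechTerm.IsHomogeneous X ℳ n w ↔ w ∈ (X.degreeProj ℳ).locStrand n S := by
  rw [DegreeProj.mem_locStrand_iff]
  constructor
  · rintro ⟨e, m, u, hu, hm, rfl⟩
    obtain ⟨a, rfl⟩ := exists_locMon X.x S u
    by_cases h0 : ((locMon X.x S a : Subalgebra.center k H) : H) = 0
    · have h1 : (0 : Subalgebra.center k H) ∈ Submonoid.closure (X.x '' (S : Set (Fin X.s))) := by
        have := (locMon X.x S a).2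
        rwa [show (locMon X.x S a : Subalgebra.center k H) = 0 from Subtype.ext h0] at this
      have := LocalizedModule.subsingleton (M := M) h1
      exact ⟨0, 0, map_zero _, Subsingleton.elim _ _⟩
    · have := DirectSum.degree_eq_of_mem_mem 𝒜 hu (X.coe_locMon_mem S a) h0
      subst this
      exact ⟨a, m, (degreeComponent_eq_self_iff ℳ).mpr hm, rfl⟩
  · rintro ⟨a, m, hm, rfl⟩
    exact ⟨_, m, _, X.coe_locMon_mem S a, (degreeComponent_eq_self_iff ℳ).mp hm, rfl⟩

omit [GradedAlgebra 𝒜] [Module k M] in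
lemma cechDifferential_apply {i : ℕ} (c : ∀ S, CechTerm M X.x S)
    (T : {S : Finset (Fin X.s) // S.card = i + 1}) :
    cechDifferential M X.x i (fun S => c S.1) T =
      coboundary (locSystem X.x M) ∅ c T.1 := by
  rw [coboundary, Finset.sdiff_empty, ← Finset.sum_coe_sort]
  simp only [cechDifferential, LinearMap.pi_apply, LinearMap.sum_apply, LinearMap.smul_apply,
    LinearMap.comp_apply, LinearMap.proj_apply]
  rfl

/-- The graded piece `H^{i,n}` of local cohomology vanishes if and only if the strand of degree `n`
of the Čech complex is exact in degree `i`. -/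
lemma notMem_localCohomologyDegrees_iff (i : ℕ) (n : ℤ) :
    n ∉ localCohomologyDegrees X ℳ i ↔
      CechExact (locSystem X.x M) ((X.degreeProj ℳ).locStrand n) ∅ Finset.univ i := by
  constructor
  · intro h c hc hcoc
    have h1 : (fun S : {S : Finset (Fin X.s) // S.card = i} => c S.1) ∈
        cechBoundaries M X.x i := by
      by_contra h2
      refine h ⟨fun S => c S.1, fun S => (CechTerm.isHomogeneous_iff X ℳ).mpr (hc S.1), ?_, h2⟩
      funext T
      rw [cechDifferential_apply]
      exact hcoc T.1 (Finset.empty_subset _) (Finset.subset_univ _) T.2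
    cases i with
    | zero =>
      refine ⟨fun _ => 0, fun _ => zero_mem _, fun T _ _ hT => ?_⟩
      have h2 := congrFun ((Submodule.mem_bot _).mp h1) ⟨T, hT⟩
      simp only [Pi.zero_apply] at h2
      rw [h2]
      simp [coboundary]
    | succ i =>
      obtain ⟨b, hb⟩ := h1
      obtain ⟨b, rfl, -⟩ := exists_extension_of_card (A := CechTerm M X.x) b
      refine ⟨fun S => (X.degreeProj ℳ).locProj S n (b S),
        fun S => (X.degreeProj ℳ).locProj_mem_locStrand n S _, fun T _ _ hT => ?_⟩
      have h2 := congrFun hb ⟨T, hT⟩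
      rw [cechDifferential_apply] at h2
      rw [← map_coboundary (fun S => (X.degreeProj ℳ).locProj S n)
        (fun _ _ h x => (X.degreeProj ℳ).locProj_locSystem h n x), h2,
        ((X.degreeProj ℳ).mem_locStrand).mp (hc T)]
  · rintro h ⟨c, hc, hcoc, hnb⟩
    apply hnb
    obtain ⟨c, rfl, hc0⟩ := exists_extension_of_card (A := CechTerm M X.x) c
    obtain ⟨b, -, hb⟩ := h c (fun S => by
      by_cases hS : S.card = i
      · exact (CechTerm.isHomogeneous_iff X ℳ).mp (hc ⟨S, hS⟩)
      · rw [hc0 S hS]; exact zero_mem _) (by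
      intro T _ _ hT
      have := congrFun hcoc ⟨T, hT⟩
      rwa [cechDifferential_apply] at this)
    cases i with
    | zero =>
      refine (Submodule.mem_bot _).mpr (funext fun S => ?_)
      have hS : S.1 = ∅ := Finset.card_eq_zero.mp S.2
      have h1 := hb S.1 (Finset.empty_subset _) (Finset.subset_univ _) S.2
      refine h1.symm.trans (Finset.sum_eq_zero fun j hj => ?_)
      simp [hS] at hj
    | succ i =>
      refine ⟨fun S => b S.1, funext fun T => ?_⟩
      rw [cechDifferential_apply]
      exact hb T.1 (Finset.empty_subset _) (Finset.subset_univ _) T.2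

end LocalCohomology

/-! ### Comparison of two families of parameters -/

section Comparison

variable {ι₁ ι₂ : Type*} [LinearOrder ι₁] [LinearOrder ι₂]
  {C₁ C₂ C : Type*} [CommRing C₁] [CommRing C₂] [CommRing C]
  {N : Type*} [AddCommGroup N] [Module C₁ N] [Module C₂ N] [Module C N]

/-- The images of two families in a common ring, as one family. -/
def joinFamily (σ₁ : C₁ →+* C) (σ₂ : C₂ →+* C) (x : ι₁ → C₁) (y : ι₂ → C₂) (j : ι₁ ⊕ₗ ι₂) : C :=
  Sum.elim (fun j => σ₁ (x j)) (fun j => σ₂ (y j)) (ofLex j)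

/-- The projections to the graded pieces, with respect to a joint family. -/
def DegreeProj.join {σ₁ : C₁ →+* C} {σ₂ : C₂ →+* C} (hσ₁ : ∀ (a : C₁) (m : N), σ₁ a • m = a • m)
    (hσ₂ : ∀ (a : C₂) (m : N), σ₂ a • m = a • m) {x : ι₁ → C₁} {y : ι₂ → C₂}
    {e₁ : ι₁ → ℤ} {e₂ : ι₂ → ℤ} (D₁ : DegreeProj x e₁ N) (D₂ : DegreeProj y e₂ N)
    (hD : D₂.proj = D₁.proj) :
    DegreeProj (joinFamily σ₁ σ₂ x y) (fun j => Sum.elim e₁ e₂ (ofLex j)) N where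
  proj := D₁.proj
  proj_proj := D₁.proj_proj
  proj_smul := by
    intro j
    obtain ⟨j, rfl⟩ := toLex.surjective j
    cases j with
    | inl j =>
      intro d m
      simp only [joinFamily, ofLex_toLex, Sum.elim_inl, hσ₁]
      exact D₁.proj_smul j d m
    | inr j =>
      intro d m
      simp only [joinFamily, ofLex_toLex, Sum.elim_inr, hσ₂]
      rw [← hD]
      exact D₂.proj_smul j d m

variable [Fintype ι₁] [Fintype ι₂]

/-- Two families of operators on a finite module which generate the same ideal up to radical have
the same graded Čech cohomology. -/
lemma cechExact_iff_of_radical [Module.Finite C N] {σ₁ : C₁ →+* C} {σ₂ : C₂ →+* C}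
    (hσ₁ : ∀ (a : C₁) (m : N), σ₁ a • m = a • m) (hσ₂ : ∀ (a : C₂) (m : N), σ₂ a • m = a • m)
    {x : ι₁ → C₁} {y : ι₂ → C₂} {e₁ : ι₁ → ℤ} {e₂ : ι₂ → ℤ} (D₁ : DegreeProj x e₁ N)
    (D₂ : DegreeProj y e₂ N) (hD : D₂.proj = D₁.proj)
    (h₁ : ∀ j, ∃ K : ℕ, ∀ m : N, ∃ g : ι₂ → N, x j ^ K • m = ∑ i, y i • g i)
    (h₂ : ∀ j, ∃ K : ℕ, ∀ m : N, ∃ g : ι₁ → N, y j ^ K • m = ∑ i, x i • g i) (n : ℤ) (i : ℕ) :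
    CechExact (locSystem x N) (D₁.locStrand n) ∅ Finset.univ i ↔
      CechExact (locSystem y N) (D₂.locStrand n) ∅ Finset.univ i := by
  let emb₁ : ι₁ ↪o ι₁ ⊕ₗ ι₂ :=
    OrderEmbedding.ofStrictMono (fun j => toLex (Sum.inl j)) Sum.Lex.inl_strictMono
  let emb₂ : ι₂ ↪o ι₁ ⊕ₗ ι₂ :=
    OrderEmbedding.ofStrictMono (fun j => toLex (Sum.inr j)) Sum.Lex.inr_strictMono
  let z := joinFamily σ₁ σ₂ x y
  have hz₁ : ∀ j, z (emb₁ j) = σ₁ (x j) := fun j => rfl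
  have hz₂ : ∀ j, z (emb₂ j) = σ₂ (y j) := fun j => rfl
  let D := D₁.join hσ₁ hσ₂ D₂ hD
  refine (cechExact_locStrand_iff_of_ringHom emb₁ σ₁ hσ₁ hz₁ (e₀ := e₁)
    (e := fun j => Sum.elim e₁ e₂ (ofLex j)) (fun _ => rfl) D₁ D rfl n Finset.univ i).trans
    (Iff.trans ?_ (cechExact_locStrand_iff_of_ringHom emb₂ σ₂ hσ₂ hz₂ (e₀ := e₂)
    (e := fun j => Sum.elim e₁ e₂ (ofLex j)) (fun _ => rfl) D₂ D hD.symm n Finset.univ i).symm)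
  rw [← cechExact_union_iff D n (Finset.univ.map emb₁.toEmbedding)
    (Finset.univ.map emb₂.toEmbedding), Finset.union_comm, cechExact_union_iff D n]
  · intro l hl
    obtain ⟨j, -, rfl⟩ := Finset.mem_map.mp hl
    obtain ⟨K, hK⟩ := h₁ j
    obtain ⟨K', a, ha, h⟩ := exists_pow_smul_eq_of_smul_mem (N := N) (f := σ₁ (x j) ^ K)
      (I := Ideal.span (z '' (Finset.univ.map emb₂.toEmbedding : Finset _))) (by
        intro m
        obtain ⟨g, hg⟩ := hK m
        rw [← map_pow, hσ₁, hg]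
        refine sum_mem fun i _ => ?_
        rw [← hσ₂, ← hz₂]
        exact Submodule.smul_mem_smul (Ideal.subset_span (Set.mem_image_of_mem _ (by simp)))
          Submodule.mem_top)
    exact ⟨K * K', a, ha, fun m => by rw [pow_mul]; exact h m⟩
  · intro l hl
    obtain ⟨j, -, rfl⟩ := Finset.mem_map.mp hl
    obtain ⟨K, hK⟩ := h₂ j
    obtain ⟨K', a, ha, h⟩ := exists_pow_smul_eq_of_smul_mem (N := N) (f := σ₂ (y j) ^ K)
      (I := Ideal.span (z '' (Finset.univ.map emb₁.toEmbedding : Finset _))) (by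
        intro m
        obtain ⟨g, hg⟩ := hK m
        rw [← map_pow, hσ₂, hg]
        refine sum_mem fun i _ => ?_
        rw [← hσ₁, ← hz₁]
        exact Submodule.smul_mem_smul (Ideal.subset_span (Set.mem_image_of_mem _ (by simp)))
          Submodule.mem_top)
    exact ⟨K * K', a, ha, fun m => by rw [pow_mul]; exact h m⟩

end Comparison

section PolynomialAction

open TensorProduct

variable {k H M : Type*} [Field k] [Ring H] [Algebra k H] {𝒜 : ℤ → Submodule k H} [GradedAlgebra 𝒜]
  [AddCommGroup M] [Module k M] [Module H M] [IsScalarTower k H M]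
  (ℳ : ℤ → Submodule k M) [DirectSum.Decomposition ℳ] [SetLike.GradedSMul 𝒜 ℳ]
  {r : ℕ} {n : Fin r → ℤ}
  {φ : MvPolynomial (Fin r) k →ₐ[k] H} (hφ : ∀ i, φ (MvPolynomial.X i) ∈ 𝒜 (n i))
  [Module (MvPolynomial (Fin r) k) M]
  (hsmul : ∀ (p : MvPolynomial (Fin r) k) (m : M), p • m = φ p • m)

omit [GradedAlgebra 𝒜] [IsScalarTower k H M] [DirectSum.Decomposition ℳ] in
include hφ hsmul in
lemma X_smul_mem (j : Fin r) (d : ℤ) (m : M) (hm : m ∈ ℳ d) :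
    (MvPolynomial.X j : MvPolynomial (Fin r) k) • m ∈ ℳ (d + n j) := by
  rw [hsmul]
  have : φ (MvPolynomial.X j) • m ∈ ℳ (n j +ᵥ d) := SetLike.GradedSMul.smul_mem (hφ j) hm
  rwa [vadd_eq_add, add_comm] at this

/-- The projections to the graded pieces of a module on which the variables act homogeneously. -/
def polynomialDegreeProj (hX : ∀ (j : Fin r) (d : ℤ), ∀ m ∈ ℳ d,
      (MvPolynomial.X j : MvPolynomial (Fin r) k) • m ∈ ℳ (d + n j)) :
    DegreeProj (MvPolynomial.X : Fin r → MvPolynomial (Fin r) k) n M :=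
  DegreeProj.ofDecomposition ℳ hX

omit [GradedAlgebra 𝒜] in
include hφ hsmul in
/-- Local cohomology with respect to `𝔪` may be computed by the Čech complex of the variables
of `R`: the two families act through the commutative ring `Z(H) ⊗ R`. -/
lemma cechExact_parameterSystem_iff [Module.Finite (MvPolynomial (Fin r) k) M] (hn : ∀ i, 0 < n i)
    (X : ParameterSystem 𝒜)
    (hx : ∀ j, ∃ K : ℕ, ∀ m : M, ∃ g : Fin r → M,
      X.x j ^ K • m = ∑ i, (MvPolynomial.X i : MvPolynomial (Fin r) k) • g i)
    (hX : ∀ (j : Fin r) (d : ℤ), ∀ m ∈ ℳ d,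
      (MvPolynomial.X j : MvPolynomial (Fin r) k) • m ∈ ℳ (d + n j)) (d : ℤ) (i : ℕ) :
    CechExact (locSystem X.x M) ((X.degreeProj ℳ).locStrand d) ∅ Finset.univ i ↔
      CechExact (locSystem (MvPolynomial.X : Fin r → MvPolynomial (Fin r) k) M)
        ((polynomialDegreeProj ℳ hX).locStrand d) ∅ Finset.univ i := by
  have hcomm : ∀ (c : Subalgebra.center k H) (p : MvPolynomial (Fin r) k) (m : M),
      c • p • m = p • c • m := by
    intro c p m
    rw [hsmul, hsmul, Subalgebra.smul_def, Subalgebra.smul_def, ← mul_smul, ← mul_smul,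
      ← (Subalgebra.mem_center_iff.mp c.2 (φ p))]
  have : SMulCommClass (Subalgebra.center k H) (MvPolynomial (Fin r) k) M := ⟨hcomm⟩
  have : IsScalarTower k (MvPolynomial (Fin r) k) M := ⟨fun c p m => by
    rw [hsmul, hsmul, map_smul, smul_assoc]⟩
  have : IsScalarTower k (Subalgebra.center k H) M := ⟨fun c p m => by
    rw [Subalgebra.smul_def, Subalgebra.smul_def, Subalgebra.coe_smul, smul_assoc]⟩
  let _ : Module (Subalgebra.center k H ⊗[k] MvPolynomial (Fin r) k) M :=
    TensorProduct.Algebra.module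
  let σ₁ : Subalgebra.center k H →+* Subalgebra.center k H ⊗[k] MvPolynomial (Fin r) k :=
    (Algebra.TensorProduct.includeLeft :
      Subalgebra.center k H →ₐ[k] Subalgebra.center k H ⊗[k] MvPolynomial (Fin r) k).toRingHom
  let σ₂ : MvPolynomial (Fin r) k →+* Subalgebra.center k H ⊗[k] MvPolynomial (Fin r) k :=
    (Algebra.TensorProduct.includeRight :
      MvPolynomial (Fin r) k →ₐ[k] Subalgebra.center k H ⊗[k] MvPolynomial (Fin r) k).toRingHom
  have hσ₁ : ∀ (a : Subalgebra.center k H) (m : M), σ₁ a • m = a • m := fun a m => by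
    change (a ⊗ₜ[k] (1 : MvPolynomial (Fin r) k)) • m = _
    rw [TensorProduct.Algebra.smul_def, one_smul]
  have hσ₂ : ∀ (a : MvPolynomial (Fin r) k) (m : M), σ₂ a • m = a • m := fun a m => by
    change ((1 : Subalgebra.center k H) ⊗ₜ[k] a) • m = _
    rw [TensorProduct.Algebra.smul_def, one_smul]
  have : Module.Finite (Subalgebra.center k H ⊗[k] MvPolynomial (Fin r) k) M := by
    obtain ⟨t, ht⟩ := Module.Finite.fg_top (R := MvPolynomial (Fin r) k) (M := M)
    refine ⟨⟨t, eq_top_iff.mpr fun m _ => ?_⟩⟩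
    have hm : m ∈ Submodule.span (MvPolynomial (Fin r) k) (t : Set M) := ht ▸ Submodule.mem_top
    induction hm using Submodule.span_induction with
    | mem m hm => exact Submodule.subset_span hm
    | zero => exact zero_mem _
    | add m m' _ _ h h' => exact add_mem (h Submodule.mem_top) (h' Submodule.mem_top)
    | smul p m _ h => rw [← hσ₂]; exact Submodule.smul_mem _ _ (h Submodule.mem_top)
  refine cechExact_iff_of_radical hσ₁ hσ₂ (X.degreeProj ℳ) (polynomialDegreeProj ℳ hX) rfl hx
    (fun j => ?_) d i
  obtain ⟨K, hK⟩ := X.radical (n j) (hn j) _ (hφ j)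
  obtain ⟨c, hc⟩ := (Submodule.mem_span_range_iff_exists_fun H).mp hK
  refine ⟨K, fun m => ⟨fun i => c i • m, ?_⟩⟩
  rw [hsmul, map_pow, ← hc, Finset.sum_smul]
  refine Finset.sum_congr rfl fun i _ => ?_
  rw [Subalgebra.smul_def, smul_eq_mul, Subalgebra.mem_center_iff.mp (X.x i).2, mul_smul]

end PolynomialAction

/-! ### Localizations of free modules inside Laurent polynomials -/

section Laurent

variable (k : Type*) [Field k] (r : ℕ)

/-- Laurent polynomials `k[ζ_1^{±1}, …, ζ_r^{±1}]`. -/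
abbrev Laurent : Type _ := AddMonoidAlgebra k (Fin r → ℤ)

/-- The inclusion of polynomials in Laurent polynomials. -/
def toLaurent : MvPolynomial (Fin r) k →ₐ[k] Laurent k r :=
  MvPolynomial.aeval fun j => AddMonoidAlgebra.single (Pi.single j 1) 1

variable {k r}

lemma toLaurent_prod_X_pow (S : Finset (Fin r)) (a : Fin r → ℕ) :
    toLaurent k r (∏ j ∈ S, MvPolynomial.X j ^ a j) =
      AddMonoidAlgebra.single (fun j => if j ∈ S then (a j : ℤ) else 0) 1 := by
  rw [map_prod]
  induction S using Finset.induction_on with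
  | empty => simp only [Finset.prod_empty, Finset.notMem_empty, if_false]; rfl
  | insert l S hl ih =>
    rw [Finset.prod_insert hl, ih, map_pow, toLaurent, MvPolynomial.aeval_X,
      AddMonoidAlgebra.single_pow, AddMonoidAlgebra.single_mul_single, one_pow, one_mul]
    congr 1
    funext j
    by_cases h : j = l
    · subst h; simp [hl]
    · simp [h]

lemma toLaurent_monomial (b : Fin r →₀ ℕ) (c : k) :
    toLaurent k r (MvPolynomial.monomial b c) =
      AddMonoidAlgebra.single (fun j => (b j : ℤ)) c := by
  have e : algebraMap k (Laurent k r) c = AddMonoidAlgebra.single 0 c := rfl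
  rw [MvPolynomial.monomial_eq, Finsupp.prod_fintype _ _ (by simp), map_mul, toLaurent_prod_X_pow,
    toLaurent, MvPolynomial.algHom_C, e, AddMonoidAlgebra.single_mul_single]
  simp

lemma coeff_toLaurent (p : MvPolynomial (Fin r) k) (a : Fin r → ℤ) :
    (toLaurent k r p).coeff a =
      if ∀ j, 0 ≤ a j then p.coeff (Finsupp.equivFunOnFinite.symm fun j => (a j).toNat) else 0 := by
  induction p using MvPolynomial.induction_on' with
  | monomial b c =>
    rw [toLaurent_monomial, AddMonoidAlgebra.coeff_single, MvPolynomial.coeff_monomial]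
    by_cases h : (fun j => (b j : ℤ)) = a
    · subst h
      rw [Finsupp.single_eq_same, if_pos (fun j => Int.natCast_nonneg _), if_pos]
      ext j; simp
    · rw [Finsupp.single_eq_of_ne (fun h' => h h'.symm)]
      split_ifs with h1 h2
      · exact absurd (funext fun j => by rw [h2]; simp [h1 j]) h
      · rfl
      · rfl
  | add p q hp hq =>
    rw [map_add, AddMonoidAlgebra.coeff_add, Finsupp.add_apply, hp, hq, MvPolynomial.coeff_add]
    split_ifs <;> simp

lemma toLaurent_injective : Function.Injective (toLaurent k r) := by
  rw [injective_iff_map_eq_zero]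
  intro p hp
  ext b
  have h := coeff_toLaurent p fun j => (b j : ℤ)
  rw [hp, if_pos (fun j => Int.natCast_nonneg _)] at h
  have e : (Finsupp.equivFunOnFinite.symm fun j => ((b j : ℤ)).toNat) = b := by ext j; simp
  rw [e] at h
  simpa using h.symm

lemma exists_toLaurent_eq {p : Laurent k r} (h : ∀ a, p.coeff a ≠ 0 → ∀ j, 0 ≤ a j) :
    ∃ f, toLaurent k r f = p := by
  refine ⟨∑ a ∈ p.coeff.support, MvPolynomial.monomial
    (Finsupp.equivFunOnFinite.symm fun j => (a j).toNat) (p.coeff a), ?_⟩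
  rw [map_sum]
  conv_rhs => rw [← AddMonoidAlgebra.sum_coeff_single p]
  refine Finset.sum_congr rfl fun a ha => ?_
  rw [toLaurent_monomial]
  congr 1
  funext j
  simp [h a (Finsupp.mem_support_iff.mp ha) j]

lemma coeff_single_one_mul_add (s a : Fin r → ℤ) (p : Laurent k r) :
    (AddMonoidAlgebra.single s 1 * p).coeff (a + s) = p.coeff a := by
  rw [AddMonoidAlgebra.coeff_single_mul_eq_mul_coeff (m₂ := a), one_mul]
  intro b _
  rw [add_comm a s]
  exact add_right_inj s

lemma exists_of_coeff_mul_ne_zero {p q : Laurent k r} {a : Fin r → ℤ} (h : (p * q).coeff a ≠ 0) :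
    ∃ b c, b + c = a ∧ p.coeff b ≠ 0 ∧ q.coeff c ≠ 0 := by
  have := AddMonoidAlgebra.support_coeff_mul_subset p q (Finsupp.mem_support_iff.mpr h)
  obtain ⟨b, hb, c, hc, e⟩ := Finset.mem_add.mp this
  exact ⟨b, c, e, Finsupp.mem_support_iff.mp hb, Finsupp.mem_support_iff.mp hc⟩

/-- The action of polynomials on Laurent polynomials. -/
instance : Algebra (MvPolynomial (Fin r) k) (Laurent k r) := (toLaurent k r).toRingHom.toAlgebra

lemma algebraMap_laurent (p : MvPolynomial (Fin r) k) :
    algebraMap (MvPolynomial (Fin r) k) (Laurent k r) p = toLaurent k r p := rfl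

lemma smul_laurent (p : MvPolynomial (Fin r) k) (q : Laurent k r) : p • q = toLaurent k r p * q :=
  rfl

/-- The inclusion of a free module in the free module over Laurent polynomials. -/
def freeToLaurent (m : ℕ) :
    (Fin m → MvPolynomial (Fin r) k) →ₗ[MvPolynomial (Fin r) k] (Fin m → Laurent k r) :=
  LinearMap.pi fun v => (Algebra.linearMap _ (Laurent k r)) ∘ₗ LinearMap.proj v

lemma freeToLaurent_apply {m : ℕ} (f : Fin m → MvPolynomial (Fin r) k) (v : Fin m) :
    freeToLaurent m f v = toLaurent k r (f v) := rfl

lemma isUnit_toLaurent {S : Finset (Fin r)}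
    (u : Submonoid.closure ((MvPolynomial.X : Fin r → MvPolynomial (Fin r) k) '' (S : Set (Fin r)))) :
    IsUnit (toLaurent k r u) := by
  obtain ⟨a, rfl⟩ := exists_locMon _ S u
  rw [coe_locMon, toLaurent_prod_X_pow]
  refine IsUnit.of_mul_eq_one (AddMonoidAlgebra.single (-fun j => if j ∈ S then (a j : ℤ) else 0) 1)
    ?_
  rw [AddMonoidAlgebra.single_mul_single, add_neg_cancel, one_mul]; rfl

/-- The localizations of a free module `F = R^m` as subgroups of `k[ζ^{±1}]^m`. -/
def locToLaurent (k : Type*) [Field k] {r : ℕ} (m : ℕ) (S : Finset (Fin r)) :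
    Loc (MvPolynomial.X : Fin r → MvPolynomial (Fin r) k) (Fin m → MvPolynomial (Fin r) k) S
      →ₗ[MvPolynomial (Fin r) k] (Fin m → Laurent k r) :=
  LocalizedModule.lift _ (freeToLaurent m) fun u => by
    have h := (isUnit_toLaurent u).map
      (Algebra.lsmul (MvPolynomial (Fin r) k) (MvPolynomial (Fin r) k) (Fin m → Laurent k r) :
        Laurent k r →ₐ[MvPolynomial (Fin r) k] _)
    rwa [← algebraMap_laurent, AlgHom.commutes] at h

section locToLaurent

variable {m : ℕ} {S T : Finset (Fin r)}

lemma toLaurent_mul_locToLaurent (f : Fin m → MvPolynomial (Fin r) k)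
    (u : Submonoid.closure ((MvPolynomial.X : Fin r → MvPolynomial (Fin r) k) '' (S : Set (Fin r))))
    (v : Fin m) :
    toLaurent k r u * locToLaurent k m S (LocalizedModule.mk f u) v = toLaurent k r (f v) := by
  have h : (u : MvPolynomial (Fin r) k) • locToLaurent k m S (LocalizedModule.mk f u) =
      freeToLaurent m f := by
    rw [← map_smul, LocalizedModule.smul'_mk, ← Submonoid.smul_def, LocalizedModule.mk_cancel,
      locToLaurent, LocalizedModule.lift_mk_one]
  have := congrFun h v
  rwa [Pi.smul_apply, smul_laurent, freeToLaurent_apply] at this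

lemma locToLaurent_eq_iff {w : Fin m → Laurent k r} (f : Fin m → MvPolynomial (Fin r) k)
    (u : Submonoid.closure ((MvPolynomial.X : Fin r → MvPolynomial (Fin r) k) '' (S : Set (Fin r)))) :
    locToLaurent k m S (LocalizedModule.mk f u) = w ↔
      ∀ v, toLaurent k r u * w v = toLaurent k r (f v) := by
  constructor
  · rintro rfl v; exact toLaurent_mul_locToLaurent f u v
  · intro h
    funext v
    exact (isUnit_toLaurent u).mul_left_cancel ((toLaurent_mul_locToLaurent f u v).trans (h v).symm)

lemma coeff_locToLaurent (f : Fin m → MvPolynomial (Fin r) k) (b : Fin r → ℕ) (v : Fin m)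
    (a : Fin r → ℤ) :
    (locToLaurent k m S (LocalizedModule.mk f (locMon _ S b)) v).coeff a =
      (toLaurent k r (f v)).coeff (a + fun j => if j ∈ S then (b j : ℤ) else 0) := by
  rw [← toLaurent_mul_locToLaurent f (locMon _ S b) v, coe_locMon, toLaurent_prod_X_pow,
    coeff_single_one_mul_add]

lemma locToLaurent_injective : Function.Injective (locToLaurent k m S) := by
  rw [← LinearMap.ker_eq_bot, LinearMap.ker_eq_bot']
  intro x hx
  induction x using LocalizedModule.induction_on with
  | h f u =>
    rw [locToLaurent_eq_iff] at hx
    have : f = 0 := funext fun v => toLaurent_injective (by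
      rw [← hx v, Pi.zero_apply, Pi.zero_apply, mul_zero, map_zero])
    rw [this, LocalizedModule.zero_mk]

lemma locToLaurent_locSystem (h : S ⊆ T)
    (x : Loc (MvPolynomial.X : Fin r → MvPolynomial (Fin r) k) (Fin m → MvPolynomial (Fin r) k) S) :
    locToLaurent k m T (locSystem _ _ h x) = locToLaurent k m S x := by
  induction x using LocalizedModule.induction_on with
  | h f u =>
    rw [locSystem_mk, locToLaurent_eq_iff]
    exact toLaurent_mul_locToLaurent f u

lemma nonneg_of_coeff_locToLaurent_ne_zero
    {x : Loc (MvPolynomial.X : Fin r → MvPolynomial (Fin r) k) (Fin m → MvPolynomial (Fin r) k) S}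
    {v : Fin m} {a : Fin r → ℤ} (h : (locToLaurent k m S x v).coeff a ≠ 0) {j : Fin r} (hj : j ∉ S) :
    0 ≤ a j := by
  obtain ⟨b, f, rfl⟩ := exists_eq_mk_locMon _ x
  rw [coeff_locToLaurent, coeff_toLaurent] at h
  have := (ite_ne_right_iff.mp h).1 j
  simpa [hj] using this

/-- The Laurent polynomials whose exponents are negative only inside `S` are the elements of the
localization at `S`. -/
lemma exists_locToLaurent_eq {w : Fin m → Laurent k r}
    (h : ∀ v a, (w v).coeff a ≠ 0 → ∀ j ∉ S, 0 ≤ a j) : ∃ x, locToLaurent k m S x = w := by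
  -- a common denominator
  obtain ⟨N, hN⟩ : ∃ N : ℕ, ∀ v a, (w v).coeff a ≠ 0 → ∀ j, 0 ≤ a j + N := by
    let B : Finset (Fin r → ℤ) := Finset.univ.biUnion fun v => (w v).coeff.support
    refine ⟨∑ a ∈ B, ∑ j, Int.natAbs ((a : Fin r → ℤ) j), fun v a ha j => ?_⟩
    have h1 : (a j).natAbs ≤ ∑ a ∈ B, ∑ j, Int.natAbs ((a : Fin r → ℤ) j) :=
      (Finset.single_le_sum (f := fun j => (a j).natAbs) (fun _ _ => Nat.zero_le _)
        (Finset.mem_univ j)).trans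
        (Finset.single_le_sum (f := fun a : Fin r → ℤ => ∑ j, (a j).natAbs) (fun _ _ => Nat.zero_le _)
          (Finset.mem_biUnion.mpr ⟨v, Finset.mem_univ v, Finsupp.mem_support_iff.mpr ha⟩))
    omega
  have h2 : ∀ v, ∃ f, toLaurent k r f =
      toLaurent k r (locMon (MvPolynomial.X : Fin r → MvPolynomial (Fin r) k) S fun _ => N) *
        w v := by
    intro v
    apply exists_toLaurent_eq
    rw [coe_locMon, toLaurent_prod_X_pow]
    intro a ha j
    obtain ⟨b, c, rfl, hb, hc⟩ := exists_of_coeff_mul_ne_zero ha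
    rw [AddMonoidAlgebra.coeff_single] at hb
    have hbc := (Finsupp.single_apply_ne_zero.mp hb).1
    subst hbc
    by_cases hj : j ∈ S
    · simp only [Pi.add_apply, if_pos hj]
      have := hN v c hc j
      omega
    · simpa [hj] using h v c hc j hj
  choose f hf using h2
  exact ⟨LocalizedModule.mk f (locMon _ S fun _ => N),
    (locToLaurent_eq_iff f _).mpr fun v => (hf v).symm⟩

/-- The map on Laurent polynomials given by the matrix of a map of free modules. -/
def laurentMap {m' : ℕ} (g : (Fin m' → MvPolynomial (Fin r) k) →ₗ[MvPolynomial (Fin r) k]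
    (Fin m → MvPolynomial (Fin r) k)) (w : Fin m' → Laurent k r) (v : Fin m) : Laurent k r :=
  ∑ u, toLaurent k r (g (Pi.single u 1) v) * w u

lemma locToLaurent_locMap {m' : ℕ} (g : (Fin m' → MvPolynomial (Fin r) k)
      →ₗ[MvPolynomial (Fin r) k] (Fin m → MvPolynomial (Fin r) k))
    (x : Loc (MvPolynomial.X : Fin r → MvPolynomial (Fin r) k)
      (Fin m' → MvPolynomial (Fin r) k) S) :
    locToLaurent k m S (locMap _ g S x) = laurentMap g (locToLaurent k m' S x) := by
  induction x using LocalizedModule.induction_on with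
  | h f u =>
    rw [locMap_mk, locToLaurent_eq_iff]
    intro v
    rw [laurentMap, Finset.mul_sum]
    conv_rhs => rw [pi_eq_sum_univ' f, map_sum, Finset.sum_apply, map_sum]
    refine Finset.sum_congr rfl fun l _ => ?_
    rw [mul_left_comm, toLaurent_mul_locToLaurent, map_smul, Pi.smul_apply, smul_eq_mul, map_mul,
      mul_comm]

end locToLaurent

end Laurent

/-! ### Čech cohomology of graded free modules -/

section FreeModules

open MvPolynomial

variable {k : Type*} [Field k] {r : ℕ} (n : Fin r → ℤ)

/-- The weight of a Laurent exponent. -/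
def laurentWeight (a : Fin r → ℤ) : ℤ := ∑ j, a j * n j

lemma laurentWeight_add (a b : Fin r → ℤ) :
    laurentWeight n (a + b) = laurentWeight n a + laurentWeight n b := by
  simp [laurentWeight, add_mul, Finset.sum_add_distrib]

lemma weight_eq_laurentWeight (b : Fin r →₀ ℕ) :
    Finsupp.weight n b = laurentWeight n fun j => (b j : ℤ) := by
  rw [Finsupp.weight_apply, Finsupp.sum_fintype _ _ (by simp), laurentWeight]
  simp

lemma laurentWeight_locDeg (S : Finset (Fin r)) (b : Fin r → ℕ) :
    laurentWeight n (fun j => if j ∈ S then (b j : ℤ) else 0) = locDeg n S b := by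
  simp [laurentWeight, locDeg, ite_mul, Finset.sum_ite_mem]

lemma coeff_toLaurent_weightedHomogeneousComponent (p : MvPolynomial (Fin r) k) (d : ℤ)
    (a : Fin r → ℤ) :
    (toLaurent k r (weightedHomogeneousComponent n d p)).coeff a =
      if laurentWeight n a = d then (toLaurent k r p).coeff a else 0 := by
  rw [coeff_toLaurent, coeff_toLaurent]
  by_cases h : ∀ j, 0 ≤ a j
  · rw [if_pos h, if_pos h, coeff_weightedHomogeneousComponent, weight_eq_laurentWeight]
    have e : (fun j => (((Finsupp.equivFunOnFinite.symm fun j => (a j).toNat) j : ℕ) : ℤ)) = a := by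
      funext j; simp [h j]
    rw [e]
  · rw [if_neg h, if_neg h, ite_self]

lemma weightedHomogeneousComponent_X_mul (j : Fin r) (d : ℤ) (p : MvPolynomial (Fin r) k) :
    weightedHomogeneousComponent n (d + n j) (X j * p) =
      X j * weightedHomogeneousComponent n d p := by
  ext b
  rw [coeff_weightedHomogeneousComponent, coeff_X_mul', coeff_X_mul',
    coeff_weightedHomogeneousComponent]
  by_cases h : j ∈ b.support
  · rw [if_pos h, if_pos h]
    have h1 : b = (b - Finsupp.single j 1) + Finsupp.single j 1 :=
      (tsub_add_cancel_of_le (by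
        rw [Finsupp.single_le_iff]
        exact Nat.one_le_iff_ne_zero.mpr (Finsupp.mem_support_iff.mp h))).symm
    have h2 : Finsupp.weight n b = Finsupp.weight n (b - Finsupp.single j 1) + n j := by
      conv_lhs => rw [h1]
      rw [map_add, Finsupp.weight_single, one_smul]
    rw [h2]
    simp
  · rw [if_neg h, if_neg h, ite_self]

variable {m : ℕ} (deg : Fin m → ℤ)

/-- The graded free module on generators of degrees `deg`, through its projections. -/
def freeDegreeProj :
    DegreeProj (X : Fin r → MvPolynomial (Fin r) k) n (Fin m → MvPolynomial (Fin r) k) where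
  proj d := AddMonoidHom.mk' (fun f v => weightedHomogeneousComponent n (d - deg v) (f v))
    fun f g => funext fun v => by rw [Pi.add_apply, map_add]; rfl
  proj_proj d f := funext fun v => weightedHomogeneousComponent_eq_self
    (weightedHomogeneousComponent_isWeightedHomogeneous _ _)
  proj_smul j d f := funext fun v => by
    change weightedHomogeneousComponent n (d + n j - deg v) (X j * f v) =
      X j * weightedHomogeneousComponent n (d - deg v) (f v)
    rw [← weightedHomogeneousComponent_X_mul]; congr 1; ring_nf

lemma freeDegreeProj_apply (d : ℤ) (f : Fin m → MvPolynomial (Fin r) k) (v : Fin m) :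
    (freeDegreeProj n deg).proj d f v = weightedHomogeneousComponent n (d - deg v) (f v) := rfl

lemma coeff_locToLaurent_locProj (d : ℤ) {S : Finset (Fin r)}
    (x : Loc (X : Fin r → MvPolynomial (Fin r) k) (Fin m → MvPolynomial (Fin r) k) S) (v : Fin m)
    (a : Fin r → ℤ) :
    (locToLaurent k m S ((freeDegreeProj n deg).locProj S d x) v).coeff a =
      if laurentWeight n a + deg v = d then (locToLaurent k m S x v).coeff a else 0 := by
  obtain ⟨b, f, rfl⟩ := exists_eq_mk_locMon _ x
  rw [DegreeProj.locProj_mk, coeff_locToLaurent, coeff_locToLaurent, freeDegreeProj_apply,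
    coeff_toLaurent_weightedHomogeneousComponent, laurentWeight_add, laurentWeight_locDeg]
  congr 1
  rw [eq_iff_iff]
  constructor <;> intro h <;> linarith

variable {n deg} in
lemma mem_locStrand_free_iff {d : ℤ} {S : Finset (Fin r)}
    {x : Loc (X : Fin r → MvPolynomial (Fin r) k) (Fin m → MvPolynomial (Fin r) k) S} :
    x ∈ (freeDegreeProj n deg).locStrand d S ↔
      ∀ v a, (locToLaurent k m S x v).coeff a ≠ 0 → laurentWeight n a + deg v = d := by
  rw [DegreeProj.mem_locStrand, ← locToLaurent_injective.eq_iff]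
  constructor
  · intro h v a ha
    rw [← h, coeff_locToLaurent_locProj] at ha
    exact (ite_ne_right_iff.mp ha).1
  · intro h
    funext v
    ext a
    rw [coeff_locToLaurent_locProj]
    split_ifs with h1
    · rfl
    · by_contra h2
      exact h1 (h v a fun h3 => h2 h3.symm)

/-- The elements of `k[ζ^{±1}]^m` with all exponents satisfying a given condition. -/
def supportedIn (Q : Fin m → (Fin r → ℤ) → Prop) : AddSubgroup (Fin m → Laurent k r) where
  carrier := {w | ∀ v a, (w v).coeff a ≠ 0 → Q v a}
  add_mem' := by
    intro w w' hw hw' v a h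
    rw [Pi.add_apply, AddMonoidAlgebra.coeff_add, Finsupp.add_apply] at h
    by_cases h1 : (w v).coeff a = 0
    · exact hw' v a fun h2 => h (by rw [h1, h2, add_zero])
    · exact hw v a h1
  zero_mem' := by intro v a h; simp at h
  neg_mem' := by
    intro w hw v a h
    refine hw v a fun h1 => h ?_
    rw [Pi.neg_apply, AddMonoidAlgebra.coeff_neg, Finsupp.neg_apply, h1, neg_zero]

open Classical in
/-- The part of an element of `k[ζ^{±1}]^m` with exponents satisfying a given condition. -/
def restrictSupport (Q : (Fin r → ℤ) → Prop) :
    (Fin m → Laurent k r) →+ (Fin m → Laurent k r) :=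
  AddMonoidHom.mk' (fun w v => AddMonoidAlgebra.ofCoeff ((w v).coeff.filter Q)) fun w w' => by
    funext v
    ext a
    simp only [Pi.add_apply, AddMonoidAlgebra.coeff_add, Finsupp.filter_add]

open Classical in
lemma coeff_restrictSupport (Q : (Fin r → ℤ) → Prop) (w : Fin m → Laurent k r) (v : Fin m)
    (a : Fin r → ℤ) :
    (restrictSupport Q w v).coeff a = if Q a then (w v).coeff a else 0 := by
  change ((w v).coeff.filter Q) a = _
  rw [Finsupp.filter_apply]

/-- The exponents whose first nonnegative entry is the `j`-th. -/
def firstNonneg (j : Fin r) (a : Fin r → ℤ) : Prop := 0 ≤ a j ∧ ∀ l < j, a l < 0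

lemma exists_firstNonneg {a : Fin r → ℤ} (h : ∃ j, 0 ≤ a j) : ∃ j, firstNonneg j a := by
  classical
  obtain ⟨j, hj, hmin⟩ := WellFounded.has_min (wellFounded_lt (α := Fin r)) {j | 0 ≤ a j} h
  exact ⟨j, hj, fun l hl => not_le.mp fun h => hmin l h hl⟩

lemma firstNonneg_unique {a : Fin r → ℤ} {j l : Fin r} (hj : firstNonneg j a)
    (hl : firstNonneg l a) : j = l := by
  rcases lt_trichotomy j l with h | h | h
  · exact absurd hj.1 (not_le.mpr (hl.2 j h))
  · exact h
  · exact absurd hl.1 (not_le.mpr (hj.2 l h))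

variable {n deg} in
/-- A cocycle with values in a graded free module is a coboundary if every Laurent monomial in it
has a nonnegative exponent: on the part where the first nonnegative exponent is that of `ζ_j`, the
restriction maps adding `j` are isomorphisms. -/
lemma exists_coboundary_of_nonneg {d : ℤ} {i : ℕ}
    {c : ∀ S, Loc (X : Fin r → MvPolynomial (Fin r) k) (Fin m → MvPolynomial (Fin r) k) S}
    (hc : ∀ S, c S ∈ (freeDegreeProj n deg).locStrand d S)
    (hcoc : ∀ T : Finset (Fin r), T.card = i + 1 → coboundary (locSystem _ _) ∅ c T = 0)
    (hnn : ∀ T : Finset (Fin r), T.card = i → ∀ v a,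
      (locToLaurent k m T (c T) v).coeff a ≠ 0 → ∃ j, 0 ≤ a j) :
    ∃ b : ∀ S, Loc (X : Fin r → MvPolynomial (Fin r) k) (Fin m → MvPolynomial (Fin r) k) S,
      (∀ S, b S ∈ (freeDegreeProj n deg).locStrand d S) ∧
      ∀ T : Finset (Fin r), T.card = i → coboundary (locSystem _ _) ∅ b T = c T := by
  classical
  let A : Finset (Fin r) → Type _ := fun _ => Fin m → Laurent k r
  let _ : ∀ S, AddCommGroup (A S) := fun S =>
    inferInstanceAs (AddCommGroup (Fin m → Laurent k r))
  let ρ : ∀ ⦃S T : Finset (Fin r)⦄, S ⊆ T → A S →+ A T := fun _ _ _ => AddMonoidHom.id _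
  have hρ : IsCoeffSystem ρ := ⟨fun _ _ => rfl, fun _ _ _ => rfl⟩
  let P : Fin r → ∀ S, AddSubgroup (A S) := fun j S => supportedIn fun v a =>
    (∀ l ∉ S, 0 ≤ a l) ∧ laurentWeight n a + deg v = d ∧ firstNonneg j a
  let Θ : ∀ S, Loc (X : Fin r → MvPolynomial (Fin r) k) (Fin m → MvPolynomial (Fin r) k) S →+ A S :=
    fun S => (locToLaurent k m S).toAddMonoidHom
  have hΘ : ∀ S x, Θ S x = locToLaurent k m S x := fun _ _ => rfl
  have hΘρ : ∀ ⦃S T : Finset (Fin r)⦄ (h : S ⊆ T) (x), Θ T (locSystem _ _ h x) = ρ h (Θ S x) :=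
    fun S T h x => locToLaurent_locSystem h x
  let c' : Fin r → ∀ S, A S := fun j S => restrictSupport (firstNonneg j) (Θ S (c S))
  have hc'P : ∀ j S, c' j S ∈ P j S := by
    intro j S v a h
    simp only [c'] at h
    rw [coeff_restrictSupport, hΘ] at h
    obtain ⟨h1, h2⟩ := ite_ne_right_iff.mp h
    exact ⟨fun l hl => nonneg_of_coeff_locToLaurent_ne_zero h2 hl,
      mem_locStrand_free_iff.mp (hc S) v a h2, h1⟩
  have hc'coc : ∀ j T, T.card = i + 1 → coboundary ρ ∅ (c' j) T = 0 := by
    intro j T hT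
    have h1 := map_coboundary (ρ := ρ) (σ := ρ) (fun _ => restrictSupport (firstNonneg j))
      (fun _ _ _ _ => rfl) ∅ (fun S => Θ S (c S)) T
    have h2 := map_coboundary (σ := ρ) Θ hΘρ ∅ c T
    rw [hcoc T hT, map_zero] at h2
    rw [← h2, map_zero] at h1
    exact h1.symm
  have hb' : ∀ j, ∃ b : ∀ S, A S, (∀ S, b S ∈ P j S) ∧
      ∀ T, T.card = i → coboundary ρ ∅ b T = c' j T := by
    intro j
    obtain ⟨K, b, hbP, hb⟩ := exists_pow_smul_eq_coboundary (C := ℤ) (a := 1) (V := ∅)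
      (U := Finset.univ) (j := j) (P := P j) (i := i) (c := c' j) hρ
      (fun S T h x hx v a ha => ⟨fun l hl => (hx v a ha).1 l fun hl' => hl (h hl'),
        (hx v a ha).2⟩)
      (fun _ _ _ _ _ => rfl) (fun S x hx => by rwa [one_smul]) (Finset.mem_univ j)
      (Finset.notMem_empty j)
      (fun S hS w hw => ⟨0, w, fun v a ha => ⟨fun l hl => by
        by_cases hlj : l = j
        · rw [hlj]; exact (hw v a ha).2.2.1
        · exact (hw v a ha).1 l fun h => (Finset.mem_insert.mp h).elim hlj hl, (hw v a ha).2⟩, by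
          rw [pow_zero, one_smul]; rfl⟩)
      (fun S hS v _ hv => ⟨0, by rw [pow_zero, one_smul]; exact hv⟩) (hc'P j)
      (fun T _ _ hT => hc'coc j T hT)
    exact ⟨b, hbP, fun T hT => by
      rw [hb T (Finset.empty_subset _) (Finset.subset_univ _) hT, one_pow, one_smul]⟩
  choose b' hb'P hb' using hb'
  have hlift : ∀ S, ∃ x, Θ S x = ∑ j, b' j S := by
    intro S
    refine exists_locToLaurent_eq fun v a ha l hl => ?_
    have h1 : (∑ j, b' j S) ∈ supportedIn (k := k) (m := m) (r := r)
        fun _ a => ∀ l ∉ S, 0 ≤ a l := sum_mem fun j _ v a h => (hb'P j S v a h).1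
    exact h1 v a ha l hl
  choose b hb using hlift
  refine ⟨b, fun S => mem_locStrand_free_iff.mpr fun v a ha => ?_, fun T hT => ?_⟩
  · have h1 : (∑ j, b' j S) ∈ supportedIn (k := k) (m := m) (r := r)
        fun v a => laurentWeight n a + deg v = d := sum_mem fun j _ v a h => (hb'P j S v a h).2.1
    rw [← hb] at h1
    exact h1 v a ha
  · apply locToLaurent_injective
    have h1 := map_coboundary (σ := ρ) Θ hΘρ ∅ b T
    simp only [hb] at h1
    rw [coboundary_sum, Finset.sum_congr rfl fun j _ => hb' j T hT] at h1
    rw [← hΘ, ← hΘ, h1]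
    funext v
    ext a
    have h2 : (∑ j, c' j T) v = ∑ j, c' j T v := Finset.sum_apply v _ _
    rw [h2, AddMonoidAlgebra.coeff_sum, Finsupp.finsetSum_apply]
    simp only [c', coeff_restrictSupport]
    by_cases h0 : (Θ T (c T) v).coeff a = 0
    · rw [h0]; simp
    · obtain ⟨j, hj⟩ := exists_firstNonneg (hnn T hT v a h0)
      rw [Finset.sum_eq_single j, if_pos hj]
      · intro l _ hl
        rw [if_neg fun h => hl (firstNonneg_unique h hj)]
      · intro h; exact absurd (Finset.mem_univ j) h

end FreeModules

/-! ### Local cohomology from a minimal free resolution -/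

section Resolution

open MvPolynomial

variable {k : Type*} [Field k] {r : ℕ} {n : Fin r → ℤ}

lemma weightedHomogeneousComponent_mul {p q : MvPolynomial (Fin r) k} {e : ℤ}
    (hq : IsWeightedHomogeneous n q e) (d : ℤ) :
    weightedHomogeneousComponent n (d + e) (p * q) = weightedHomogeneousComponent n d p * q := by
  classical
  let _ := weightedGradedAlgebra k n
  have h := DirectSum.coe_decompose_mul_add_of_right_mem
    (𝒜 := weightedHomogeneousSubmodule k n) (i := d) (j := e) (a := p) (b := q) hq
  exact (decompose'_apply k n _ _).symm.trans
    (h.trans (congrArg (· * q) (decompose'_apply k n p d)))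

/-- A map from a graded free module preserves degrees if it does so on multiples of the basis
elements. -/
lemma map_freeDegreeProj {m : ℕ} {deg : Fin m → ℤ} {N : Type*} [AddCommGroup N]
    [Module (MvPolynomial (Fin r) k) N] (D : DegreeProj (X : Fin r → MvPolynomial (Fin r) k) n N)
    (g : (Fin m → MvPolynomial (Fin r) k) →ₗ[MvPolynomial (Fin r) k] N)
    (hg : ∀ u d (p : MvPolynomial (Fin r) k), D.proj d (p • g (Pi.single u 1)) =
      weightedHomogeneousComponent n (d - deg u) p • g (Pi.single u 1)) (d : ℤ)
    (x : Fin m → MvPolynomial (Fin r) k) :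
    g ((freeDegreeProj n deg).proj d x) = D.proj d (g x) := by
  conv_rhs => rw [pi_eq_sum_univ' x, map_sum, map_sum]
  rw [pi_eq_sum_univ' ((freeDegreeProj n deg).proj d x), map_sum]
  refine Finset.sum_congr rfl fun u _ => ?_
  rw [map_smul, map_smul, hg, freeDegreeProj_apply]

variable {M : Type*} [AddCommGroup M] [Module k M] [Module (MvPolynomial (Fin r) k) M]
  {ℳ : ℤ → Submodule k M}

section Scalar

variable [IsScalarTower k (MvPolynomial (Fin r) k) M]
  (hX : ∀ (j : Fin r) (d : ℤ), ∀ m ∈ ℳ d, (X j : MvPolynomial (Fin r) k) • m ∈ ℳ (d + n j))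

include hX in
lemma monomial_smul_mem {e : ℤ} {m : M} (hm : m ∈ ℳ e) (b : Fin r →₀ ℕ) (c : k) :
    monomial b c • m ∈ ℳ (e + Finsupp.weight n b) := by
  induction b using Finsupp.induction_linear generalizing e m c with
  | zero =>
    have : (monomial (0 : Fin r →₀ ℕ) c) • m = c • m := by
      rw [monomial_zero', ← mul_one (C c), ← smul_eq_C_mul, smul_assoc, one_smul]
    rw [this, map_zero, add_zero]
    exact Submodule.smul_mem _ _ hm
  | add f g hf hg =>
    have h1 : monomial (f + g) c = monomial f c * monomial g 1 := by
      rw [monomial_mul, mul_one]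
    rw [h1, mul_smul, map_add, add_comm (Finsupp.weight n f), ← add_assoc]
    exact hf (hg hm 1) c
  | single j a =>
    have h1 : monomial (Finsupp.single j a) c = C c * X j ^ a := by
      rw [X_pow_eq_monomial, C_mul_monomial, mul_one]
    have h2 : ∀ a : ℕ, (X j : MvPolynomial (Fin r) k) ^ a • m ∈ ℳ (e + a * n j) := by
      intro a
      induction a with
      | zero => simpa using hm
      | succ a ih =>
        rw [pow_succ', mul_smul]
        convert hX j _ _ ih using 2
        push_cast; ring
    rw [h1, ← smul_eq_C_mul, smul_assoc, Finsupp.weight_single, nsmul_eq_mul]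
    exact Submodule.smul_mem _ _ (h2 a)

include hX in
lemma degreeComponent_smul [DirectSum.Decomposition ℳ] {e : ℤ} {m : M} (hm : m ∈ ℳ e) (d : ℤ)
    (p : MvPolynomial (Fin r) k) :
    degreeComponent ℳ d (p • m) = weightedHomogeneousComponent n (d - e) p • m := by
  classical
  induction p using MvPolynomial.induction_on' with
  | monomial b c =>
    have h1 := monomial_smul_mem hX hm b c
    by_cases h : Finsupp.weight n b = d - e
    · rw [weightedHomogeneousComponent_of_mem (h ▸ isWeightedHomogeneous_monomial n b c rfl),
        if_pos rfl, (degreeComponent_eq_self_iff ℳ).mpr]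
      rw [h] at h1
      rwa [add_sub_cancel] at h1
    · rw [weightedHomogeneousComponent_of_mem (isWeightedHomogeneous_monomial n b c rfl),
        if_neg (Ne.symm h), zero_smul, degreeComponent_apply, DirectSum.decompose_of_mem_ne ℳ h1]
      intro h'; exact h (by linarith)
  | add p q hp hq => rw [add_smul, map_add, hp, hq, map_add, add_smul]

end Scalar

namespace MinimalFreeResolution

variable (F : MinimalFreeResolution n ℳ)

/-- The part of degree `d` of the localizations of `F_j`. -/
abbrev strand (d : ℤ) (j : ℕ) (S : Finset (Fin r)) :
    AddSubgroup (Loc (X : Fin r → MvPolynomial (Fin r) k)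
      (Fin (F.rank j) → MvPolynomial (Fin r) k) S) :=
  (freeDegreeProj n (F.deg j)).locStrand d S

lemma diff_freeDegreeProj (j : ℕ) (d : ℤ) (x : Fin (F.rank (j + 1)) → MvPolynomial (Fin r) k) :
    F.diff j ((freeDegreeProj n (F.deg (j + 1))).proj d x) =
      (freeDegreeProj n (F.deg j)).proj d (F.diff j x) := by
  refine map_freeDegreeProj _ _ (fun u d p => _root_.funext fun v => ?_) d x
  rw [freeDegreeProj_apply, Pi.smul_apply, Pi.smul_apply, smul_eq_mul, smul_eq_mul,
    ← weightedHomogeneousComponent_mul (F.diff_homogeneous j u v)]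
  congr 2; ring

/-- `Hⁱ` of the Čech complex with values in the cokernel of `F_{j+1} → F_j` vanishes in
degree `d`. -/
def ExactMod (d : ℤ) (j i : ℕ) : Prop :=
  CechExactMod (locSystem X (Fin (F.rank j) → MvPolynomial (Fin r) k)) (F.strand d j)
    (F.strand d (j + 1)) (locMap X (F.diff j)) ∅ Finset.univ i

lemma exact_strand (d : ℤ) (j : ℕ) (S : Finset (Fin r)) :
    ∀ x ∈ F.strand d (j + 1) S, locMap X (F.diff j) S x = 0 →
      ∃ y ∈ F.strand d (j + 2) S, locMap X (F.diff (j + 1)) S y = x :=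
  fun x hx h => DegreeProj.exists_mem_locStrand_of_exists (F.diff_freeDegreeProj (j + 1)) hx
    ((locMap_exact X (F.exact_succ j) S x).mp h)

lemma locMap_diff_diff (j : ℕ) (S : Finset (Fin r)) (x) :
    locMap X (F.diff j) S (locMap X (F.diff (j + 1)) S x) = 0 :=
  (locMap_exact X (F.exact_succ j) S _).mpr ⟨x, rfl⟩

/-- The Čech cohomology of `F_j` is concentrated in degree `r`, and bounded above there. -/
lemma cechExact_free (d : ℤ) (j i : ℕ) (hn : ∀ i, 0 < n i)
    (h : i = r → ∀ v, F.deg j v < d + ∑ l, n l) :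
    CechExact (locSystem X (Fin (F.rank j) → MvPolynomial (Fin r) k)) (F.strand d j) ∅
      Finset.univ i := by
  intro c hc hcoc
  obtain ⟨b, hb, hbc⟩ := exists_coboundary_of_nonneg hc
    (fun T hT => hcoc T (Finset.empty_subset _) (Finset.subset_univ _) hT) (by
      intro T hT v a ha
      by_cases hir : i = r
      · by_contra! hneg
        have h1 := mem_locStrand_free_iff.mp (hc T) v a ha
        have h2 : laurentWeight n a ≤ -∑ l, n l := by
          rw [laurentWeight, ← Finset.sum_neg_distrib]
          refine Finset.sum_le_sum fun l _ => ?_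
          nlinarith [hneg l, hn l]
        have := h hir v
        linarith
      · have : ∃ l, l ∉ T := by
          by_contra! hall
          rw [Finset.eq_univ_iff_forall.mpr hall, Finset.card_univ, Fintype.card_fin] at hT
          exact hir hT.symm
        obtain ⟨l, hl⟩ := this
        exact ⟨l, nonneg_of_coeff_locToLaurent_ne_zero ha hl⟩)
  exact ⟨b, hb, fun T _ _ hT => hbc T hT⟩

lemma exactMod_of_lt (d : ℤ) (j : ℕ) {i : ℕ} (hi : r < i) : F.ExactMod d j i := by
  intro c a _ _ _
  refine ⟨fun _ => 0, fun _ => 0, fun _ => zero_mem _, fun _ => zero_mem _, fun T _ _ hT => ?_⟩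
  have := T.card_le_univ
  rw [hT, Fintype.card_fin] at this
  omega

/-- Descending induction along the resolution, starting from `F_{j+t}` in the top degree `r`. -/
lemma exactMod_of_deg_lt (hn : ∀ i, 0 < n i) (d : ℤ) (t : ℕ) :
    ∀ j i : ℕ, i + t = r → (∀ v, F.deg (j + t) v < d + ∑ l, n l) → F.ExactMod d j i := by
  induction t with
  | zero =>
    intro j i hi h
    exact CechExact.exactMod_of_succ (isCoeffSystem_locSystem X)
      ((freeDegreeProj n _).locSystem_mem_locStrand d)
      (fun _ _ => locMap_locSystem X (F.diff j)) (DegreeProj.locMap_mem_locStrand (F.diff_freeDegreeProj j) d)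
      (F.exact_strand d j) (F.cechExact_free d j i hn fun _ => h)
      (F.exactMod_of_lt d (j + 1) (by omega)) (F.locMap_diff_diff j)
  | succ t ih =>
    intro j i hi h
    exact CechExact.exactMod_of_succ (isCoeffSystem_locSystem X)
      ((freeDegreeProj n _).locSystem_mem_locStrand d)
      (fun _ _ => locMap_locSystem X (F.diff j)) (DegreeProj.locMap_mem_locStrand (F.diff_freeDegreeProj j) d)
      (F.exact_strand d j) (F.cechExact_free d j i hn fun h => by omega)
      (ih (j + 1) (i + 1) (by omega) (by rwa [show j + 1 + t = j + (t + 1) by omega]))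
      (F.locMap_diff_diff j)

/-- The socle element `ζ_1⁻¹ ⋯ ζ_r⁻¹ v₀` of the top cohomology of `F_j`, as a cochain. -/
lemma exists_socle (j : ℕ) (v₀ : Fin (F.rank j)) :
    ∃ s : ∀ S, Loc (X : Fin r → MvPolynomial (Fin r) k)
        (Fin (F.rank j) → MvPolynomial (Fin r) k) S,
      (∀ S, s S ∈ F.strand (F.deg j v₀ - ∑ l, n l) j S) ∧
      locToLaurent k (F.rank j) Finset.univ (s Finset.univ) =
        Pi.single v₀ (AddMonoidAlgebra.single (fun _ => -1) 1) := by
  obtain ⟨x, hx⟩ := exists_locToLaurent_eq (k := k) (S := (Finset.univ : Finset (Fin r)))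
    (w := (Pi.single v₀ (AddMonoidAlgebra.single (fun _ => -1) 1) :
      Fin (F.rank j) → Laurent k r)) fun _ _ _ l hl => absurd (Finset.mem_univ l) hl
  have hmem : x ∈ F.strand (F.deg j v₀ - ∑ l, n l) j Finset.univ := by
    rw [mem_locStrand_free_iff, hx]
    intro v a ha
    by_cases hv : v = v₀
    · subst hv
      rw [Pi.single_eq_same, AddMonoidAlgebra.coeff_single] at ha
      rw [(Finsupp.single_apply_ne_zero.mp ha).1, laurentWeight]
      simp only [neg_mul, one_mul, Finset.sum_neg_distrib]
      ring
    · rw [Pi.single_eq_of_ne hv] at ha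
      simp at ha
  refine ⟨fun S => if h : S = Finset.univ then h ▸ x else 0, fun S => ?_, ?_⟩
  · by_cases h : S = Finset.univ
    · subst h
      simpa using hmem
    · simp only [dif_neg h]
      exact zero_mem _
  · simpa using hx

/-- Matrix entries of the differentials have no constant coefficient. -/
lemma exists_pos_of_coeff_diff_ne_zero {j : ℕ} {u : Fin (F.rank (j + 1))} {v : Fin (F.rank j)}
    {b : Fin r → ℤ} (h : (toLaurent k r (F.diff j (Pi.single u 1) v)).coeff b ≠ 0) :
    (∀ l, 0 ≤ b l) ∧ ∃ l, 0 < b l := by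
  rw [coeff_toLaurent] at h
  obtain ⟨h1, h2⟩ := ite_ne_right_iff.mp h
  refine ⟨h1, ?_⟩
  by_contra! h3
  apply h2
  have : (Finsupp.equivFunOnFinite.symm fun j => (b j).toNat) = 0 := by
    ext l
    simpa using h3 l
  rw [this]
  exact F.minimal j _ v

/-- If `F_{j+1}` has no generators in degrees above that of the generator `v₀` of `F_j`, then the
class of `ζ_1⁻¹ ⋯ ζ_r⁻¹ v₀` is not a boundary modulo the image of `F_{j+1}`. -/
lemma socle_ne (hn : ∀ i, 0 < n i) {j : ℕ} {v₀ : Fin (F.rank j)}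
    (hv₀ : ∀ w, F.deg (j + 1) w ≤ F.deg j v₀)
    {s : ∀ S, Loc (X : Fin r → MvPolynomial (Fin r) k)
        (Fin (F.rank j) → MvPolynomial (Fin r) k) S}
    (hs : locToLaurent k (F.rank j) Finset.univ (s Finset.univ) =
        Pi.single v₀ (AddMonoidAlgebra.single (fun _ => -1) 1))
    (b : ∀ S, Loc (X : Fin r → MvPolynomial (Fin r) k)
        (Fin (F.rank j) → MvPolynomial (Fin r) k) S)
    {a' : Loc (X : Fin r → MvPolynomial (Fin r) k)
        (Fin (F.rank (j + 1)) → MvPolynomial (Fin r) k) Finset.univ}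
    (ha' : a' ∈ F.strand (F.deg j v₀ - ∑ l, n l) (j + 1) Finset.univ) :
    s Finset.univ - coboundary (locSystem X _) ∅ b Finset.univ ≠
      locMap X (F.diff j) Finset.univ a' := by
  intro h
  have h1 := DFunLike.congr_fun (congrArg AddMonoidAlgebra.coeff
    (congrFun (congrArg (locToLaurent k (F.rank j) Finset.univ) h) v₀)) fun _ => -1
  rw [map_sub, hs, Pi.sub_apply, AddMonoidAlgebra.coeff_sub, Finsupp.sub_apply, Pi.single_eq_same,
    AddMonoidAlgebra.coeff_single, Finsupp.single_eq_same, locToLaurent_locMap] at h1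
  have h2 : (locToLaurent k (F.rank j) Finset.univ
      (coboundary (locSystem X _) ∅ b Finset.univ) v₀).coeff (fun _ => -1) = 0 := by
    rw [coboundary, map_sum, Finset.sum_apply, AddMonoidAlgebra.coeff_sum, Finsupp.finsetSum_apply]
    refine Finset.sum_eq_zero fun l _ => ?_
    rw [map_zsmul, Pi.smul_apply, locToLaurent_locSystem, AddMonoidAlgebra.coeff_smul,
      Finsupp.smul_apply]
    by_contra h3
    have h4 := nonneg_of_coeff_locToLaurent_ne_zero (j := l)
      (right_ne_zero_of_smul h3) (Finset.notMem_erase l _)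
    norm_num at h4
  rw [h2, sub_zero, laurentMap, AddMonoidAlgebra.coeff_sum, Finsupp.finsetSum_apply] at h1
  -- a term of the image of `a'` at `ζ_1⁻¹ ⋯ ζ_r⁻¹` forces a generator of `F_{j+1}` of larger degree
  obtain ⟨u, -, hu⟩ := Finset.exists_ne_zero_of_sum_ne_zero (h1 ▸ one_ne_zero)
  obtain ⟨e, c, hec, he, hc⟩ := exists_of_coeff_mul_ne_zero hu
  obtain ⟨he0, l, hl⟩ := F.exists_pos_of_coeff_diff_ne_zero he
  have h3 := mem_locStrand_free_iff.mp ha' u c hc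
  have h4 : laurentWeight n e + laurentWeight n c = -∑ l, n l := by
    rw [← laurentWeight_add, hec, laurentWeight]
    simp
  have h5 : 0 < laurentWeight n e :=
    Finset.sum_pos' (fun i _ => mul_nonneg (he0 i) (hn i).le) ⟨l, Finset.mem_univ l, mul_pos hl (hn l)⟩
  linarith [hv₀ u]

section Augmented

variable [DirectSum.Decomposition ℳ] [IsScalarTower k (MvPolynomial (Fin r) k) M]
  (hX : ∀ (j : Fin r) (d : ℤ), ∀ m ∈ ℳ d, (X j : MvPolynomial (Fin r) k) • m ∈ ℳ (d + n j))

lemma aug_freeDegreeProj (d : ℤ) (x : Fin (F.rank 0) → MvPolynomial (Fin r) k) :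
    F.aug ((freeDegreeProj n (F.deg 0)).proj d x) =
      (polynomialDegreeProj ℳ hX).proj d (F.aug x) :=
  map_freeDegreeProj _ _ (fun u d p =>
    degreeComponent_smul hX (F.aug_homogeneous u) d p) d x

lemma cechExact_iff_exactMod (d : ℤ) (i : ℕ) :
    CechExact (locSystem X M) ((polynomialDegreeProj ℳ hX).locStrand d) ∅ Finset.univ i ↔
      F.ExactMod d 0 i :=
  _root_.cechExact_iff_exactMod (f₁ := locMap X F.aug) (fun _ _ => locMap_locSystem X F.aug)
    (DegreeProj.locMap_mem_locStrand (F.aug_freeDegreeProj hX) d)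
    (fun S x => (locMap_exact X F.exact_zero S _).mpr ⟨x, rfl⟩)
    (fun S _ hx h => DegreeProj.exists_mem_locStrand_of_exists (F.diff_freeDegreeProj 0) hx
      ((locMap_exact X F.exact_zero S _).mp h))
    (fun S x hx => DegreeProj.exists_mem_locStrand_of_exists (F.aug_freeDegreeProj hX) hx
      (locMap_surjective X F.aug F.aug_surjective S x))
    ((freeDegreeProj n _).locSystem_mem_locStrand d) i

/-- `H^{i,d}` vanishes if all generators of `F_{r-i}` have degree less than `d + ∑ n_l`. -/
lemma cechExact_of_deg_lt (hn : ∀ i, 0 < n i) {d : ℤ} {i : ℕ}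
    (h : i ≤ r → ∀ v, F.deg (r - i) v < d + ∑ l, n l) :
    CechExact (locSystem X M) ((polynomialDegreeProj ℳ hX).locStrand d) ∅ Finset.univ i := by
  rw [F.cechExact_iff_exactMod hX]
  by_cases hi : i ≤ r
  · exact F.exactMod_of_deg_lt hn d (r - i) 0 i (by omega) (by rw [zero_add]; exact h hi)
  · exact F.exactMod_of_lt d 0 (by omega)

/-- A generator `v₀` of `F_j` whose degree is not exceeded by those of the generators of `F_{j+1}`
gives a nonzero class of degree `|v₀| - ∑ n_l` in `H^{r-j}`. -/
lemma not_cechExact (hn : ∀ i, 0 < n i) {j : ℕ} (hj : j ≤ r) {v₀ : Fin (F.rank j)}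
    (hv₀ : ∀ w, F.deg (j + 1) w ≤ F.deg j v₀) :
    ¬ CechExact (locSystem X M)
      ((polynomialDegreeProj ℳ hX).locStrand (F.deg j v₀ - ∑ l, n l)) ∅ Finset.univ (r - j) := by
  rw [F.cechExact_iff_exactMod hX]
  intro h
  obtain ⟨s, hsP, hs⟩ := F.exists_socle j v₀
  set d := F.deg j v₀ - ∑ l, n l with hd
  have huniv : (Finset.univ : Finset (Fin r)).card = r := by simp
  cases j with
  | zero =>
    obtain ⟨b, a', -, ha', hb⟩ := h s (fun _ => 0) hsP (fun _ => zero_mem _) fun T _ _ hT => by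
      have := T.card_le_univ
      rw [hT, Fintype.card_fin] at this
      omega
    exact F.socle_ne hn hv₀ hs b (ha' _) (hb _ (Finset.empty_subset _) subset_rfl huniv)
  | succ j =>
    -- climb from `M` to the image of `F_{j+1} → F_j`
    have climb : ∀ t, t ≤ j → F.ExactMod d t (r - (j + 1) + t) := by
      intro t
      induction t with
      | zero => intro _; exact h
      | succ t ih =>
        intro ht
        exact CechExactMod.succ (fun _ _ => locMap_locSystem X (F.diff t))
          (DegreeProj.locMap_mem_locStrand (F.diff_freeDegreeProj t) d) (F.locMap_diff_diff t)
          (F.exact_strand d t) (ih (by omega))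
          ((freeDegreeProj n _).locSystem_mem_locStrand d)
          (F.cechExact_free d t _ hn fun (h : r - (j + 1) + t + 1 = r) => by omega) (isCoeffSystem_locSystem X)
    have hr : r - (j + 1) + j + 1 = r := by omega
    -- the image of the class in the cohomology of `F_j` vanishes by minimality
    obtain ⟨c, hc, hcs⟩ := exists_coboundary_of_nonneg (i := r)
      (c := fun S => locMap X (F.diff j) S (s S))
      (fun S => DegreeProj.locMap_mem_locStrand (F.diff_freeDegreeProj j) d S _ (hsP S))
      (fun T hT => by
        have := T.card_le_univ
        rw [hT, Fintype.card_fin] at this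
        omega)
      (fun T hT v a ha => by
        have hT' : T = Finset.univ := by rw [← Finset.card_eq_iff_eq_univ, hT, Fintype.card_fin]
        subst hT'
        rw [locToLaurent_locMap, hs, laurentMap, AddMonoidAlgebra.coeff_sum,
          Finsupp.finsetSum_apply] at ha
        obtain ⟨u, -, hu⟩ := Finset.exists_ne_zero_of_sum_ne_zero ha
        obtain ⟨e, c, rfl, he, hc⟩ := exists_of_coeff_mul_ne_zero hu
        obtain ⟨-, l, hl⟩ := F.exists_pos_of_coeff_diff_ne_zero he
        refine ⟨l, ?_⟩
        by_cases huv : u = v₀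
        · subst huv
          rw [Pi.single_eq_same, AddMonoidAlgebra.coeff_single] at hc
          rw [(Finsupp.single_apply_ne_zero.mp hc).1, Pi.add_apply]
          omega
        · rw [Pi.single_eq_of_ne huv] at hc
          simp at hc)
    obtain ⟨b, a', -, ha', hb⟩ := CechExactMod.exists_of_map_eq_coboundary
      (fun _ _ => locMap_locSystem X (F.diff j)) (F.exact_strand d j) (climb j le_rfl)
      ((freeDegreeProj n _).locSystem_mem_locStrand d) hsP hc
      (fun T _ _ hT => (hcs T (hT.trans hr)).symm) (isCoeffSystem_locSystem X)
    exact F.socle_ne hn hv₀ hs b (ha' _)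
      (hb _ (Finset.empty_subset _) subset_rfl (huniv.trans hr.symm))

end Augmented

end MinimalFreeResolution

end Resolution

/-! ### The length of minimal resolutions -/

section Length

open MvPolynomial

variable {k : Type*} [Field k] {r : ℕ}

lemma mem_span_X_of_X_mul_mem {s : Set (Fin r)} {l : Fin r} (hl : l ∉ s)
    {p : MvPolynomial (Fin r) k}
    (h : X l * p ∈ Ideal.span ((X : Fin r → MvPolynomial (Fin r) k) '' s)) :
    p ∈ Ideal.span ((X : Fin r → MvPolynomial (Fin r) k) '' s) := by
  rw [mem_ideal_span_X_image] at h ⊢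
  intro b hb
  obtain ⟨i, hi, hib⟩ := h (Finsupp.single l 1 + b) (by
    rw [mem_support_iff, coeff_X_mul]
    exact mem_support_iff.mp hb)
  refine ⟨i, hi, ?_⟩
  have : l ≠ i := fun e => hl (e ▸ hi)
  simpa [Finsupp.single_eq_of_ne this.symm] using hib

lemma mem_span_X_iff_constantCoeff {p : MvPolynomial (Fin r) k} :
    p ∈ Ideal.span ((X : Fin r → MvPolynomial (Fin r) k) '' Set.univ) ↔ constantCoeff p = 0 := by
  rw [mem_ideal_span_X_image, constantCoeff_eq]
  constructor
  · intro h
    by_contra h0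
    obtain ⟨i, -, hi⟩ := h 0 (mem_support_iff.mpr h0)
    exact hi rfl
  · intro h b hb
    by_contra! h0
    have : b = 0 := Finsupp.ext fun i => h0 i (Set.mem_univ i)
    subst this
    exact mem_support_iff.mp hb h

lemma map_apply_mem {m m' : ℕ} (g : (Fin m → MvPolynomial (Fin r) k) →ₗ[MvPolynomial (Fin r) k]
    (Fin m' → MvPolynomial (Fin r) k)) {I : Ideal (MvPolynomial (Fin r) k)}
    {f : Fin m → MvPolynomial (Fin r) k} (hf : ∀ u, f u ∈ I) (v : Fin m') : g f v ∈ I := by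
  rw [pi_eq_sum_univ' f, map_sum, Finset.sum_apply]
  refine sum_mem fun u _ => ?_
  rw [map_smul, Pi.smul_apply, smul_eq_mul]
  exact I.mul_mem_right _ (hf u)

variable {n : Fin r → ℤ} {M : Type*} [AddCommGroup M] [Module k M]
  [Module (MvPolynomial (Fin r) k) M] {ℳ : ℤ → Submodule k M}

namespace MinimalFreeResolution

variable (F : MinimalFreeResolution n ℳ)

lemma diff_diff (j : ℕ) (x) : F.diff j (F.diff (j + 1) x) = 0 := (F.exact_succ j _).mpr ⟨x, rfl⟩

/-- `F/(ζ_1, …, ζ_m)F` is exact at `F_{j+1}` for `j ≥ m`, since `ζ_1, …, ζ_m` is a regular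
sequence on each term of the resolution. -/
lemma exists_sub_diff_mem (m : ℕ) (hm : m ≤ r) : ∀ j, m ≤ j →
    ∀ f : Fin (F.rank (j + 1)) → MvPolynomial (Fin r) k,
      (∀ v, F.diff j f v ∈ Ideal.span ((X : Fin r → MvPolynomial (Fin r) k) '' {l | (l : ℕ) < m})) →
      ∃ g, ∀ v, (f - F.diff (j + 1) g) v ∈
        Ideal.span ((X : Fin r → MvPolynomial (Fin r) k) '' {l | (l : ℕ) < m}) := by
  induction m with
  | zero =>
    intro j _ f hf
    simp only [Nat.not_lt_zero, Set.ofPred_false, Set.image_empty, Ideal.span_empty,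
      Ideal.mem_bot] at hf ⊢
    obtain ⟨g, hg⟩ := (F.exact_succ j f).mp (_root_.funext hf)
    exact ⟨g, fun v => by rw [hg, sub_self]; rfl⟩
  | succ m ih =>
    intro j hj f hf
    obtain ⟨j, rfl⟩ : ∃ i, j = i + 1 := ⟨j - 1, by omega⟩
    have hset : (X : Fin r → MvPolynomial (Fin r) k) '' {l | (l : ℕ) < m + 1} =
        insert (X ⟨m, hm⟩) ((X : Fin r → MvPolynomial (Fin r) k) '' {l | (l : ℕ) < m}) := by
      rw [← Set.image_insert_eq]
      congr 1
      ext l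
      simp only [Set.mem_ofPred_eq, Set.mem_insert_iff, Fin.ext_iff]
      omega
    rw [hset] at hf ⊢
    set I := Ideal.span ((X : Fin r → MvPolynomial (Fin r) k) '' {l | (l : ℕ) < m}) with hI
    choose h z hz hfz using fun v => Ideal.mem_span_insert.mp (hf v)
    have hfz' : F.diff (j + 1) f = (X ⟨m, hm⟩ : MvPolynomial (Fin r) k) • h + z := _root_.funext fun v => by
      rw [hfz, Pi.add_apply, Pi.smul_apply, smul_eq_mul, mul_comm]
    obtain ⟨g, hg⟩ := ih (by omega) j (by omega) h fun v => by
      refine mem_span_X_of_X_mul_mem (l := ⟨m, hm⟩) (by simp) ?_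
      have h1 := congrFun (F.diff_diff j f) v
      rw [hfz', map_add, map_smul, Pi.add_apply, Pi.smul_apply, smul_eq_mul, Pi.zero_apply] at h1
      rw [eq_neg_of_add_eq_zero_left h1]
      exact neg_mem (map_apply_mem _ hz v)
    obtain ⟨g', hg'⟩ := ih (by omega) (j + 1) (by omega) (f - (X ⟨m, hm⟩ : MvPolynomial (Fin r) k) • g) fun v => by
      rw [map_sub, map_smul, hfz', Pi.sub_apply, Pi.add_apply, Pi.smul_apply, Pi.smul_apply,
        add_sub_right_comm, ← smul_sub]
      exact add_mem (Ideal.mul_mem_left _ _ (hg v)) (hz v)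
    refine ⟨g', fun v => Ideal.mem_span_insert.mpr ⟨g v, _, hg' v, ?_⟩⟩
    simp only [Pi.sub_apply, Pi.smul_apply, smul_eq_mul]
    ring

/-- A minimal resolution over a polynomial ring in `r` variables has length at most `r`. -/
lemma rank_eq_zero {j : ℕ} (hj : r < j) : F.rank j = 0 := by
  obtain ⟨j, rfl⟩ : ∃ i, j = i + 1 := ⟨j - 1, by omega⟩
  by_contra h0
  let u : Fin (F.rank (j + 1)) := ⟨0, Nat.pos_of_ne_zero h0⟩
  have hset : {l : Fin r | (l : ℕ) < r} = Set.univ := Set.eq_univ_of_forall fun l => l.2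
  obtain ⟨g, hg⟩ := F.exists_sub_diff_mem r le_rfl j (by omega) (Pi.single u 1) fun v => by
    rw [hset, mem_span_X_iff_constantCoeff]
    exact F.minimal j _ v
  have h1 := hg u
  rw [hset, mem_span_X_iff_constantCoeff, Pi.sub_apply, map_sub, F.minimal, Pi.single_eq_same,
    map_one, sub_zero] at h1
  exact one_ne_zero h1

end MinimalFreeResolution

end Length

/-! ### Existence of minimal resolutions -/

section Existence

open MvPolynomial

variable {k : Type*} [Field k] {r : ℕ} {n : Fin r → ℤ}

/-- A weighted homogeneous polynomial of nonzero degree has no constant coefficient. -/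
lemma constantCoeff_eq_zero_of_isWeightedHomogeneous {p : MvPolynomial (Fin r) k} {d : ℤ}
    (hp : IsWeightedHomogeneous n p d) (hd : d ≠ 0) : constantCoeff p = 0 := by
  by_contra h
  exact hd (by simpa using (hp h).symm)

/-- The degree `0` component of a polynomial in variables of positive degree is constant. -/
lemma weightedHomogeneousComponent_zero_eq_C (hn : ∀ i, 0 < n i) (p : MvPolynomial (Fin r) k) :
    weightedHomogeneousComponent n 0 p = C (constantCoeff p) := by
  ext b
  rw [coeff_weightedHomogeneousComponent, coeff_C, constantCoeff_eq]
  by_cases hb : 0 = b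
  · subst hb; simp
  · rw [if_neg hb, if_neg]
    intro h
    rw [weight_eq_laurentWeight, laurentWeight,
      Finset.sum_eq_zero_iff_of_nonneg fun i _ => mul_nonneg (Int.natCast_nonneg _) (hn i).le] at h
    exact hb (Finsupp.ext fun i => Eq.symm (by simpa [(hn i).ne'] using h i (Finset.mem_univ i)))

variable {N : Type*} [AddCommGroup N] [Module (MvPolynomial (Fin r) k) N]

/-- A homogeneous finitely generated submodule `K` of a graded module has a finite set of homogeneous
generators whose relations have coefficients in `(ζ_1, …, ζ_r)`: take as few generators as
possible. -/
lemma exists_minimal_generators (hn : ∀ i, 0 < n i)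
    (D : DegreeProj (X : Fin r → MvPolynomial (Fin r) k) n N)
    (hsum : ∀ x, ∃ s : Finset ℤ, x = ∑ d ∈ s, D.proj d x)
    (hsmul : ∀ d e (p : MvPolynomial (Fin r) k) x, D.proj e x = x →
      D.proj d (p • x) = weightedHomogeneousComponent n (d - e) p • x)
    {K : Submodule (MvPolynomial (Fin r) k) N} (hK : ∀ x ∈ K, ∀ d, D.proj d x ∈ K) (hfg : K.FG) :
    ∃ (m : ℕ) (deg : Fin m → ℤ) (g : (Fin m → MvPolynomial (Fin r) k)
        →ₗ[MvPolynomial (Fin r) k] N),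
      (∀ u, D.proj (deg u) (g (Pi.single u 1)) = g (Pi.single u 1)) ∧ LinearMap.range g = K ∧
      ∀ w, g w = 0 → ∀ v, constantCoeff (w v) = 0 := by
  classical
  have hex : ∃ (m : ℕ) (deg : Fin m → ℤ) (y : Fin m → N),
      (∀ u, D.proj (deg u) (y u) = y u) ∧
        Submodule.span (MvPolynomial (Fin r) k) (Set.range y) = K := by
    obtain ⟨S, hS⟩ := hfg
    choose s hs using hsum
    let T : Finset N := S.biUnion fun x => (s x).image fun d => D.proj d x
    have hT : ∀ y ∈ T, ∃ d, D.proj d y = y := by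
      intro y hy
      obtain ⟨x, -, hx⟩ := Finset.mem_biUnion.mp hy
      obtain ⟨d, -, rfl⟩ := Finset.mem_image.mp hx
      exact ⟨d, D.proj_proj d x⟩
    have hrange : Set.range (fun u => (T.equivFin.symm u : N)) = T := by
      ext y
      constructor
      · rintro ⟨u, rfl⟩; exact (T.equivFin.symm u).2
      · intro hy; exact ⟨T.equivFin ⟨y, hy⟩, by simp⟩
    choose! deg hdeg using hT
    refine ⟨T.card, fun u => deg (T.equivFin.symm u), fun u => T.equivFin.symm u,
      fun u => hdeg _ (T.equivFin.symm u).2, ?_⟩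
    rw [hrange]
    apply le_antisymm
    · refine Submodule.span_le.mpr fun y hy => ?_
      obtain ⟨x, hx, hxy⟩ := Finset.mem_biUnion.mp (Finset.mem_coe.mp hy)
      obtain ⟨d, -, rfl⟩ := Finset.mem_image.mp hxy
      exact hK x (hS ▸ Submodule.subset_span hx) d
    · rw [← hS]
      refine Submodule.span_le.mpr fun x hx => ?_
      rw [SetLike.mem_coe, hs x]
      exact sum_mem fun d hd => Submodule.subset_span (Finset.mem_biUnion.mpr
        ⟨x, hx, Finset.mem_image_of_mem _ hd⟩)
  obtain ⟨deg, y, hy, hspan⟩ := Nat.find_spec hex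
  have hmin : ∀ m < Nat.find hex, ¬ _ := fun m hm => Nat.find_min hex hm
  generalize Nat.find hex = m at deg y hy hspan hmin
  have hsingle : ∀ u, Fintype.linearCombination (MvPolynomial (Fin r) k) y (Pi.single u 1) = y u :=
    fun u => by rw [Fintype.linearCombination_apply_single, one_smul]
  refine ⟨m, deg, Fintype.linearCombination (MvPolynomial (Fin r) k) y, fun u => ?_, ?_,
    fun w hw v => ?_⟩
  · rw [hsingle, hy]
  · rw [Fintype.range_linearCombination, hspan]
  · by_contra hv
    obtain ⟨m, rfl⟩ : ∃ m', m = m' + 1 := ⟨m - 1, by have := v.2; omega⟩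
    -- the component of degree `deg v` of the relation expresses `y v` by the other generators
    refine hmin m (Nat.lt_succ_self m) ⟨fun u => deg (v.succAbove u), fun u => y (v.succAbove u),
      fun u => hy _, ?_⟩
    rw [← hspan]
    apply le_antisymm
    · refine Submodule.span_mono ?_
      rintro _ ⟨u, rfl⟩
      exact ⟨_, rfl⟩
    · refine Submodule.span_le.mpr ?_
      have hoth : ∀ u, y (v.succAbove u) ∈ Submodule.span (MvPolynomial (Fin r) k)
          (Set.range fun u => y (v.succAbove u)) := fun u => Submodule.subset_span ⟨u, rfl⟩
      rintro _ ⟨u, rfl⟩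
      rcases eq_or_ne u v with rfl | huv
      · have h1 := congrArg (D.proj (deg u)) hw
        rw [Fintype.linearCombination_apply, map_zero, map_sum, Fin.sum_univ_succAbove _ u,
          hsmul _ _ _ _ (hy u), sub_self, weightedHomogeneousComponent_zero_eq_C hn] at h1
        have h2 : y u = (C (constantCoeff (w u))⁻¹ : MvPolynomial (Fin r) k) •
            (C (constantCoeff (w u)) : MvPolynomial (Fin r) k) • y u := by
          rw [← mul_smul, ← C_mul, inv_mul_cancel₀ hv, C_1, one_smul]
        rw [SetLike.mem_coe, h2, eq_neg_of_add_eq_zero_left h1]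
        refine Submodule.smul_mem _ _ (neg_mem (sum_mem fun l _ => ?_))
        rw [hsmul _ _ _ _ (hy _)]
        exact Submodule.smul_mem _ _ (hoth l)
      · obtain ⟨l, rfl⟩ := Fin.exists_succAbove_eq huv
        exact hoth l

lemma freeDegreeProj_smul {m : ℕ} (deg : Fin m → ℤ) (d e : ℤ) (p : MvPolynomial (Fin r) k)
    (x : Fin m → MvPolynomial (Fin r) k) (hx : (freeDegreeProj n deg).proj e x = x) :
    (freeDegreeProj n deg).proj d (p • x) = weightedHomogeneousComponent n (d - e) p • x := by
  refine _root_.funext fun v => ?_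
  have h1 := congrFun hx v
  rw [freeDegreeProj_apply] at h1
  rw [freeDegreeProj_apply, Pi.smul_apply, Pi.smul_apply, smul_eq_mul, smul_eq_mul,
    ← weightedHomogeneousComponent_mul (h1 ▸ weightedHomogeneousComponent_isWeightedHomogeneous _ _)]
  congr 2; ring

lemma freeDegreeProj_sum {m : ℕ} (deg : Fin m → ℤ) (x : Fin m → MvPolynomial (Fin r) k) :
    ∃ s : Finset ℤ, x = ∑ d ∈ s, (freeDegreeProj n deg).proj d x := by
  classical
  refine ⟨Finset.univ.biUnion fun v => (x v).support.image fun b => Finsupp.weight n b + deg v, ?_⟩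
  refine _root_.funext fun v => ?_
  ext b
  rw [Finset.sum_apply, coeff_sum]
  simp only [freeDegreeProj_apply, coeff_weightedHomogeneousComponent]
  by_cases hb : coeff b (x v) = 0
  · simp [hb]
  · rw [Finset.sum_eq_single (Finsupp.weight n b + deg v), if_pos (by ring)]
    · intro d _ hd
      rw [if_neg]
      intro h; apply hd; linarith
    · intro h
      refine absurd (Finset.mem_biUnion.mpr ⟨v, Finset.mem_univ v, ?_⟩) h
      exact Finset.mem_image_of_mem _ (mem_support_iff.mpr hb)

/-- A step in the construction of a minimal resolution: a graded free module with the homogeneous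
submodule `K` of relations that remain to be resolved. -/
structure ResolutionStage (k : Type*) [Field k] {r : ℕ} (n : Fin r → ℤ) where
  /-- the rank -/
  rank : ℕ
  /-- the degrees of the basis elements -/
  deg : Fin rank → ℤ
  /-- the relations -/
  K : Submodule (MvPolynomial (Fin r) k) (Fin rank → MvPolynomial (Fin r) k)
  proj_mem : ∀ x ∈ K, ∀ d, (freeDegreeProj n deg).proj d x ∈ K
  minimal : ∀ x ∈ K, ∀ v, constantCoeff (x v) = 0

/-- Minimal generators of a graded module, with their relations. -/
lemma exists_resolutionStage (hn : ∀ i, 0 < n i)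
    (D : DegreeProj (X : Fin r → MvPolynomial (Fin r) k) n N)
    (hsum : ∀ x, ∃ s : Finset ℤ, x = ∑ d ∈ s, D.proj d x)
    (hsmul : ∀ d e (p : MvPolynomial (Fin r) k) x, D.proj e x = x →
      D.proj d (p • x) = weightedHomogeneousComponent n (d - e) p • x)
    {K : Submodule (MvPolynomial (Fin r) k) N} (hK : ∀ x ∈ K, ∀ d, D.proj d x ∈ K) (hfg : K.FG) :
    ∃ (s : ResolutionStage k n) (g : (Fin s.rank → MvPolynomial (Fin r) k)
        →ₗ[MvPolynomial (Fin r) k] N),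
      (∀ u, D.proj (s.deg u) (g (Pi.single u 1)) = g (Pi.single u 1)) ∧ LinearMap.range g = K ∧
      LinearMap.ker g = s.K := by
  obtain ⟨m, deg, g, hg, hr, hmin⟩ := exists_minimal_generators hn D hsum hsmul hK hfg
  exact ⟨⟨m, deg, LinearMap.ker g, fun x hx d => by
    rw [LinearMap.mem_ker] at hx ⊢
    rw [map_freeDegreeProj D g (fun u d p => hsmul _ _ _ _ (hg u)), hx, map_zero],
    fun x hx v => hmin x hx v⟩, g, hg, hr, rfl⟩

theorem nonempty_minimalFreeResolution {M : Type*} [AddCommGroup M] [Module k M]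
    [Module (MvPolynomial (Fin r) k) M] [IsScalarTower k (MvPolynomial (Fin r) k) M]
    [Module.Finite (MvPolynomial (Fin r) k) M] (ℳ : ℤ → Submodule k M) [DirectSum.Decomposition ℳ]
    (hn : ∀ i, 0 < n i) (hX : ∀ (j : Fin r) (d : ℤ), ∀ m ∈ ℳ d,
      (X j : MvPolynomial (Fin r) k) • m ∈ ℳ (d + n j)) :
    Nonempty (MinimalFreeResolution n ℳ) := by
  classical
  obtain ⟨s₀, aug, haug, hr, hker⟩ := exists_resolutionStage hn (polynomialDegreeProj ℳ hX)
    (fun x => ⟨(DirectSum.decompose ℳ x).support, (DirectSum.sum_support_decompose ℳ x).symm⟩)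
    (fun d e p x hx => degreeComponent_smul hX ((degreeComponent_eq_self_iff ℳ).mp hx) d p)
    (K := ⊤) (fun _ _ _ => Submodule.mem_top) Module.Finite.fg_top
  have hnext : ∀ s : ResolutionStage k n, ∃ (s' : ResolutionStage k n)
      (g : (Fin s'.rank → MvPolynomial (Fin r) k) →ₗ[MvPolynomial (Fin r) k]
        (Fin s.rank → MvPolynomial (Fin r) k)),
      (∀ u, (freeDegreeProj n s.deg).proj (s'.deg u) (g (Pi.single u 1)) = g (Pi.single u 1)) ∧
      LinearMap.range g = s.K ∧ LinearMap.ker g = s'.K := fun s =>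
    exists_resolutionStage hn (freeDegreeProj n s.deg) (freeDegreeProj_sum s.deg)
      (freeDegreeProj_smul s.deg) s.proj_mem (IsNoetherian.noetherian s.K)
  choose next g hg hrange hker' using hnext
  let st : ℕ → ResolutionStage k n := fun j => Nat.rec s₀ (fun _ s => next s) j
  exact ⟨{
    rank := fun j => (st j).rank
    deg := fun j => (st j).deg
    diff := fun j => g (st j)
    aug := aug
    diff_homogeneous := fun j u v => by
      have h := congrFun (hg (st j) u) v
      rw [freeDegreeProj_apply] at h
      exact h ▸ weightedHomogeneousComponent_isWeightedHomogeneous _ _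
    aug_homogeneous := fun u => (degreeComponent_eq_self_iff ℳ).mp (haug u)
    aug_surjective := LinearMap.range_eq_top.mp hr
    exact_zero := LinearMap.exact_iff.mpr (hker.trans (hrange s₀).symm)
    exact_succ := fun j => LinearMap.exact_iff.mpr ((hker' (st j)).trans (hrange (st (j + 1))).symm)
    minimal := fun j w v => (st j).minimal _ (hrange (st j) ▸ ⟨w, rfl⟩) v }⟩

end Existence

/-! ### Existence of systems of parameters -/

section Parameters

variable {k H : Type*} [Field k] [Ring H] [Algebra k H] {𝒜 : ℤ → Submodule k H} [GradedAlgebra 𝒜]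

omit [GradedAlgebra 𝒜] in
lemma list_prod_mem_graded [SetLike.GradedMonoid 𝒜] {deg : H → ℤ} {l : List H}
    (hl : ∀ a ∈ l, a ∈ 𝒜 (deg a)) : l.prod ∈ 𝒜 (l.map deg).sum := by
  simpa using SetLike.list_prod_map_mem_graded l deg id hl

/-- Homogeneous elements of even degree are central. -/
lemma mem_center_of_even (hH : IsGradedCommutativeFG 𝒜) {d : ℤ} (hd : Even d) {h : H}
    (hh : h ∈ 𝒜 d) : h ∈ Subalgebra.center k H := by
  rw [Subalgebra.mem_center_iff]
  intro b
  induction b using DirectSum.Decomposition.inductionOn 𝒜 with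
  | zero => simp
  | @homogeneous i b =>
    rw [hH.graded_comm d i h b hh b.2, Int.negOnePow_even _ (hd.mul_right i), one_smul]
  | add a b ha hb => rw [add_mul, mul_add, ha, hb]

omit [GradedAlgebra 𝒜] in
lemma mul_comm_up_to_sign (hH : IsGradedCommutativeFG 𝒜) {i j : ℤ} {a b : H} (ha : a ∈ 𝒜 i)
    (hb : b ∈ 𝒜 j) : a * b = b * a ∨ a * b = -(b * a) := by
  rw [hH.graded_comm i j a b ha hb]
  rcases Int.even_or_odd (i * j) with h | h
  · left; rw [Int.negOnePow_even _ h, one_smul]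
  · right; rw [Int.negOnePow_odd _ h, Units.neg_smul, one_smul]

/-- A word in which a letter is repeated is a multiple of the square of that letter. -/
lemma list_prod_mem_of_not_nodup (hH : IsGradedCommutativeFG 𝒜) {deg : H → ℤ} {I : Ideal H}
    (l : List H) (hl : ∀ a ∈ l, a ∈ 𝒜 (deg a)) (hI : ∀ a ∈ l, a ^ 2 ∈ I) (hnd : ¬ l.Nodup) :
    l.prod ∈ I := by
  induction l with
  | nil => exact absurd List.nodup_nil hnd
  | cons a l ih =>
    rw [List.prod_cons]
    by_cases h : l.Nodup
    · have hal : a ∈ l := by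
        by_contra h'
        exact hnd (List.nodup_cons.mpr ⟨h', h⟩)
      obtain ⟨s, u, rfl⟩ := List.append_of_mem hal
      have ha := hl a List.mem_cons_self
      have hs : s.prod ∈ 𝒜 (s.map deg).sum := list_prod_mem_graded fun b hb =>
        hl b (List.mem_cons_of_mem _ (List.mem_append_left _ hb))
      have hcen : ∀ b, b * a ^ 2 = a ^ 2 * b := Subalgebra.mem_center_iff.mp
        (mem_center_of_even hH (d := 2 • deg a) ⟨deg a, by simp [two_mul]⟩
          (SetLike.pow_mem_graded 2 ha))
      have hmem : s.prod * u.prod * a ^ 2 ∈ I := I.mul_mem_left _ (hI a List.mem_cons_self)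
      rw [List.prod_append, List.prod_cons, ← mul_assoc]
      rcases mul_comm_up_to_sign hH ha hs with h | h <;> rw [h]
      · rw [mul_assoc, ← mul_assoc a, ← sq, ← hcen, ← mul_assoc]
        exact hmem
      · rw [neg_mul, mul_assoc, ← mul_assoc a, ← sq, ← hcen, ← mul_assoc]
        exact neg_mem hmem
    · exact I.mul_mem_left _ (ih (fun b hb => hl b (List.mem_cons_of_mem _ hb))
        (fun b hb => hI b (List.mem_cons_of_mem _ hb)) h)

/-- The squares of homogeneous generators form a system of parameters: a word in the generators of
large degree contains a repeated letter. -/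
theorem nonempty_parameterSystem (hH : IsGradedCommutativeFG 𝒜) :
    Nonempty (ParameterSystem 𝒜) := by
  classical
  obtain ⟨t, ht, hgen⟩ := hH.generated
  choose! deg hpos hmem using ht
  let y : Fin t.card → H := fun j => t.equivFin.symm j
  have hy : ∀ j, y j ∈ t := fun j => (t.equivFin.symm j).2
  have hy2 : ∀ j, y j ^ 2 ∈ 𝒜 (2 • deg (y j)) := fun j => SetLike.pow_mem_graded 2 (hmem _ (hy j))
  let x : Fin t.card → Subalgebra.center k H := fun j =>
    ⟨y j ^ 2, mem_center_of_even hH ⟨deg (y j), by simp [two_mul]⟩ (hy2 j)⟩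
  let I : Ideal H := Ideal.span (Set.range fun j => (x j : H))
  have hI : ∀ a ∈ t, a ^ 2 ∈ I := fun a ha =>
    Ideal.subset_span ⟨t.equivFin ⟨a, ha⟩, by simp [x, y]⟩
  let B : ℤ := ∑ a ∈ t, deg a
  let Q : Submodule k H :=
    { carrier := {h | ∀ N, B < N → degreeComponent 𝒜 N h ∈ I}
      add_mem' := fun ha hb N hN => by rw [map_add]; exact add_mem (ha N hN) (hb N hN)
      zero_mem' := fun N _ => by rw [map_zero]; exact zero_mem _
      smul_mem' := fun c a ha N hN => by
        rw [degreeComponent_apply, DirectSum.decompose_smul, DFinsupp.smul_apply, Submodule.coe_smul,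
          Algebra.smul_def]
        exact I.mul_mem_left _ (ha N hN) }
  have hQ : ∀ h, h ∈ Q := by
    intro h
    have hh : h ∈ Algebra.adjoin k (t : Set H) := hgen ▸ Algebra.mem_top
    rw [← Subalgebra.mem_toSubmodule, Algebra.adjoin_eq_span] at hh
    refine (Submodule.span_le.mpr fun w hw => ?_) hh
    obtain ⟨l, hl, rfl⟩ := Submonoid.exists_list_of_mem_closure hw
    intro N hN
    have hl' := list_prod_mem_graded fun a ha => hmem a (hl a ha)
    by_cases hd : (l.map deg).sum = N
    · rw [(degreeComponent_eq_self_iff 𝒜).mpr (hd ▸ hl')]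
      refine list_prod_mem_of_not_nodup hH l (fun a ha => hmem a (hl a ha))
        (fun a ha => hI a (hl a ha)) fun hnd => ?_
      rw [← List.sum_toFinset deg hnd] at hd
      have : ∑ a ∈ l.toFinset, deg a ≤ B := Finset.sum_le_sum_of_subset_of_nonneg
        (fun a ha => hl a (List.mem_toFinset.mp ha)) fun a ha _ => (hpos a ha).le
      exact absurd (hd ▸ this) (not_le.mpr hN)
    · rw [degreeComponent_apply, DirectSum.decompose_of_mem_ne 𝒜 hl' hd]
      exact zero_mem _
  refine ⟨⟨t.card, x, fun j => 2 • deg (y j), fun j => ?_, hy2, fun d hd h hh => ?_⟩⟩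
  · have := hpos _ (hy j)
    simp only [nsmul_eq_mul, Nat.cast_ofNat]
    omega
  · refine ⟨B.natAbs + 1, ?_⟩
    have h1 := SetLike.pow_mem_graded (B.natAbs + 1) hh
    have h2 := hQ (h ^ (B.natAbs + 1)) _ (show B < (B.natAbs + 1) • d by
      rw [nsmul_eq_mul]; push_cast
      nlinarith [le_abs_self B, abs_nonneg B])
    rwa [(degreeComponent_eq_self_iff 𝒜).mpr h1] at h2

end Parameters

/-! ### Comparison of degrees -/

section TopDegree

lemma topDegree_le_of_forall_exists {S T : Set ℤ} (h : ∀ a ∈ S, ∃ b ∈ T, a ≤ b) :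
    topDegree S ≤ topDegree T := by
  refine iSup₂_le fun a ha => ?_
  obtain ⟨b, hb, hab⟩ := h a ha
  exact (EReal.coe_le_coe_iff.mpr (Int.cast_le.mpr hab)).trans
    (le_iSup₂ (f := fun (n : ℤ) (_ : n ∈ T) => ((n : ℝ) : EReal)) b hb)

lemma topDegree_sub (S : Set ℤ) (d : ℤ) :
    topDegree S - ((d : ℝ) : EReal) = topDegree {a | a + d ∈ S} := by
  apply le_antisymm
  · rw [EReal.sub_le_iff_le_add (Or.inl (EReal.coe_ne_bot _)) (Or.inl (EReal.coe_ne_top _))]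
    refine iSup₂_le fun a ha => ?_
    have h1 : ((a - d : ℤ) : ℝ) ≤ topDegree {a | a + d ∈ S} :=
      le_iSup₂ (f := fun (n : ℤ) (_ : n ∈ {a | a + d ∈ S}) => ((n : ℝ) : EReal)) (a - d)
        (show a - d + d ∈ S by rwa [sub_add_cancel])
    have h2 : ((a : ℝ) : EReal) = ((a - d : ℤ) : ℝ) + ((d : ℝ) : EReal) := by
      rw [← EReal.coe_add, ← Int.cast_add, sub_add_cancel]
    rw [h2]
    exact add_le_add_left h1 _
  · refine iSup₂_le fun a ha => ?_
    rw [EReal.le_sub_iff_add_le (Or.inl (EReal.coe_ne_bot _)) (Or.inl (EReal.coe_ne_top _)),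
      ← EReal.coe_add]
    have h1 := le_iSup₂ (f := fun (n : ℤ) (_ : n ∈ S) => ((n : ℝ) : EReal)) (a + d) ha
    push_cast at h1
    exact h1

lemma iSup_topDegree {κ : Type*} (S : κ → Set ℤ) : ⨆ i, topDegree (S i) = topDegree (⋃ i, S i) := by
  simp only [topDegree, Set.mem_iUnion]
  rw [iSup_comm]
  refine iSup_congr fun a => ?_
  rw [iSup_exists]

end TopDegree

section Comparison

open MvPolynomial

variable {k H M : Type*} [Field k] [Ring H] [Algebra k H] {𝒜 : ℤ → Submodule k H} [GradedAlgebra 𝒜]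
  [AddCommGroup M] [Module k M] [Module H M] [IsScalarTower k H M]
  {ℳ : ℤ → Submodule k M} [DirectSum.Decomposition ℳ] [SetLike.GradedSMul 𝒜 ℳ]
  {r : ℕ} {n : Fin r → ℤ} [Module (MvPolynomial (Fin r) k) M]

/-- Above the degrees of its generators, `M` is contained in `(ζ_1, …, ζ_r) M`. -/
lemma MinimalFreeResolution.exists_eq_sum_X_smul [IsScalarTower k (MvPolynomial (Fin r) k) M]
    (F : MinimalFreeResolution n ℳ)
    (hX : ∀ (j : Fin r) (d : ℤ), ∀ m ∈ ℳ d, (X j : MvPolynomial (Fin r) k) • m ∈ ℳ (d + n j))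
    {d : ℤ} (hd : ∀ v, F.deg 0 v < d) {m : M} (hm : m ∈ ℳ d) :
    ∃ g : Fin r → M, m = ∑ i, (X i : MvPolynomial (Fin r) k) • g i := by
  obtain ⟨w, rfl⟩ := F.aug_surjective m
  have h1 : F.aug ((freeDegreeProj n (F.deg 0)).proj d w) = F.aug w := by
    rw [F.aug_freeDegreeProj hX]
    exact (degreeComponent_eq_self_iff ℳ).mpr hm
  have h2 : ∀ v, ∃ q : Fin r → MvPolynomial (Fin r) k,
      ∑ i, q i * X i = (freeDegreeProj n (F.deg 0)).proj d w v := by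
    intro v
    have h3 : (freeDegreeProj n (F.deg 0)).proj d w v ∈
        Ideal.span ((X : Fin r → MvPolynomial (Fin r) k) '' Set.univ) := by
      rw [mem_span_X_iff_constantCoeff, freeDegreeProj_apply]
      exact constantCoeff_eq_zero_of_isWeightedHomogeneous
        (weightedHomogeneousComponent_isWeightedHomogeneous _ _) (by linarith [hd v])
    rw [Set.image_univ] at h3
    exact (Submodule.mem_span_range_iff_exists_fun _).mp h3
  choose q hq using h2
  refine ⟨fun i => F.aug fun v => q v i, ?_⟩
  rw [← h1]
  simp only [← map_smul, ← map_sum]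
  congr 1
  funext v
  rw [← hq, Finset.sum_apply]
  exact Finset.sum_congr rfl fun i _ => mul_comm _ _

variable {φ : MvPolynomial (Fin r) k →ₐ[k] H} (hφ : ∀ i, φ (X i) ∈ 𝒜 (n i))
  (hsmul : ∀ (p : MvPolynomial (Fin r) k) (m : M), p • m = φ p • m)

include hsmul in
omit [GradedAlgebra 𝒜] [IsScalarTower k H M] in
/-- The central parameters act on `M` nilpotently modulo `(ζ_1, …, ζ_r) M`. -/
lemma MinimalFreeResolution.exists_pow_smul_eq_sum [IsScalarTower k (MvPolynomial (Fin r) k) M]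
    [SetLike.GradedMonoid 𝒜] (F : MinimalFreeResolution n ℳ)
    (hX : ∀ (j : Fin r) (d : ℤ), ∀ m ∈ ℳ d, (X j : MvPolynomial (Fin r) k) • m ∈ ℳ (d + n j))
    (Y : ParameterSystem 𝒜) (j : Fin Y.s) :
    ∃ K : ℕ, ∀ m : M, ∃ g : Fin r → M,
      Y.x j ^ K • m = ∑ i, (X i : MvPolynomial (Fin r) k) • g i := by
  have hcomm : ∀ (c : Subalgebra.center k H) (p : MvPolynomial (Fin r) k) (m : M),
      c • p • m = p • c • m := by
    intro c p m
    rw [hsmul, hsmul, Subalgebra.smul_def, Subalgebra.smul_def, ← mul_smul, ← mul_smul,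
      ← (Subalgebra.mem_center_iff.mp c.2 (φ p))]
  obtain ⟨K, hK⟩ : ∃ K : ℕ, ∀ u v, F.deg 0 u < F.deg 0 v + K := by
    refine ⟨(∑ u, ∑ v, (F.deg 0 u - F.deg 0 v).natAbs) + 1, fun u v => ?_⟩
    have h1 : (F.deg 0 u - F.deg 0 v).natAbs ≤ ∑ u, ∑ v, (F.deg 0 u - F.deg 0 v).natAbs :=
      (Finset.single_le_sum (f := fun v => (F.deg 0 u - F.deg 0 v).natAbs)
        (fun _ _ => Nat.zero_le _) (Finset.mem_univ v)).trans
        (Finset.single_le_sum (f := fun u => ∑ v, (F.deg 0 u - F.deg 0 v).natAbs)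
          (fun _ _ => Nat.zero_le _) (Finset.mem_univ u))
    omega
  refine ⟨K, fun m => ?_⟩
  have h1 : ∀ v, ∃ g : Fin r → M, Y.x j ^ K • F.aug (Pi.single v 1) =
      ∑ i, (X i : MvPolynomial (Fin r) k) • g i := by
    intro v
    refine F.exists_eq_sum_X_smul hX (d := K • Y.e j + F.deg 0 v) (fun u => ?_) ?_
    · rw [nsmul_eq_mul]
      nlinarith [hK u v, Y.e_pos j]
    · exact SetLike.GradedSMul.smul_mem (SetLike.pow_mem_graded K (Y.x_mem j))
        (F.aug_homogeneous v)
  choose g hg using h1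
  obtain ⟨w, rfl⟩ := F.aug_surjective m
  refine ⟨fun i => ∑ v, w v • g v i, ?_⟩
  conv_lhs => rw [pi_eq_sum_univ' w, map_sum, Finset.smul_sum]
  simp only [Finset.smul_sum]
  rw [Finset.sum_comm]
  refine Finset.sum_congr rfl fun v _ => ?_
  rw [map_smul, hcomm, hg, Finset.smul_sum]
  refine Finset.sum_congr rfl fun i _ => smul_comm _ _ _

variable [Module.Finite (MvPolynomial (Fin r) k) M] (hn : ∀ i, 0 < n i)
  (Y : ParameterSystem 𝒜) (F : MinimalFreeResolution n ℳ)

include hsmul in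
omit [GradedAlgebra 𝒜] [Module.Finite (MvPolynomial (Fin r) k) M] [DirectSum.Decomposition ℳ]
  [SetLike.GradedSMul 𝒜 ℳ] in
lemma isScalarTower_polynomial : IsScalarTower k (MvPolynomial (Fin r) k) M :=
  ⟨fun c p m => by rw [hsmul, hsmul, map_smul, smul_assoc]⟩

include hφ hsmul hn in
/-- `H^{i,c}` is nonzero only if `F_{r-i}` has a generator of degree at least `c + ∑ n_l`. -/
lemma exists_le_deg_of_mem {i : ℕ} {c : ℤ} (hc : c ∈ localCohomologyDegrees Y ℳ i) :
    i ≤ r ∧ ∃ v, c + ∑ l, n l ≤ F.deg (r - i) v := by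
  have := isScalarTower_polynomial (M := M) hsmul
  have hX := X_smul_mem ℳ hφ hsmul
  by_contra! h
  refine (notMem_localCohomologyDegrees_iff Y ℳ i c).mpr ?_ hc
  rw [cechExact_parameterSystem_iff ℳ hφ hsmul hn Y (F.exists_pow_smul_eq_sum hsmul hX Y) hX]
  exact F.cechExact_of_deg_lt hX hn h

include hφ hsmul hn in
/-- `MinimalFreeResolution.not_cechExact` for the local cohomology with respect to `𝔪`. -/
lemma sub_mem_localCohomologyDegrees {j : ℕ} (hj : j ≤ r) {v₀ : Fin (F.rank j)}
    (hv₀ : ∀ w, F.deg (j + 1) w ≤ F.deg j v₀) :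
    F.deg j v₀ - ∑ l, n l ∈ localCohomologyDegrees Y ℳ (r - j) := by
  have := isScalarTower_polynomial (M := M) hsmul
  have hX := X_smul_mem ℳ hφ hsmul
  by_contra h
  rw [notMem_localCohomologyDegrees_iff, cechExact_parameterSystem_iff ℳ hφ hsmul hn Y
    (F.exists_pow_smul_eq_sum hsmul hX Y) hX] at h
  exact F.not_cechExact hX hn hj hv₀ h

include hφ hsmul hn in
/-- A generator of `F_j` contributes to local cohomology, after passing along the resolution to a
generator of larger degree as long as there is one in the next step. -/
lemma exists_mem_localCohomologyDegrees {d : ℕ → ℤ} (hd : ∀ i < r, d i - 1 ≤ d (i + 1)) (i : ℕ) :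
    ∀ j, i + j = r → ∀ v : Fin (F.rank j), ∃ l ≤ r, ∃ c ∈ localCohomologyDegrees Y ℳ l,
      F.deg j v - d i - ∑ l, n l ≤ c - d l := by
  induction i with
  | zero =>
    intro j hj v
    obtain rfl : j = r := by omega
    refine ⟨0, Nat.zero_le _, _, ?_, le_of_eq (sub_right_comm _ _ _)⟩
    have := sub_mem_localCohomologyDegrees hφ hsmul hn Y F le_rfl (v₀ := v) fun w =>
      (Fin.cast (F.rank_eq_zero (Nat.lt_succ_self _)) w).elim0
    rwa [Nat.sub_self] at this
  | succ i ih =>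
    intro j hj v
    by_cases h : ∀ w, F.deg (j + 1) w ≤ F.deg j v
    · refine ⟨i + 1, by omega, _, ?_, le_of_eq (sub_right_comm _ _ _)⟩
      have := sub_mem_localCohomologyDegrees hφ hsmul hn Y F (by omega) h
      rwa [show r - j = i + 1 by omega] at this
    · push Not at h
      obtain ⟨w, hw⟩ := h
      obtain ⟨l, hl, c, hc, h1⟩ := ih (j + 1) (by omega) w
      exact ⟨l, hl, c, hc, by have := hd i (by omega); omega⟩

include hφ hsmul hn in
/-- The comparison of top degrees, with the shifted degrees of all `Hⁱ` and of all `F_{r-i}` collected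
in one set each. -/
lemma topDegree_eq {d : ℕ → ℤ} (hd : ∀ i < r, d i - 1 ≤ d (i + 1)) {S T : Set ℤ} {e : ℤ}
    (hS : ∀ a, a ∈ S ↔ ∃ i ≤ r, a + d i ∈ localCohomologyDegrees Y ℳ i)
    (hT : ∀ a, a ∈ T ↔ ∃ i ≤ r, a + d i ∈ Set.range (F.deg (r - i)))
    (he : e = ∑ l, n l) : topDegree S = topDegree T - ((e : ℝ) : EReal) := by
  subst he
  rw [topDegree_sub]
  apply le_antisymm
  · refine topDegree_le_of_forall_exists fun a ha => ?_
    obtain ⟨i, hi, ha⟩ := (hS a).mp ha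
    obtain ⟨-, v, hv⟩ := exists_le_deg_of_mem hφ hsmul hn Y F ha
    refine ⟨F.deg (r - i) v - d i - ∑ l, n l, (hT _).mpr ⟨i, hi, v, by ring⟩, by linarith⟩
  · refine topDegree_le_of_forall_exists fun a ha => ?_
    obtain ⟨i, hi, v, hv⟩ := (hT _).mp ha
    obtain ⟨l, hl, c, hc, h⟩ := exists_mem_localCohomologyDegrees hφ hsmul hn Y F hd i (r - i)
      (by omega) v
    exact ⟨c - d l, (hS _).mpr ⟨l, hl, by rwa [sub_add_cancel]⟩, by linarith⟩

end Comparison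

theorem theorem5p5 {k H M : Type*} [Field k] [Ring H] [Algebra k H]
    (𝒜 : ℤ → Submodule k H) [GradedAlgebra 𝒜] (hH : IsGradedCommutativeFG 𝒜)
    [AddCommGroup M] [Module k M] [Module H M] [IsScalarTower k H M]
    (ℳ : ℤ → Submodule k M) [DirectSum.Decomposition ℳ] [SetLike.GradedSMul 𝒜 ℳ]
    [Module.Finite H M]
    (r : ℕ) (hdim : moduleKrullDim H M = r)
    (n : Fin r → ℤ) (hn : ∀ i, 0 < n i)
    (φ : MvPolynomial (Fin r) k →ₐ[k] H) (hφ : ∀ i, φ (MvPolynomial.X i) ∈ 𝒜 (n i))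
    [Module (MvPolynomial (Fin r) k) M]
    (hsmul : ∀ (p : MvPolynomial (Fin r) k) (m : M), p • m = φ p • m)
    [Module.Finite (MvPolynomial (Fin r) k) M]
    (hreg : IsFilterRegular n ℳ) :
    Nonempty (ParameterSystem 𝒜) ∧ Nonempty (MinimalFreeResolution n ℳ) ∧
    ∀ (X : ParameterSystem 𝒜) (F : MinimalFreeResolution n ℳ),
      (∀ d : Fin (r + 1) → ℤ, IsTypeSequence d →
        (⨆ i : Fin (r + 1), (aInvariant X ℳ i - ((d i : ℝ) : EReal))) =
          (⨆ i : Fin (r + 1), (F.beta (r - i) - ((d i : ℝ) : EReal))) -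
            (((∑ j, n j : ℤ) : ℝ) : EReal)) ∧
      (⨆ i : ℕ, aInvariant X ℳ i) = (⨆ i : ℕ, F.beta i) - (((∑ j, n j : ℤ) : ℝ) : EReal) ∧
      regularity X ℳ =
        (⨆ i : ℕ, (F.beta i - ((i : ℝ) : EReal))) - (((∑ j, (n j - 1) : ℤ) : ℝ) : EReal) := by
  have := isScalarTower_polynomial (M := M) hsmul
  refine ⟨nonempty_parameterSystem hH,
    nonempty_minimalFreeResolution ℳ hn (X_smul_mem ℳ hφ hsmul), fun Y F => ?_⟩
  have hle : ∀ {i c}, c ∈ localCohomologyDegrees Y ℳ i → i ≤ r := fun h =>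
    (exists_le_deg_of_mem hφ hsmul hn Y F h).1
  have hle' : ∀ {j} (_ : Fin (F.rank j)), j ≤ r := fun {j} v => by
    by_contra! h
    exact (Fin.cast (F.rank_eq_zero h) v).elim0
  refine ⟨fun d hd => ?_, ?_, ?_⟩
  · let d' : ℕ → ℤ := fun i => if h : i < r + 1 then d ⟨i, h⟩ else 0
    have hd' : ∀ (i : ℕ) (h : i < r + 1), d' i = d ⟨i, h⟩ := fun i h => dif_pos h
    simp only [aInvariant, MinimalFreeResolution.beta, topDegree_sub, iSup_topDegree]
    rw [← topDegree_sub]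
    refine topDegree_eq hφ hsmul hn Y F (d := d') (fun i hi => ?_) (fun a => ?_) (fun a => ?_) rfl
    · rw [hd' i (by omega), hd' (i + 1) (by omega)]
      exact hd.1 ⟨i, hi⟩
    · rw [Set.mem_iUnion]
      exact ⟨fun ⟨i, hi⟩ => ⟨i, by omega, by rw [hd' i i.2]; exact hi⟩,
        fun ⟨i, hi, h⟩ => ⟨⟨i, by omega⟩, by rw [hd' i (by omega)] at h; exact h⟩⟩
    · rw [Set.mem_iUnion]
      exact ⟨fun ⟨i, hi⟩ => ⟨i, by omega, by rw [hd' i i.2]; exact hi⟩,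
        fun ⟨i, hi, h⟩ => ⟨⟨i, by omega⟩, by rw [hd' i (by omega)] at h; exact h⟩⟩
  · simp only [aInvariant, MinimalFreeResolution.beta, iSup_topDegree]
    refine topDegree_eq hφ hsmul hn Y F (d := 0) (fun i _ => ?_) (fun a => ?_) (fun a => ?_) rfl
    · simp
    · simp only [Set.mem_iUnion, Pi.zero_apply, add_zero]
      exact ⟨fun ⟨i, h⟩ => ⟨i, hle h, h⟩, fun ⟨i, _, h⟩ => ⟨i, h⟩⟩
    · simp only [Set.mem_iUnion, Pi.zero_apply, add_zero]
      exact ⟨fun ⟨j, v, h⟩ => ⟨r - j, Nat.sub_le _ _, by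
        rw [Nat.sub_sub_self (hle' v)]; exact ⟨v, h⟩⟩, fun ⟨i, _, h⟩ => ⟨r - i, h⟩⟩
  · have h1 : ∀ j : ℕ, aInvariant Y ℳ j + ((j : ℝ) : EReal) =
        topDegree {a | a + (-j : ℤ) ∈ localCohomologyDegrees Y ℳ j} := fun j => by
      rw [← topDegree_sub, Int.cast_neg, Int.cast_natCast, EReal.coe_neg, sub_eq_add_neg,
        neg_neg]; rfl
    have h2 : ∀ j : ℕ, F.beta j - ((j : ℝ) : EReal) =
        topDegree {a | a + (j : ℤ) ∈ Set.range (F.deg j)} := fun j => by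
      rw [← topDegree_sub, Int.cast_natCast]; rfl
    have h3 : ∑ j, (n j - 1) = ∑ j, n j - r := by simp
    simp only [regularity, h1, h2, iSup_topDegree]
    rw [h3]
    -- indexing by `j = r - i` instead of `i` shifts degrees by `r`
    refine (topDegree_eq hφ hsmul hn Y F (d := fun i => -i) (fun i _ => ?_) (fun a => ?_)
      (T := {a | a + (-r : ℤ) ∈ ⋃ j : ℕ, {a | a + (j : ℤ) ∈ Set.range (F.deg j)}})
      (fun a => ?_) rfl).trans ?_
    · push_cast; linarith
    · rw [Set.mem_iUnion]
      exact ⟨fun ⟨i, h⟩ => ⟨i, hle h, h⟩, fun ⟨i, _, h⟩ => ⟨i, h⟩⟩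
    · rw [Set.mem_ofPred_eq, Set.mem_iUnion]
      constructor
      · rintro ⟨j, v, h⟩
        have := hle' v
        refine ⟨r - j, Nat.sub_le _ _, ?_⟩
        rw [Nat.sub_sub_self this]
        exact ⟨v, by rw [h]; push_cast [this]; ring⟩
      · rintro ⟨i, hi, v, h⟩
        exact ⟨r - i, v, by rw [h]; push_cast [hi]; ring⟩
    · rw [topDegree_sub, topDegree_sub]
      congr 1
      ext a
      simp only [Set.mem_ofPred_eq]
      rw [add_assoc, sub_eq_add_neg]

end
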